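/- **The matching algorithm is a $\frac32$-approximation algorithm.** An instance consists of a finite undirected (multi)graph $G=(V,E)$ with edge costs $w_e\ge 0$, a root $r\in V$, and two sets $C_G, C_B\subseteq V\setminus\{r\}$ of green and blue terminals (possibly overlapping, possibly of different size). A capacity installation $x\in\mathbb{Z}_{\ge0}^E$ is feasible if, for each of the two colors separately, all terminals of that color can simultaneously send one unit of flow to $r$, each along a single path, so that every edge $e$ lies on at most $x_e$ of these paths. The cost of $x$ is $\sum_e w_e x_e$, and $\mathrm{OPT}$ is the minimum cost of a feasible installation. The matching algorithm: if $|C_G|\ne|C_B|$, first make the two sides equally large by adding dummy terminals located at $r$ to the smaller side. For every green $g$ and blue $b$ compute a minimum-cost Steiner tree $T_{g,b}$ in $G$ connecting $g$, $b$ and $r$; find a perfect matching $\mathcal M$ of minimum weight in the complete bipartite graph between the green and the blue side, where the edge $(g,b)$ has weight equal to the cost of $T_{g,b}$; and, for every pair $(g,b)\in\mathcal M$, cumulatively install one unit of capacity on each edge of $T_{g,b}$. For every instance that has a feasible solution: 1. the minimum $\mathrm{OPT}$ is attained, and every output of the matching algorithm (whatever minimum-cost Steiner trees and whatever minimum-weight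 perfect matching are chosen) is a feasible capacity installation of cost at most $\frac32\,\mathrm{OPT}$; 2. the matching algorithm runs in polynomial time: there are one fixed program, using only additions, (truncated) subtractions and comparisons on natural numbers, additions, subtractions and comparisons on edge costs, and indexed memory access, each counted as one step, and one polynomial $q$, such that on every such instance with $n$ vertices and $m$ edges the program halts after at most $q(n+m)$ steps with an output of the matching algorithm. -/

import Mathlib

/-- A two-color instance: a finite undirected multigraph with vertex set `V` and edge set `E`
(the order of the two ends of an edge has no meaning), nonnegative edge costs, a root and
two sets of terminals that avoid the root. The two sets may overlap and may differ in size. -/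
structure SandInstance (V E : Type*) where
  ends : E → V × V
  cost : E → ℝ
  cost_nonneg : ∀ e, 0 ≤ cost e
  root : V
  green : Finset V
  blue : Finset V
  root_notMem_green : root ∉ green
  root_notMem_blue : root ∉ blue

namespace SandInstance

variable {V E : Type*}

/-- The edge `e` joins `u` and `v`. -/
def Joins (I : SandInstance V E) (e : E) (u v : V) : Prop :=
  I.ends e = (u, v) ∨ I.ends e = (v, u)

/-- `I.IsWalk u p v`: the list `p` of steps (edge, vertex reached) is a walk from `u` to `v`. -/
def IsWalk (I : SandInstance V E) : V → List (E × V) → V → Prop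
  | u, [], v => u = v
  | u, s :: p, v => I.Joins s.1 u s.2 ∧ I.IsWalk s.2 p v

/-- A path is a walk that visits no vertex twice. -/
def IsPath (I : SandInstance V E) (u : V) (p : List (E × V)) (v : V) : Prop :=
  I.IsWalk u p v ∧ (u :: p.map Prod.snd).Nodup

/-- Under the capacities `x`, all vertices of `C` can simultaneously send one unit of flow to
the root, each along a single path: every edge lies on at most `x e` of the chosen paths. -/
def Routable (I : SandInstance V E) (C : Finset V) (x : E → ℕ) : Prop :=
  ∃ P : V → List (E × V), (∀ v ∈ C, I.IsPath v (P v) I.root) ∧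
    ∀ e, {v | v ∈ C ∧ e ∈ (P v).map Prod.fst}.ncard ≤ x e

/-- Feasible integer capacity installations: each color, separately, can be routed. -/
def Feasible (I : SandInstance V E) (x : E → ℕ) : Prop :=
  I.Routable I.green x ∧ I.Routable I.blue x

/-- The total cost of a capacity installation. -/
noncomputable def totalCost [Fintype E] (I : SandInstance V E) (x : E → ℕ) : ℝ :=
  ∑ e, I.cost e * x e

/-- `u` and `v` are joined by a walk all of whose edges belong to `T`. -/
def ConnectedIn (I : SandInstance V E) (T : Set E) (u v : V) : Prop :=
  ∃ p : List (E × V), I.IsWalk u p v ∧ ∀ s ∈ p, s.1 ∈ T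

/-- The subgraph with vertex set `U` and edge set `T` is a tree: it is connected, and acyclic
in the sense that no edge has its two ends connected by the remaining edges. -/
structure IsTree (I : SandInstance V E) (U : Set V) (T : Set E) : Prop where
  nonempty : U.Nonempty
  ends_mem : ∀ e ∈ T, (I.ends e).1 ∈ U ∧ (I.ends e).2 ∈ U
  connected : ∀ u ∈ U, ∀ v ∈ U, I.ConnectedIn T u v
  acyclic : ∀ e ∈ T, ¬ I.ConnectedIn (T \ {e}) (I.ends e).1 (I.ends e).2

/-- `T` is the edge set of a tree in the graph that contains all vertices of `X`. -/
def IsSteinerTree (I : SandInstance V E) (X : Set V) (T : Finset E) : Prop :=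
  ∃ U : Set V, X ⊆ U ∧ I.IsTree U (T : Set E)

/-- The cost of a set of edges. -/
noncomputable def treeCost (I : SandInstance V E) (T : Finset E) : ℝ :=
  ∑ e ∈ T, I.cost e

/-- `T` is a minimum-cost Steiner tree for the vertex set `X`. -/
def IsMinSteinerTree (I : SandInstance V E) (X : Set V) (T : Finset E) : Prop :=
  I.IsSteinerTree X T ∧ ∀ T' : Finset E, I.IsSteinerTree X T' → I.treeCost T ≤ I.treeCost T'

/-- The green side of the bipartite graph: the green terminals and, if there are fewer green than
blue terminals, as many dummy terminals as are missing. -/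
abbrev GreenSide (I : SandInstance V E) : Type _ :=
  {v // v ∈ I.green} ⊕ Fin (I.blue.card - I.green.card)

/-- The blue side of the bipartite graph: the blue terminals and, if there are fewer blue than
green terminals, as many dummy terminals as are missing. -/
abbrev BlueSide (I : SandInstance V E) : Type _ :=
  {v // v ∈ I.blue} ⊕ Fin (I.green.card - I.blue.card)

/-- The vertex at which an element of the green side sits; dummies sit at the root. -/
def greenVertex (I : SandInstance V E) : I.GreenSide → V
  | .inl v => v
  | .inr _ => I.root

/-- The vertex at which an element of the blue side sits; dummies sit at the root. -/
def blueVertex (I : SandInstance V E) : I.BlueSide → V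
  | .inl v => v
  | .inr _ => I.root

/-- `x` is a possible output of the matching algorithm: for some choice of a minimum-cost Steiner
tree `T g b` on `g`, `b` and the root for each pair `(g, b)`, and some perfect matching `M` of
minimum weight in the complete bipartite graph in which the pair `(g, b)` has as weight the cost
of `T g b`, the capacity `x e` is the number of matched pairs whose tree contains `e`. -/
def IsMatchingOutput (I : SandInstance V E) (x : E → ℕ) : Prop :=
  ∃ (T : I.GreenSide → I.BlueSide → Finset E) (M : I.GreenSide ≃ I.BlueSide),
    (∀ g b, I.IsMinSteinerTree {I.greenVertex g, I.blueVertex b, I.root} (T g b)) ∧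
    (∀ M' : I.GreenSide ≃ I.BlueSide,
      ∑ g, I.treeCost (T g (M g)) ≤ ∑ g, I.treeCost (T g (M' g))) ∧
    ∀ e, x e = {g | e ∈ T g (M g)}.ncard

end SandInstance

/-! ### A machine model with a step count

Programs of a small imperative language over two-dimensional arrays of natural numbers and of
real numbers. Only `+`, `-` and `≤` are available on numbers, the only real constant is `0`, and
each operation is charged one step. (On rational data, numbers gain at most a bounded number of
bits per step, so a polynomial number of steps also means polynomial time in the bit model.) -/

namespace Machine

/-- The memory: cell `[i, j]` of the natural-number array `a`, and of the real array `a`. -/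
structure State where
  nat : ℕ → ℕ → ℕ → ℕ
  real : ℕ → ℕ → ℕ → ℝ

/-- Natural-number expressions; `get a i j` reads cell `[i, j]` of array `a`. -/
inductive NExp where
  | lit (c : ℕ)
  | get (a : ℕ) (i j : NExp)
  | add (x y : NExp)
  | sub (x y : NExp)

/-- Real expressions; `get a i j` reads cell `[i, j]` of the real array `a`. -/
inductive RExp where
  | zero
  | get (a : ℕ) (i j : NExp)
  | add (x y : RExp)
  | sub (x y : RExp)

/-- Tests. -/
inductive Test where
  | natLe (x y : NExp)
  | realLe (x y : RExp)
  | neg (b : Test)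
  | conj (b c : Test)

/-- Commands. -/
inductive Cmd where
  | noop
  | setNat (a : ℕ) (i j x : NExp)
  | setReal (a : ℕ) (i j : NExp) (x : RExp)
  | seq (c d : Cmd)
  | cond (b : Test) (c d : Cmd)
  | loop (b : Test) (c : Cmd)

/-- The value of an expression (subtraction is truncated at `0`). -/
def NExp.eval (s : State) : NExp → ℕ
  | .lit c => c
  | .get a i j => s.nat a (i.eval s) (j.eval s)
  | .add x y => x.eval s + y.eval s
  | .sub x y => x.eval s - y.eval s

/-- The number of steps needed to evaluate an expression: one for each operation. -/
def NExp.steps : NExp → ℕ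
  | .lit _ => 1
  | .get _ i j => i.steps + j.steps + 1
  | .add x y => x.steps + y.steps + 1
  | .sub x y => x.steps + y.steps + 1

/-- The value of a real expression. -/
noncomputable def RExp.eval (s : State) : RExp → ℝ
  | .zero => 0
  | .get a i j => s.real a (i.eval s) (j.eval s)
  | .add x y => x.eval s + y.eval s
  | .sub x y => x.eval s - y.eval s

/-- The number of steps needed to evaluate a real expression. -/
def RExp.steps : RExp → ℕ
  | .zero => 1
  | .get _ i j => i.steps + j.steps + 1
  | .add x y => x.steps + y.steps + 1
  | .sub x y => x.steps + y.steps + 1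

/-- The test succeeds in the state `s`. -/
def Test.Holds (s : State) : Test → Prop
  | .natLe x y => x.eval s ≤ y.eval s
  | .realLe x y => x.eval s ≤ y.eval s
  | .neg b => ¬ b.Holds s
  | .conj b c => b.Holds s ∧ c.Holds s

/-- The number of steps needed to evaluate a test. -/
def Test.steps : Test → ℕ
  | .natLe x y => x.steps + y.steps + 1
  | .realLe x y => x.steps + y.steps + 1
  | .neg b => b.steps + 1
  | .conj b c => b.steps + c.steps + 1

/-- Write `x` into cell `[i, j]` of the natural-number array `a`. -/
def State.writeNat (s : State) (a i j x : ℕ) : State where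
  nat := fun a' i' j' => if a' = a ∧ i' = i ∧ j' = j then x else s.nat a' i' j'
  real := s.real

/-- Write `x` into cell `[i, j]` of the real array `a`. -/
def State.writeReal (s : State) (a i j : ℕ) (x : ℝ) : State where
  nat := s.nat
  real := fun a' i' j' => if a' = a ∧ i' = i ∧ j' = j then x else s.real a' i' j'

/-- `Exec c s t s'`: started in the state `s`, the command `c` halts after exactly `t` steps in
the state `s'`. -/
inductive Exec : Cmd → State → ℕ → State → Prop where
  | noop (s : State) : Exec .noop s 1 s
  | setNat (s : State) (a : ℕ) (i j x : NExp) :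
      Exec (.setNat a i j x) s (i.steps + j.steps + x.steps + 1)
        (s.writeNat a (i.eval s) (j.eval s) (x.eval s))
  | setReal (s : State) (a : ℕ) (i j : NExp) (x : RExp) :
      Exec (.setReal a i j x) s (i.steps + j.steps + x.steps + 1)
        (s.writeReal a (i.eval s) (j.eval s) (x.eval s))
  | seq {c d : Cmd} {s s' s'' : State} {t t' : ℕ} :
      Exec c s t s' → Exec d s' t' s'' → Exec (.seq c d) s (t + t') s''
  | condTrue {b : Test} {c d : Cmd} {s s' : State} {t : ℕ} :
      b.Holds s → Exec c s t s' → Exec (.cond b c d) s (b.steps + t + 1) s'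
  | condFalse {b : Test} {c d : Cmd} {s s' : State} {t : ℕ} :
      ¬ b.Holds s → Exec d s t s' → Exec (.cond b c d) s (b.steps + t + 1) s'
  | loopDone {b : Test} {c : Cmd} {s : State} :
      ¬ b.Holds s → Exec (.loop b c) s (b.steps + 1) s
  | loopStep {b : Test} {c : Cmd} {s s' s'' : State} {t t' : ℕ} :
      b.Holds s → Exec c s t s' → Exec (.loop b c) s' t' s'' →
        Exec (.loop b c) s (b.steps + t + t' + 1) s''

open Classical in
/-- The natural-number part of the input: array `0` holds in row `0` the number of vertices, the
number of edges and the root; array `1` holds in row `e` the two ends of the edge `e`; array `2`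
holds in row `v` two flags that tell whether `v` is a green and whether `v` is a blue terminal.
All other cells are `0`. -/
noncomputable def inputNat {n m : ℕ} (I : SandInstance (Fin n) (Fin m)) : ℕ → ℕ → ℕ → ℕ
  | 0, 0, 0 => n
  | 0, 0, 1 => m
  | 0, 0, 2 => I.root
  | 1, e, 0 => if h : e < m then (I.ends ⟨e, h⟩).1 else 0
  | 1, e, 1 => if h : e < m then (I.ends ⟨e, h⟩).2 else 0
  | 2, v, 0 => if ∃ h : v < n, (⟨v, h⟩ : Fin n) ∈ I.green then 1 else 0
  | 2, v, 1 => if ∃ h : v < n, (⟨v, h⟩ : Fin n) ∈ I.blue then 1 else 0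
  | _, _, _ => 0

/-- The real part of the input: array `0` holds in row `e` the cost of the edge `e`. All other
cells are `0`. -/
noncomputable def inputReal {n m : ℕ} (I : SandInstance (Fin n) (Fin m)) : ℕ → ℕ → ℕ → ℝ
  | 0, e, 0 => if h : e < m then I.cost ⟨e, h⟩ else 0
  | _, _, _ => 0

/-- The initial memory on the instance `I`. -/
noncomputable def input {n m : ℕ} (I : SandInstance (Fin n) (Fin m)) : State where
  nat := inputNat I
  real := inputReal I

/-- The output: the capacity of the edge `e` is read from row `e` of array `3`. -/
def output (m : ℕ) (s : State) : Fin m → ℕ :=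
  fun e => s.nat 3 e 0

end Machine

/-! ### Walks, paths, connectivity and Steiner trees on three vertices -/

namespace SandInstance

variable {V E : Type*}

/-! The cost bound is linear programming duality used twice, and it yields the factor 4/3, which is
better than the stated 3/2. On the matching side there are prices `p`, `q` with `p g + q b` at most
the cost of `T g b` whose total is the minimum matching weight (`exists_optimal_prices`). On the
installation side, two functions α, β on the vertices that vanish at the root and satisfy |Δα| +
|Δβ| ≤ cost on every edge bound the cost of each feasible installation from below by the sum of α
over the green plus the sum of β over the blue terminals (`Feasible.sum_add_sum_le`).

Prices become potentials: P₀(z) is the maximum of p g − d(g, z) over g, and Q₀ is defined likewise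
from q. Three walks that meet at z contain a Steiner tree, so P₀ + Q₀ ≤ D, where D is the distance
from the root. Subtract P₀(root) from P₀, add it to Q₀, and truncate both at 0; the shift costs
nothing because both sides have equally many members. The results P, Q are nonnegative, vanish at
the root, satisfy P + Q ≤ D, and, like D, change by at most the cost along an edge. Hence ((D+P)/2,
(D−P)/2) and ((D−Q)/2, (D+Q)/2) are both admissible pairs. Adding their two lower bounds, a green
terminal contributes D + (P−Q)/2 ≥ 3P/2 and a blue one D + (Q−P)/2 ≥ 3Q/2. So 3/2 times the matching
weight is at most 2 OPT (`Feasible.sum_potentials_le`, `Feasible.sum_prices_le`).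

For the running time, a minimum Steiner tree on three vertices costs as much as the best star of
shortest paths from a common center z. Trying every z as the root of a shortest-path tree gives all
costs, and the union of three paths of one such tree is again a tree
(`IsShortestPathTree.isSteinerTree`). The Hungarian algorithm then returns a matching together with
prices that certify it; the correctness proof of this program also serves as the proof of matching
duality used above.

The program is written in a language `Prog` whose loops all run n or m times, so a polynomial step
bound follows by induction on its syntax. `Prog.exec_compile` transfers it to the machine, and
correctness is shown by loop invariants for `Prog.run`. -/

theorem Joins.symm {I : SandInstance V E} {e : E} {u v : V} (h : I.Joins e u v) :
    I.Joins e v u := Or.symm h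

theorem Joins.eq_or_eq {I : SandInstance V E} {e : E} {a b c d : V} (h : I.Joins e a b)
    (h' : I.Joins e c d) : a = c ∨ a = d := by
  unfold Joins at h h'
  rcases h with h | h <;> rcases h' with h' | h' <;> simp_all

theorem joins_ends (I : SandInstance V E) (e : E) : I.Joins e (I.ends e).1 (I.ends e).2 :=
  Or.inl rfl

theorem IsWalk.append {I : SandInstance V E} {p q : List (E × V)} {u v w : V}
    (hp : I.IsWalk u p v) (hq : I.IsWalk v q w) : I.IsWalk u (p ++ q) w := by
  induction p generalizing u with
  | nil => cases hp; exact hq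
  | cons s p ih => exact ⟨hp.1, ih hp.2⟩

theorem IsWalk.exists_reverse {I : SandInstance V E} {p : List (E × V)} {u v : V}
    (hp : I.IsWalk u p v) :
    ∃ q, I.IsWalk v q u ∧ q.map Prod.fst = (p.map Prod.fst).reverse := by
  induction p generalizing u with
  | nil => cases hp; exact ⟨[], rfl, rfl⟩
  | cons s p ih =>
    obtain ⟨q, hq, hqe⟩ := ih hp.2
    exact ⟨q ++ [(s.1, u)], hq.append ⟨hp.1.symm, rfl⟩, by simp [hqe]⟩

theorem IsWalk.mem_of_joins {I : SandInstance V E} {p : List (E × V)} {u v : V}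
    (hp : I.IsWalk u p v) {e : E} (he : e ∈ p.map Prod.fst) {a b : V} (hab : I.Joins e a b) :
    a ∈ u :: p.map Prod.snd := by
  induction p generalizing u with
  | nil => simp at he
  | cons s p ih =>
    rw [List.map_cons, List.mem_cons] at he
    rcases he with rfl | he
    · rcases hab.eq_or_eq hp.1 with rfl | rfl <;> simp
    · exact List.mem_cons_of_mem _ (ih hp.2 he)

/-- An edge used again later would have the starting vertex as an end, and so bring the path back to
that vertex. -/
theorem IsPath.nodup_edges {I : SandInstance V E} {p : List (E × V)} {u v : V}
    (hp : I.IsPath u p v) : (p.map Prod.fst).Nodup := by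
  induction p generalizing u with
  | nil => simp
  | cons s p ih =>
    obtain ⟨hw, hn⟩ := hp
    rw [List.nodup_cons] at hn
    rw [List.map_cons, List.nodup_cons]
    refine ⟨fun h => hn.1 ?_, ih ⟨hw.2, by simpa using hn.2⟩⟩
    exact hw.2.mem_of_joins h hw.1

/-- The part of a path from one of its vertices on. -/
theorem IsPath.exists_drop {I : SandInstance V E} {p : List (E × V)} {u v w : V}
    (hp : I.IsPath u p v) (hw : w ∈ u :: p.map Prod.snd) :
    ∃ q r, p = r ++ q ∧ I.IsPath w q v ∧ I.IsWalk u r w := by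
  induction p generalizing u with
  | nil =>
    obtain rfl : w = u := by simpa using hw
    exact ⟨[], [], rfl, hp, rfl⟩
  | cons s p ih =>
    rcases List.mem_cons.1 hw with rfl | hw
    · exact ⟨s :: p, [], rfl, hp, rfl⟩
    · obtain ⟨q, r, rfl, hq, hr⟩ := ih ⟨hp.1.2, (List.nodup_cons.1 hp.2).2⟩ hw
      exact ⟨q, s :: r, rfl, hq, hp.1.1, hr⟩

theorem IsWalk.exists_isPath {I : SandInstance V E} {p : List (E × V)} {u v : V}
    (hp : I.IsWalk u p v) :
    ∃ q, I.IsPath u q v ∧ q.map Prod.fst ⊆ p.map Prod.fst := by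
  induction p generalizing u with
  | nil => exact ⟨[], ⟨hp, by simp⟩, by simp⟩
  | cons s p ih =>
    obtain ⟨q, hq, hqp⟩ := ih hp.2
    by_cases hu : u ∈ s.2 :: q.map Prod.snd
    · obtain ⟨q', r, rfl, hq', -⟩ := hq.exists_drop hu
      refine ⟨q', hq', fun e he => List.mem_cons_of_mem _ (hqp ?_)⟩
      simp only [List.map_append, List.mem_append]
      exact Or.inr he
    · refine ⟨s :: q, ⟨⟨hp.1, hq.1⟩, List.nodup_cons.2 ⟨hu, hq.2⟩⟩, ?_⟩
      exact List.cons_subset_cons _ hqp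

/-- The cost of a walk. -/
noncomputable def walkCost (I : SandInstance V E) (p : List (E × V)) : ℝ :=
  (p.map fun s => I.cost s.1).sum

theorem walkCost_nonneg (I : SandInstance V E) (p : List (E × V)) : 0 ≤ I.walkCost p := by
  refine List.sum_nonneg fun x hx => ?_
  obtain ⟨_, -, rfl⟩ := List.mem_map.1 hx
  exact I.cost_nonneg _

theorem walkCost_append (I : SandInstance V E) (p q : List (E × V)) :
    I.walkCost (p ++ q) = I.walkCost p + I.walkCost q := by
  simp [walkCost]

theorem walkCost_eq_of_edges (I : SandInstance V E) (p : List (E × V)) :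
    I.walkCost p = ((p.map Prod.fst).map I.cost).sum := by
  simp [walkCost, Function.comp_def]

theorem IsWalk.exists_reverse_cost {I : SandInstance V E} {p : List (E × V)} {u v : V}
    (hp : I.IsWalk u p v) : ∃ q, I.IsWalk v q u ∧ I.walkCost q = I.walkCost p := by
  obtain ⟨q, hq, hqe⟩ := hp.exists_reverse
  refine ⟨q, hq, ?_⟩
  rw [walkCost_eq_of_edges, walkCost_eq_of_edges, hqe, List.map_reverse, List.sum_reverse]

theorem ConnectedIn.refl (I : SandInstance V E) (T : Set E) (u : V) : I.ConnectedIn T u u :=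
  ⟨[], rfl, by simp⟩

theorem ConnectedIn.trans {I : SandInstance V E} {T : Set E} {u v w : V}
    (h : I.ConnectedIn T u v) (h' : I.ConnectedIn T v w) : I.ConnectedIn T u w := by
  obtain ⟨p, hp, hpT⟩ := h
  obtain ⟨q, hq, hqT⟩ := h'
  refine ⟨p ++ q, hp.append hq, fun s hs => ?_⟩
  rcases List.mem_append.1 hs with hs | hs
  exacts [hpT s hs, hqT s hs]

theorem IsWalk.connectedIn {I : SandInstance V E} {T : Set E} {p : List (E × V)} {u v : V}
    (hp : I.IsWalk u p v) (hT : ∀ e ∈ p.map Prod.fst, e ∈ T) : I.ConnectedIn T u v :=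
  ⟨p, hp, fun _ hs => hT _ (List.mem_map_of_mem hs)⟩

theorem ConnectedIn.symm {I : SandInstance V E} {T : Set E} {u v : V}
    (h : I.ConnectedIn T u v) : I.ConnectedIn T v u := by
  obtain ⟨p, hp, hpT⟩ := h
  obtain ⟨q, hq, hqe⟩ := hp.exists_reverse
  refine hq.connectedIn fun e he => ?_
  rw [hqe, List.mem_reverse] at he
  obtain ⟨s, hs, rfl⟩ := List.mem_map.1 he
  exact hpT s hs

theorem ConnectedIn.mono {I : SandInstance V E} {T T' : Set E} {u v : V} (hT : T ⊆ T')
    (h : I.ConnectedIn T u v) : I.ConnectedIn T' u v := by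
  obtain ⟨p, hp, hpT⟩ := h
  exact ⟨p, hp, fun s hs => hT (hpT s hs)⟩

theorem Joins.connectedIn {I : SandInstance V E} {T : Set E} {e : E} {u v : V}
    (h : I.Joins e u v) (he : e ∈ T) : I.ConnectedIn T u v :=
  ⟨[(e, v)], ⟨h, rfl⟩, by simpa using he⟩

theorem ConnectedIn.exists_isPath {I : SandInstance V E} {T : Set E} {u v : V}
    (h : I.ConnectedIn T u v) : ∃ p, I.IsPath u p v ∧ ∀ e ∈ p.map Prod.fst, e ∈ T := by
  obtain ⟨p, hp, hpT⟩ := h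
  obtain ⟨q, hq, hqp⟩ := hp.exists_isPath
  refine ⟨q, hq, fun e he => ?_⟩
  obtain ⟨s, hs, rfl⟩ := List.mem_map.1 (hqp he)
  exact hpT s hs

/-- If all ends of edges of `T` satisfy an invariant together, connected vertices do. -/
theorem ConnectedIn.invariant {I : SandInstance V E} {T : Set E} {f : V → Prop}
    (hf : ∀ e ∈ T, ∀ u v, I.Joins e u v → (f u ↔ f v)) {u v : V} (h : I.ConnectedIn T u v) :
    f u ↔ f v := by
  obtain ⟨p, hp, hpT⟩ := h
  induction p generalizing u with
  | nil => cases hp; rfl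
  | cons s p ih =>
    exact (hf _ (hpT s (by simp)) _ _ hp.1).trans
      (ih hp.2 fun t ht => hpT t (List.mem_cons_of_mem _ ht))

/-- Replacing an edge by a detour. -/
theorem ConnectedIn.of_detour {I : SandInstance V E} {T T' : Set E}
    (hT : ∀ e ∈ T, e ∈ T' ∨ I.ConnectedIn T' (I.ends e).1 (I.ends e).2) {u v : V}
    (h : I.ConnectedIn T u v) : I.ConnectedIn T' u v := by
  obtain ⟨p, hp, hpT⟩ := h
  induction p generalizing u with
  | nil => cases hp; exact .refl _ _ _
  | cons s p ih =>
    refine ConnectedIn.trans ?_ (ih hp.2 fun t ht => hpT t (List.mem_cons_of_mem _ ht))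
    rcases hT _ (hpT s (by simp)) with h | h
    · exact hp.1.connectedIn h
    · rcases hp.1 with h' | h'
      · rw [h'] at h; exact h
      · rw [h'] at h; exact h.symm

theorem treeCost_mono (I : SandInstance V E) {T T' : Finset E} (h : T ⊆ T') :
    I.treeCost T ≤ I.treeCost T' :=
  Finset.sum_le_sum_of_subset_of_nonneg h fun e _ _ => I.cost_nonneg e

theorem treeCost_nonneg (I : SandInstance V E) (T : Finset E) : 0 ≤ I.treeCost T :=
  Finset.sum_nonneg fun e _ => I.cost_nonneg e

/-- A set of edges that connects `X` to `r` contains a Steiner tree. -/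
theorem exists_isSteinerTree_subset (I : SandInstance V E) (X : Set V) (r : V) (F : Finset E)
    (hF : ∀ v ∈ X, I.ConnectedIn (F : Set E) r v) :
    ∃ T ⊆ F, I.IsSteinerTree X T := by
  classical
  induction hn : F.card using Nat.strong_induction_on generalizing F with
  | _ n ih =>
  by_cases hmin : ∃ e ∈ F, ∀ v ∈ X, I.ConnectedIn ((F.erase e : Finset E) : Set E) r v
  · obtain ⟨e, he, h⟩ := hmin
    obtain ⟨T, hT, hT'⟩ := ih _ (hn ▸ Finset.card_erase_lt_of_mem he) _ h rfl
    exact ⟨T, hT.trans (Finset.erase_subset _ _), hT'⟩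
  · push Not at hmin
    -- When no edge of `F` can be spared, `F` itself is a tree on the component of `r`.
    refine ⟨F, subset_rfl, {v | I.ConnectedIn F r v}, hF, ⟨r, .refl _ _ _⟩, ?_, ?_, ?_⟩
    · intro e he
      -- A walk from `r` that used the edge would put both of its ends into the component, so an
      -- edge with an end outside could be spared.
      by_contra hcon
      obtain ⟨v, hv, hvn⟩ := hmin e he
      obtain ⟨p, hp, hpF⟩ := hF v hv
      refine hvn (hp.connectedIn fun e' he' => ?_)
      have he'F : e' ∈ F := by
        obtain ⟨s, hs, rfl⟩ := List.mem_map.1 he'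
        exact hpF s hs
      refine Finset.mem_coe.2 (Finset.mem_erase.2 ⟨?_, he'F⟩)
      rintro rfl
      have key : ∀ a b, I.Joins e' a b → I.ConnectedIn F r a := by
        intro a b hab
        have : ∀ (p : List (E × V)) (u : V), I.IsWalk u p v → (∀ s ∈ p, s.1 ∈ (F : Set E)) →
            I.ConnectedIn F r u → e' ∈ p.map Prod.fst → I.ConnectedIn F r a := by
          intro p
          induction p with
          | nil => intro u _ _ _ h; simp at h
          | cons s p ihp =>
            intro u hw hs hu hmem
            have h2 : I.ConnectedIn F r s.2 := hu.trans (hw.1.connectedIn (hs s (by simp)))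
            rw [List.map_cons, List.mem_cons] at hmem
            rcases hmem with rfl | hmem
            · rcases hab.eq_or_eq hw.1 with rfl | rfl <;> assumption
            · exact ihp s.2 hw.2 (fun t ht => hs t (List.mem_cons_of_mem _ ht)) h2 hmem
        exact this p r hp hpF (.refl _ _ _) he'
      exact hcon ⟨key _ _ (I.joins_ends e'), key _ _ (I.joins_ends e').symm⟩
    · intro u hu v hv
      exact hu.symm.trans hv
    · intro e he hc
      obtain ⟨v, hv, hvn⟩ := hmin e he
      -- If the ends of `e` stay connected without `e`, every use of `e` can be replaced by that
      -- detour and `e` could be spared.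
      refine hvn ((hF v hv).of_detour fun e' he' => ?_)
      rw [Finset.coe_erase]
      by_cases h : e' = e
      · exact Or.inr (h ▸ hc)
      · exact Or.inl ⟨he', h⟩

theorem sum_cost_toFinset_le [DecidableEq E] (I : SandInstance V E) (l : List E) :
    I.treeCost l.toFinset ≤ (l.map I.cost).sum := by
  induction l with
  | nil => simp [treeCost]
  | cons e l ih =>
    rw [List.toFinset_cons, List.map_cons, List.sum_cons]
    refine le_trans ?_ (add_le_add_right ih (I.cost e))
    by_cases h : e ∈ l.toFinset
    · rw [Finset.insert_eq_of_mem h]; linarith [I.cost_nonneg e]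
    · rw [treeCost, Finset.sum_insert h]; rfl

/-- A minimum-cost Steiner tree on three vertices costs at most as much as three walks to
a common vertex. -/
theorem IsMinSteinerTree.le_star {I : SandInstance V E} {a b c z : V} {T : Finset E}
    (hT : I.IsMinSteinerTree {a, b, c} T) {p q r : List (E × V)} (hp : I.IsWalk a p z)
    (hq : I.IsWalk b q z) (hr : I.IsWalk c r z) :
    I.treeCost T ≤ I.walkCost p + I.walkCost q + I.walkCost r := by
  classical
  set l : List E := p.map Prod.fst ++ q.map Prod.fst ++ r.map Prod.fst with hl
  have hF : ∀ v ∈ ({a, b, c} : Set V), I.ConnectedIn (l.toFinset : Set E) z v := by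
    rintro v (rfl | rfl | rfl)
    · exact (hp.connectedIn fun e he => by
        simp only [hl, List.coe_toFinset, Set.mem_ofPred_eq, List.mem_append, he, true_or]).symm
    · exact (hq.connectedIn fun e he => by
        simp only [hl, List.coe_toFinset, Set.mem_ofPred_eq, List.mem_append, he, true_or,
          or_true]).symm
    · exact (hr.connectedIn fun e he => by
        simp only [hl, List.coe_toFinset, Set.mem_ofPred_eq, List.mem_append, he, or_true]).symm
  obtain ⟨T', hT'l, hT'⟩ := I.exists_isSteinerTree_subset _ z _ hF
  calc I.treeCost T ≤ I.treeCost T' := hT.2 T' hT'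
    _ ≤ I.treeCost l.toFinset := I.treeCost_mono hT'l
    _ ≤ (l.map I.cost).sum := I.sum_cost_toFinset_le l
    _ = _ := by simp only [hl, List.map_append, List.sum_append, walkCost_eq_of_edges]

/-- A path from `u` to a vertex with property `f` has an initial part that reaches `f` and
whose edges all start outside `f`. -/
theorem IsPath.exists_first {I : SandInstance V E} (f : V → Prop) {p : List (E × V)} {u v : V}
    (hp : I.IsPath u p v) (hv : f v) :
    ∃ q z, I.IsWalk u q z ∧ f z ∧ q.map Prod.fst ⊆ p.map Prod.fst ∧ (q.map Prod.fst).Nodup ∧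
      ∀ e ∈ q.map Prod.fst, ∃ a b, I.Joins e a b ∧ ¬ f a := by
  induction p generalizing u with
  | nil => cases hp.1; exact ⟨[], _, rfl, hv, by simp, by simp, by simp⟩
  | cons s p ih =>
    by_cases hu : f u
    · exact ⟨[], u, rfl, hu, by simp, by simp, by simp⟩
    obtain ⟨q, z, hq, hz, hqp, hn, hf⟩ := ih ⟨hp.1.2, (List.nodup_cons.1 hp.2).2⟩
    have hnd := hp.nodup_edges
    rw [List.map_cons, List.nodup_cons] at hnd
    refine ⟨s :: q, z, ⟨hp.1.1, hq⟩, hz, List.cons_subset_cons _ hqp, ?_, ?_⟩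
    · rw [List.map_cons, List.nodup_cons]
      exact ⟨fun h => hnd.1 (hqp h), hn⟩
    · intro e he
      rw [List.map_cons, List.mem_cons] at he
      rcases he with rfl | he
      · exact ⟨u, s.2, hp.1.1, hu⟩
      · exact hf e he

/-- Three vertices that are connected to each other in `T` can be joined to a common vertex
by walks of total cost at most the cost of `T`. -/
theorem exists_star_le (I : SandInstance V E) {T : Finset E} {a b c : V}
    (hab : I.ConnectedIn (T : Set E) a b) (hca : I.ConnectedIn (T : Set E) c a) :
    ∃ z p q r, I.IsWalk z p a ∧ I.IsWalk z q b ∧ I.IsWalk z r c ∧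
      I.walkCost p + I.walkCost q + I.walkCost r ≤ I.treeCost T := by
  classical
  obtain ⟨p, hp, hpT⟩ := hab.exists_isPath
  obtain ⟨r, hr, hrT⟩ := hca.exists_isPath
  -- The common vertex `z` is the first point where the path from `c` meets the path from `a` to
  -- `b`.
  obtain ⟨r', z, hr', hz, hsub, hnd, hout⟩ :=
    hr.exists_first (fun v => v ∈ a :: p.map Prod.snd) (by simp)
  obtain ⟨q, p', rfl, hq, hp'⟩ := hp.exists_drop hz
  obtain ⟨p'', hp'', hp''c⟩ := hp'.exists_reverse_cost
  obtain ⟨r'', hr'', hr''c⟩ := hr'.exists_reverse_cost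
  refine ⟨z, p'', q, r'', hp'', hq.1, hr'', ?_⟩
  set l := (p' ++ q).map Prod.fst ++ r'.map Prod.fst with hl
  have hlnd : l.Nodup := by
    -- Each edge of the branch from `c` has an end off the main path, so it is not an edge of that
    -- path. Disjointness makes the total at most the cost of `T`.
    refine List.Nodup.append hp.nodup_edges hnd fun e he he' => ?_
    obtain ⟨x, y, hxy, hx⟩ := hout e he'
    exact hx (hp.1.mem_of_joins he hxy)
  have hlT : l.toFinset ⊆ T := by
    intro e he
    rw [List.mem_toFinset, hl, List.mem_append] at he
    rcases he with he | he
    · exact hpT e he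
    · exact hrT e (hsub he)
  calc _ = (l.map I.cost).sum := by
        rw [hp''c, hr''c]
        simp only [hl, List.map_append, List.sum_append, walkCost_eq_of_edges]
    _ = I.treeCost l.toFinset := (List.sum_toFinset I.cost hlnd).symm
    _ ≤ _ := I.treeCost_mono hlT

end SandInstance

/-! ### Existence of an optimum, feasibility of outputs, weak duality -/

namespace SandInstance

variable {V E : Type*}

/-- One path is chosen per vertex, so no edge ever carries more than |V| of them. -/
theorem Routable.min_card {I : SandInstance V E} [Finite V] {C : Finset V} {x : E → ℕ}
    (h : I.Routable C x) : I.Routable C fun e => min (x e) (Nat.card V) := by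
  obtain ⟨P, hP, hx⟩ := h
  refine ⟨P, hP, fun e => le_min (hx e) ?_⟩
  rw [← Set.ncard_univ]
  exact Set.ncard_le_ncard (Set.subset_univ _) Set.finite_univ

theorem totalCost_mono [Fintype E] (I : SandInstance V E) {x y : E → ℕ} (h : x ≤ y) :
    I.totalCost x ≤ I.totalCost y :=
  Finset.sum_le_sum fun e _ =>
    mul_le_mul_of_nonneg_left (Nat.cast_le.2 (h e)) (I.cost_nonneg e)

/-- Capping capacities at |V| preserves feasibility and does not raise the cost, so it suffices to
minimize over a finite set. -/
theorem exists_isLeast_totalCost [Finite V] [Fintype E] (I : SandInstance V E)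
    (h : ∃ y, I.Feasible y) :
    ∃ opt : ℝ, IsLeast {c | ∃ y, I.Feasible y ∧ I.totalCost y = c} opt := by
  set B : Set (E → ℕ) := {y | I.Feasible y ∧ y ≤ fun _ => Nat.card V} with hB
  have hfin : B.Finite := (Set.Finite.pi' fun _ : E => Set.finite_Iic (Nat.card V)).subset
    fun y hy => hy.2
  have htr : ∀ y, I.Feasible y → (fun e => min (y e) (Nat.card V)) ∈ B := fun y hy =>
    ⟨⟨hy.1.min_card, hy.2.min_card⟩, fun e => min_le_right _ _⟩
  obtain ⟨y, hy⟩ := h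
  obtain ⟨x, hx, hmin⟩ := hfin.exists_minimalFor I.totalCost _ ⟨_, htr y hy⟩
  refine ⟨I.totalCost x, ⟨x, hx.1, rfl⟩, ?_⟩
  rintro c ⟨y, hy, rfl⟩
  have h1 : I.totalCost (fun e => min (y e) (Nat.card V)) ≤ I.totalCost y :=
    I.totalCost_mono fun e => min_le_left _ _
  rcases le_total (I.totalCost x) (I.totalCost fun e => min (y e) (Nat.card V)) with h2 | h2
  · exact h2.trans h1
  · exact (hmin (htr y hy) h2).trans h1

/-- Capacities that count edge sets connecting the members of `C` to the root suffice. -/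
theorem routable_of_connectedIn {I : SandInstance V E} {C : Finset V} {γ : Type*} [Finite γ]
    (F : γ → Finset E) (f : γ → V)
    (h : ∀ v ∈ C, ∃ g, f g = v ∧ I.ConnectedIn (F g : Set E) v I.root) :
    I.Routable C fun e => {g | e ∈ F g}.ncard := by
  have h' : ∀ v ∈ C, ∃ p, I.IsPath v p I.root ∧
      ∃ g, f g = v ∧ ∀ e ∈ p.map Prod.fst, e ∈ (F g : Set E) := by
    intro v hv
    obtain ⟨g, hg, hc⟩ := h v hv
    obtain ⟨p, hp, hpF⟩ := hc.exists_isPath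
    exact ⟨p, hp, g, hg, hpF⟩
  choose! P hP hPF using h'
  refine ⟨P, hP, fun e => ?_⟩
  have hfin : {g | e ∈ F g}.Finite := Set.toFinite _
  refine le_trans (Set.ncard_le_ncard ?_ (hfin.image f)) (Set.ncard_image_le hfin)
  rintro v ⟨hv, he⟩
  obtain ⟨g, hg, hgF⟩ := hPF v hv
  exact ⟨g, hgF e he, hg⟩

theorem IsSteinerTree.connectedIn {I : SandInstance V E} {X : Set V} {T : Finset E}
    (h : I.IsSteinerTree X T) {u v : V} (hu : u ∈ X) (hv : v ∈ X) :
    I.ConnectedIn (T : Set E) u v := by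
  obtain ⟨U, hXU, hT⟩ := h
  exact hT.connected u (hXU hu) v (hXU hv)

/-- Every terminal travels to the root inside the tree of its own pair, and for each color distinct
terminals belong to distinct pairs. -/
theorem IsMatchingOutput.feasible {I : SandInstance V E} {x : E → ℕ}
    (h : I.IsMatchingOutput x) : I.Feasible x := by
  obtain ⟨T, M, hT, -, hx⟩ := h
  obtain rfl : x = fun e => {g | e ∈ T g (M g)}.ncard := funext hx
  constructor
  · refine routable_of_connectedIn (fun g => T g (M g)) I.greenVertex fun v hv => ?_
    exact ⟨.inl ⟨v, hv⟩, rfl, (hT _ _).1.connectedIn (by simp [greenVertex]) (by simp)⟩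
  · refine routable_of_connectedIn (fun g => T g (M g)) (fun g => I.blueVertex (M g))
      fun v hv => ?_
    refine ⟨M.symm (.inl ⟨v, hv⟩), by simp [blueVertex], ?_⟩
    exact (hT _ _).1.connectedIn (by simp [blueVertex]) (by simp)

/-- Double counting of incidences between edges and members of the family. -/
theorem totalCost_ncard [Fintype E] {γ : Type*} [Fintype γ] (I : SandInstance V E)
    (F : γ → Finset E) :
    I.totalCost (fun e => {g | e ∈ F g}.ncard) = ∑ g, I.treeCost (F g) := by
  classical
  have h : ∀ e, (({g | e ∈ F g}.ncard : ℕ) : ℝ) = ∑ g, if e ∈ F g then (1 : ℝ) else 0 := by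
    intro e
    rw [Finset.sum_boole, Set.ncard_eq_toFinset_card']
    simp
  simp only [totalCost, treeCost, h, Finset.mul_sum]
  rw [Finset.sum_comm]
  refine Finset.sum_congr rfl fun g _ => ?_
  simp

/-- A function that vanishes at the root and its total increase towards a routable set. -/
theorem Routable.sum_le [Fintype E] {I : SandInstance V E} {C : Finset V} {y : E → ℕ}
    (h : I.Routable C y) (α : V → ℝ) (hα : α I.root = 0) :
    ∑ v ∈ C, α v ≤ ∑ e, |α (I.ends e).1 - α (I.ends e).2| * y e := by
  classical
  obtain ⟨P, hP, hy⟩ := h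
  set δ : E → ℝ := fun e => |α (I.ends e).1 - α (I.ends e).2| with hδ
  -- Telescoping along a walk. Summed over the chosen paths, the increment of an edge is then
  -- counted at most `y e` times.
  have hwalk : ∀ (p : List (E × V)) (u v : V), I.IsWalk u p v →
      α u ≤ ((p.map Prod.fst).map δ).sum + α v := by
    intro p
    induction p with
    | nil => rintro u v rfl; simp
    | cons s p ih =>
      intro u v hw
      have h1 := ih _ _ hw.2
      have h2 : α u - α s.2 ≤ δ s.1 := by
        rcases hw.1 with h | h
        · simp only [hδ, h]; exact le_abs_self _
        · simp only [hδ, h]; rw [abs_sub_comm]; exact le_abs_self _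
      simp only [List.map_cons, List.sum_cons]
      linarith
  have h1 : ∀ v ∈ C, α v ≤ ∑ e, if e ∈ (P v).map Prod.fst then δ e else 0 := by
    intro v hv
    have h2 := hwalk _ _ _ (hP v hv).1
    rw [hα, add_zero, ← List.sum_toFinset δ (hP v hv).nodup_edges] at h2
    refine h2.trans_eq ?_
    rw [← Finset.sum_filter]
    congr 1
    ext e
    simp
  refine (Finset.sum_le_sum h1).trans ?_
  rw [Finset.sum_comm]
  refine Finset.sum_le_sum fun e _ => ?_
  rw [← Finset.sum_filter, Finset.sum_const, nsmul_eq_mul, mul_comm]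
  refine mul_le_mul_of_nonneg_left (Nat.cast_le.2 ?_) (abs_nonneg _)
  refine le_trans (le_of_eq ?_) (hy e)
  rw [← Set.ncard_coe_finset]
  congr 1
  ext v
  simp

/-- Weak duality for capacity installations. -/
theorem Feasible.sum_add_sum_le [Fintype E] {I : SandInstance V E} {y : E → ℕ}
    (h : I.Feasible y) (α β : V → ℝ) (hα : α I.root = 0) (hβ : β I.root = 0)
    (hw : ∀ e, |α (I.ends e).1 - α (I.ends e).2| + |β (I.ends e).1 - β (I.ends e).2| ≤ I.cost e) :
    ∑ v ∈ I.green, α v + ∑ v ∈ I.blue, β v ≤ I.totalCost y := by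
  refine (add_le_add (h.1.sum_le α hα) (h.2.sum_le β hβ)).trans ?_
  rw [← Finset.sum_add_distrib]
  refine Finset.sum_le_sum fun e _ => ?_
  rw [← add_mul]
  exact mul_le_mul_of_nonneg_right (hw e) (Nat.cast_nonneg _)

/-! ### Distances, potentials and the factor 4/3 -/

/-- The distance between two vertices. -/
noncomputable def dist (I : SandInstance V E) (u v : V) : ℝ :=
  sInf {c | ∃ p, I.IsWalk u p v ∧ I.walkCost p = c}

theorem dist_le {I : SandInstance V E} {u v : V} {p : List (E × V)} (hp : I.IsWalk u p v) :
    I.dist u v ≤ I.walkCost p := by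
  refine csInf_le ⟨0, ?_⟩ ⟨p, hp, rfl⟩
  rintro c ⟨q, -, rfl⟩
  exact I.walkCost_nonneg q

/-- Two vertices are connected in the whole graph. -/
def Reachable (I : SandInstance V E) (u v : V) : Prop := I.ConnectedIn Set.univ u v

theorem IsWalk.reachable {I : SandInstance V E} {u v : V} {p : List (E × V)}
    (hp : I.IsWalk u p v) : I.Reachable u v := hp.connectedIn fun _ _ => trivial

/-- Reachability is needed because the infimum over an empty set of walks is 0 by convention. -/
theorem le_dist {I : SandInstance V E} {u v : V} {a : ℝ} (h : I.Reachable u v)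
    (ha : ∀ p, I.IsWalk u p v → a ≤ I.walkCost p) : a ≤ I.dist u v := by
  obtain ⟨p, hp, -⟩ := h
  refine le_csInf ⟨_, p, hp, rfl⟩ ?_
  rintro c ⟨q, hq, rfl⟩
  exact ha q hq

theorem dist_nonneg (I : SandInstance V E) (u v : V) : 0 ≤ I.dist u v := by
  refine Real.sInf_nonneg ?_
  rintro c ⟨q, -, rfl⟩
  exact I.walkCost_nonneg q

theorem dist_self (I : SandInstance V E) (u : V) : I.dist u u = 0 :=
  le_antisymm ((dist_le (p := []) rfl).trans_eq (by simp [walkCost])) (I.dist_nonneg u u)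

theorem dist_le_dist_add {I : SandInstance V E} {u v w : V} {e : E} (h : I.Reachable u v)
    (he : I.Joins e v w) : I.dist u w ≤ I.dist u v + I.cost e := by
  rw [← sub_le_iff_le_add]
  refine le_dist h fun p hp => ?_
  have := dist_le (hp.append (q := [(e, w)]) ⟨he, rfl⟩)
  rw [walkCost_append] at this
  simp only [walkCost, List.map_cons, List.map_nil, List.sum_singleton] at this ⊢
  linarith

/-- The bound by three walks passes to the infimum in one walk at a time. -/
theorem IsMinSteinerTree.le_dist {I : SandInstance V E} {a b c z : V} {T : Finset E}
    (hT : I.IsMinSteinerTree {a, b, c} T) (ha : I.Reachable a z) (hb : I.Reachable b z)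
    (hc : I.Reachable c z) : I.treeCost T ≤ I.dist a z + I.dist b z + I.dist c z := by
  have h1 : I.treeCost T - I.dist b z - I.dist c z ≤ I.dist a z := by
    refine SandInstance.le_dist ha fun p hp => ?_
    have h2 : I.treeCost T - I.walkCost p - I.dist c z ≤ I.dist b z := by
      refine SandInstance.le_dist hb fun q hq => ?_
      have h3 : I.treeCost T - I.walkCost p - I.walkCost q ≤ I.dist c z := by
        refine SandInstance.le_dist hc fun r hr => ?_
        linarith [hT.le_star hp hq hr]
      linarith
    linarith
  linarith

/-- The potential generated by values at finitely many vertices. -/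
noncomputable def potential {γ : Type*} [Fintype γ] [Nonempty γ] (I : SandInstance V E)
    (f : γ → V) (p : γ → ℝ) (z : V) : ℝ :=
  Finset.univ.sup' Finset.univ_nonempty fun g => p g - I.dist (f g) z

section potential

variable {γ : Type*} [Fintype γ] [Nonempty γ] {I : SandInstance V E} {f : γ → V} {p : γ → ℝ}

theorem le_potential (g : γ) (z : V) : p g - I.dist (f g) z ≤ I.potential f p z :=
  Finset.le_sup' (fun g => p g - I.dist (f g) z) (Finset.mem_univ g)

theorem exists_potential_eq (z : V) : ∃ g, I.potential f p z = p g - I.dist (f g) z := by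
  obtain ⟨g, -, hg⟩ := Finset.exists_mem_eq_sup' (Finset.univ_nonempty (α := γ))
    fun g => p g - I.dist (f g) z
  exact ⟨g, hg⟩

/-- A maximum of functions that change by at most the cost along an edge does so too. Reachability
excludes the default distance 0. -/
theorem potential_sub_le {e : E} {u v : V} (he : I.Joins e u v)
    (hr : ∀ g, I.Reachable (f g) u) : I.potential f p u - I.potential f p v ≤ I.cost e := by
  obtain ⟨g, hg⟩ := exists_potential_eq (I := I) (f := f) (p := p) u
  have h1 := le_potential (I := I) (f := f) (p := p) g v
  have h2 := dist_le_dist_add (hr g) he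
  linarith

end potential

/-- The left side is max(|d|, |p|). This is why half-sum and half-difference of two potentials form
an admissible pair. -/
theorem abs_half_add_abs_half_le {d p w : ℝ} (hd : |d| ≤ w) (hp : |p| ≤ w) :
    |(d + p) / 2| + |(d - p) / 2| ≤ w := by
  rw [abs_le] at hd hp
  rcases abs_cases ((d + p) / 2) with h | h <;> rcases abs_cases ((d - p) / 2) with h' | h' <;>
    linarith

theorem abs_max_zero_sub_le {a b w : ℝ} (h : |a - b| ≤ w) : |max a 0 - max b 0| ≤ w :=
  (abs_max_sub_max_le_abs a b 0).trans h

theorem Routable.reachable {I : SandInstance V E} {C : Finset V} {y : E → ℕ}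
    (h : I.Routable C y) {v : V} (hv : v ∈ C) : I.Reachable v I.root := by
  obtain ⟨P, hP, -⟩ := h
  exact (hP v hv).1.reachable

theorem Feasible.reachable_green {I : SandInstance V E} {y : E → ℕ} (h : I.Feasible y)
    (g : I.GreenSide) : I.Reachable (I.greenVertex g) I.root := by
  rcases g with g | g
  · exact h.1.reachable g.2
  · exact .refl _ _ _

theorem Feasible.reachable_blue {I : SandInstance V E} {y : E → ℕ} (h : I.Feasible y)
    (g : I.BlueSide) : I.Reachable (I.blueVertex g) I.root := by
  rcases g with g | g
  · exact h.2.reachable g.2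
  · exact .refl _ _ _

/-- Both sides have the maximum of the two cardinalities; it is written in the form natural for the
blue side so that the two counts agree literally. -/
theorem card_greenSide (I : SandInstance V E) :
    Fintype.card I.GreenSide = I.blue.card + (I.green.card - I.blue.card) := by
  simp only [GreenSide, Fintype.card_sum, Fintype.card_coe, Fintype.card_fin]
  omega

theorem card_blueSide (I : SandInstance V E) :
    Fintype.card I.BlueSide = I.blue.card + (I.green.card - I.blue.card) := by
  simp only [BlueSide, Fintype.card_sum, Fintype.card_coe, Fintype.card_fin]

/-- Potentials that vanish at the root and are bounded by the distance from it. -/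
theorem Feasible.sum_potentials_le [Fintype E] {I : SandInstance V E} {y : E → ℕ}
    (h : I.Feasible y) (D P Q : V → ℝ) (hD : D I.root = 0) (hP : P I.root = 0)
    (hQ : Q I.root = 0) (hP0 : ∀ v, 0 ≤ P v) (hQ0 : ∀ v, 0 ≤ Q v) (hPQ : ∀ v, P v + Q v ≤ D v)
    (hDe : ∀ e, |D (I.ends e).1 - D (I.ends e).2| ≤ I.cost e)
    (hPe : ∀ e, |P (I.ends e).1 - P (I.ends e).2| ≤ I.cost e)
    (hQe : ∀ e, |Q (I.ends e).1 - Q (I.ends e).2| ≤ I.cost e) :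
    ∑ v ∈ I.green, P v + ∑ v ∈ I.blue, Q v ≤ 4 / 3 * I.totalCost y := by
  have h1 := h.sum_add_sum_le (fun v => (D v + P v) / 2) (fun v => (D v - P v) / 2)
    (by simp [hD, hP]) (by simp [hD, hP]) fun e => by
      refine le_trans (le_of_eq ?_) (abs_half_add_abs_half_le (hDe e) (hPe e))
      congr 2 <;> ring
  have h2 := h.sum_add_sum_le (fun v => (D v - Q v) / 2) (fun v => (D v + Q v) / 2)
    (by simp [hD, hQ]) (by simp [hD, hQ]) fun e => by
      rw [add_comm]
      refine le_trans (le_of_eq ?_) (abs_half_add_abs_half_le (hDe e) (hQe e))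
      congr 2 <;> ring
  -- The two green terms add up to D + (P − Q)/2, which is at least 3P/2 + Q/2 because P + Q ≤ D.
  have h3 : ∑ v ∈ I.green, (3 / 2 * P v) ≤
      ∑ v ∈ I.green, (D v + P v) / 2 + ∑ v ∈ I.green, (D v - Q v) / 2 := by
    rw [← Finset.sum_add_distrib]
    exact Finset.sum_le_sum fun v _ => by linarith [hPQ v, hP0 v, hQ0 v]
  have h4 : ∑ v ∈ I.blue, (3 / 2 * Q v) ≤
      ∑ v ∈ I.blue, (D v - P v) / 2 + ∑ v ∈ I.blue, (D v + Q v) / 2 := by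
    rw [← Finset.sum_add_distrib]
    exact Finset.sum_le_sum fun v _ => by linarith [hPQ v, hP0 v, hQ0 v]
  rw [← Finset.mul_sum] at h3 h4
  linarith

/-- Dual feasible prices for the matching problem are worth at most `4 / 3` times the cost of
any feasible installation. -/
theorem Feasible.sum_prices_le [Fintype E] {I : SandInstance V E} {y : E → ℕ}
    (h : I.Feasible y) (T : I.GreenSide → I.BlueSide → Finset E)
    (hT : ∀ g b, I.IsMinSteinerTree {I.greenVertex g, I.blueVertex b, I.root} (T g b))
    (p : I.GreenSide → ℝ) (q : I.BlueSide → ℝ) (hpq : ∀ g b, p g + q b ≤ I.treeCost (T g b)) :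
    ∑ g, p g + ∑ b, q b ≤ 4 / 3 * I.totalCost y := by
  classical
  rcases isEmpty_or_nonempty I.GreenSide with hG | hG
  · have hB : IsEmpty I.BlueSide := by
      rw [← Fintype.card_eq_zero_iff, card_blueSide, ← card_greenSide, Fintype.card_eq_zero_iff]
      exact hG
    simp only [Finset.univ_eq_empty, Finset.sum_empty, add_zero]
    exact mul_nonneg (by norm_num) (Finset.sum_nonneg fun e _ =>
      mul_nonneg (I.cost_nonneg e) (Nat.cast_nonneg _))
  have hB : Nonempty I.BlueSide := by
    rw [← Fintype.card_pos_iff, card_blueSide, ← card_greenSide, Fintype.card_pos_iff]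
    exact hG
  have hg := h.reachable_green
  have hb := h.reachable_blue
  set r := I.root with hr
  set P₀ := I.potential I.greenVertex p with hP₀
  set Q₀ := I.potential I.blueVertex q with hQ₀
  -- Distances are meaningful only within the component of the root. All potentials are set to 0
  -- elsewhere, and no edge joins the two regions.
  set R : V → Prop := fun v => I.Reachable r v with hR
  have hRr : R r := ConnectedIn.refl _ _ _
  have hRe : ∀ e u v, I.Joins e u v → R u → R v := fun e u v he hu =>
    ConnectedIn.trans hu (he.connectedIn (Set.mem_univ e))
  have key : ∀ F : V → ℝ, (∀ e u v, I.Joins e u v → R u → F u - F v ≤ I.cost e) →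
      ∀ e, |(if R (I.ends e).1 then F (I.ends e).1 else 0) -
        (if R (I.ends e).2 then F (I.ends e).2 else 0)| ≤ I.cost e := by
    intro F hF e
    have he := I.joins_ends e
    by_cases h1 : R (I.ends e).1
    · have h2 := hRe _ _ _ he h1
      rw [if_pos h1, if_pos h2, abs_sub_le_iff]
      exact ⟨hF _ _ _ he h1, hF _ _ _ he.symm h2⟩
    · have h2 : ¬ R (I.ends e).2 := fun h2 => h1 (hRe _ _ _ he.symm h2)
      rw [if_neg h1, if_neg h2, sub_zero, abs_zero]
      exact I.cost_nonneg e
  have hDlip : ∀ e u v, I.Joins e u v → R u → I.dist r u - I.dist r v ≤ I.cost e := by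
    intro e u v he hu
    have := dist_le_dist_add (hRe _ _ _ he hu) he.symm
    linarith
  have hPlip : ∀ e u v, I.Joins e u v → R u → P₀ u - P₀ v ≤ I.cost e := fun e u v he hu =>
    potential_sub_le he fun g => (hg g).trans hu
  have hQlip : ∀ e u v, I.Joins e u v → R u → Q₀ u - Q₀ v ≤ I.cost e := fun e u v he hu =>
    potential_sub_le he fun g => (hb g).trans hu
  have hPQ : ∀ z, R z → P₀ z + Q₀ z ≤ I.dist r z := by
    intro z hz
    obtain ⟨g, hgz⟩ := exists_potential_eq (I := I) (f := I.greenVertex) (p := p) z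
    obtain ⟨b, hbz⟩ := exists_potential_eq (I := I) (f := I.blueVertex) (p := q) z
    have := (hT g b).le_dist ((hg g).trans hz) ((hb b).trans hz) hz
    -- For the maximizers g and b at `z`, the price sum is at most the tree cost, which is at most
    -- the star centered at `z`; the terminal distances cancel.
    have := hpq g b
    rw [hP₀, hQ₀, hgz, hbz]
    linarith
  have hPr : ∀ v, R v → P₀ v - P₀ r ≤ I.dist r v := by
    intro v hv
    refine le_dist hv fun w hw => ?_
    have : ∀ (w : List (E × V)) (u : V), I.IsWalk u w v → R u →
        P₀ v - P₀ u ≤ I.walkCost w := by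
      intro w
      induction w with
      | nil => rintro u rfl -; simp [walkCost]
      | cons s w ih =>
        intro u hw hu
        have h1 := hRe _ _ _ hw.1 hu
        have h2 := ih _ hw.2 h1
        have h3 := hPlip _ _ _ hw.1.symm h1
        simp only [walkCost, List.map_cons, List.sum_cons] at h2 ⊢
        linarith
    exact this w r hw hRr
  -- From `r` to `v` the potential `Q₀` grows by at most the distance, and `Q₀ r + P₀ r ≤ 0`.
  have hQr : ∀ v, R v → Q₀ v + P₀ r ≤ I.dist r v := by
    intro v hv
    refine le_dist hv fun w hw => ?_
    have : ∀ (w : List (E × V)) (u : V), I.IsWalk u w v → R u →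
        Q₀ v - Q₀ u ≤ I.walkCost w := by
      intro w
      induction w with
      | nil => rintro u rfl -; simp [walkCost]
      | cons s w ih =>
        intro u hw hu
        have h1 := hRe _ _ _ hw.1 hu
        have h2 := ih _ hw.2 h1
        have h3 := hQlip _ _ _ hw.1.symm h1
        simp only [walkCost, List.map_cons, List.sum_cons] at h2 ⊢
        linarith
    have h1 := this w r hw hRr
    have h2 := hPQ r hRr
    rw [dist_self] at h2
    linarith
  have h0 := hPQ r hRr
  rw [dist_self] at h0
  -- The shift by `P₀ r` makes both potentials vanish at the root after truncation: the first
  -- becomes 0 and the second at most 0 there.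
  set P : V → ℝ := fun v => if R v then max (P₀ v - P₀ r) 0 else 0 with hP
  set Q : V → ℝ := fun v => if R v then max (Q₀ v + P₀ r) 0 else 0 with hQ
  have hPr0 : P r = 0 := by simp [hP, hRr]
  have hQr0 : Q r = 0 := by simp only [hQ, hRr, if_true]; exact max_eq_right (by linarith)
  have hmain := h.sum_potentials_le (fun v => if R v then I.dist r v else 0) P Q
    (by rw [if_pos hRr]; exact I.dist_self _) hPr0 hQr0
    (by intro v; simp only [hP]; split_ifs <;> simp)
    (by intro v; simp only [hQ]; split_ifs <;> simp)
    (by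
      intro v
      simp only [hP, hQ]
      split_ifs with hv
      · have h1 := hPQ v hv
        have h2 := hPr v hv
        have h3 := hQr v hv
        have h4 := I.dist_nonneg r v
        rcases max_cases (P₀ v - P₀ r) 0 with ⟨h5, -⟩ | ⟨h5, -⟩ <;>
          rcases max_cases (Q₀ v + P₀ r) 0 with ⟨h6, -⟩ | ⟨h6, -⟩ <;> rw [h5, h6] <;> linarith
      · simp)
    (key _ hDlip)
    (key (fun v => max (P₀ v - P₀ r) 0) fun e u v he hu => by
      have h1 := hRe _ _ _ he hu
      refine le_trans (le_abs_self _) (abs_max_zero_sub_le ?_)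
      rw [abs_sub_le_iff]
      exact ⟨by linarith [hPlip _ _ _ he hu], by linarith [hPlip _ _ _ he.symm h1]⟩)
    (key (fun v => max (Q₀ v + P₀ r) 0) fun e u v he hu => by
      have h1 := hRe _ _ _ he hu
      refine le_trans (le_abs_self _) (abs_max_zero_sub_le ?_)
      rw [abs_sub_le_iff]
      exact ⟨by linarith [hQlip _ _ _ he hu], by linarith [hQlip _ _ _ he.symm h1]⟩)
  have hp1 : ∀ g, p g - P₀ r ≤ P (I.greenVertex g) := by
    intro g
    have h1 := le_potential (I := I) (f := I.greenVertex) (p := p) g (I.greenVertex g)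
    rw [dist_self, sub_zero, ← hP₀] at h1
    have h2 : P (I.greenVertex g) = max (P₀ (I.greenVertex g) - P₀ r) 0 := if_pos (hg g).symm
    rw [h2]
    exact le_max_of_le_left (by linarith)
  have hq1 : ∀ b, q b + P₀ r ≤ Q (I.blueVertex b) := by
    intro b
    have h1 := le_potential (I := I) (f := I.blueVertex) (p := q) b (I.blueVertex b)
    rw [dist_self, sub_zero, ← hQ₀] at h1
    have h2 : Q (I.blueVertex b) = max (Q₀ (I.blueVertex b) + P₀ r) 0 := if_pos (hb b).symm
    rw [h2]
    exact le_max_of_le_left (by linarith)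
  -- Summation produces the shift `P₀ r` once per member of each side with opposite signs. The sides
  -- have equal size, so the shifts cancel; dummies contribute 0.
  have hp2 := Finset.sum_le_sum fun g (_ : g ∈ Finset.univ) => hp1 g
  have hq2 := Finset.sum_le_sum fun b (_ : b ∈ Finset.univ) => hq1 b
  rw [Finset.sum_sub_distrib, Finset.sum_const, Finset.card_univ, card_greenSide] at hp2
  rw [Finset.sum_add_distrib, Finset.sum_const, Finset.card_univ, card_blueSide] at hq2
  have hp3 : ∑ g, P (I.greenVertex g) = ∑ v ∈ I.green, P v := by
    rw [Fintype.sum_sum_type]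
    simp only [greenVertex, ← hr, hPr0, Finset.sum_const_zero, add_zero]
    exact Finset.sum_coe_sort I.green P
  have hq3 : ∑ b, Q (I.blueVertex b) = ∑ v ∈ I.blue, Q v := by
    rw [Fintype.sum_sum_type]
    simp only [blueVertex, ← hr, hQr0, Finset.sum_const_zero, add_zero]
    exact Finset.sum_coe_sort I.blue Q
  linarith

end SandInstance

/-! ### A language of bounded loops: semantics, step bound, frame rules -/

namespace Machine

/-- Programs whose loops run over the vertices (`false`) or the edges (`true`), with a
counter in cell `[0, 0]` of a dedicated array. -/
inductive Prog where
  | setNat (a : ℕ) (i j x : NExp)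
  | setReal (a : ℕ) (i j : NExp) (x : RExp)
  | seq (p q : Prog)
  | onlyIf (b : Test) (p : Prog)
  | iter (c : ℕ) (edges : Bool) (p : Prog)

/-- The content of a register, that is, of cell `[0, 0]` of an array. -/
def NExp.reg (a : ℕ) : NExp := .get a (.lit 0) (.lit 0)

/-- The content of a real register. -/
def RExp.reg (a : ℕ) : RExp := .get a (.lit 0) (.lit 0)

/-- The number of iterations of a loop. -/
def State.size (s : State) (edges : Bool) : ℕ := s.nat 0 0 (if edges then 1 else 0)

namespace Prog

/-- The machine program. -/
def compile : Prog → Cmd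
  | setNat a i j x => .setNat a i j x
  | setReal a i j x => .setReal a i j x
  | seq p q => .seq p.compile q.compile
  | onlyIf b p => .cond b p.compile .noop
  | .iter c edges p =>
    .seq (.setNat c (.lit 0) (.lit 0) (.lit 0))
      (.loop (.natLe (.add (.reg c) (.lit 1)) (.get 0 (.lit 0) (.lit (if edges then 1 else 0))))
        (.seq p.compile (.setNat c (.lit 0) (.lit 0) (.add (.reg c) (.lit 1)))))

open Classical in
/-- The effect of a program on the memory. -/
noncomputable def run : Prog → State → State
  | setNat a i j x, s => s.writeNat a (i.eval s) (j.eval s) (x.eval s)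
  | setReal a i j x, s => s.writeReal a (i.eval s) (j.eval s) (x.eval s)
  | seq p q, s => q.run (p.run s)
  | onlyIf b p, s => if b.Holds s then p.run s else s
  | .iter c edges p, s =>
    Nat.rec (s.writeNat c 0 0 0) (fun i s' => (p.run s').writeNat c 0 0 (i + 1)) (s.size edges)

/-- The natural-number arrays that a program may change. -/
def natWrites : Prog → List ℕ
  | setNat a _ _ _ => [a]
  | setReal _ _ _ _ => []
  | seq p q => p.natWrites ++ q.natWrites
  | onlyIf _ p => p.natWrites
  | .iter c _ p => c :: p.natWrites

/-- The real arrays that a program may change. -/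
def realWrites : Prog → List ℕ
  | setNat _ _ _ _ => []
  | setReal a _ _ _ => [a]
  | seq p q => p.realWrites ++ q.realWrites
  | onlyIf _ p => p.realWrites
  | .iter _ _ p => p.realWrites

/-- No loop body changes the counter of its loop. -/
def WellFormed : Prog → Prop
  | setNat _ _ _ _ => True
  | setReal _ _ _ _ => True
  | seq p q => p.WellFormed ∧ q.WellFormed
  | onlyIf _ p => p.WellFormed
  | .iter c _ p => c ∉ p.natWrites ∧ p.WellFormed

/-- A bound on the number of steps on inputs with at most `N` vertices and edges. -/
def timeBound (N : ℕ) : Prog → ℕ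
  | setNat _ i j x => i.steps + j.steps + x.steps + 1
  | setReal _ i j x => i.steps + j.steps + x.steps + 1
  | seq p q => p.timeBound N + q.timeBound N
  | onlyIf b p => b.steps + (p.timeBound N + 1) + 1
  | .iter _ _ p => 14 + N * (p.timeBound N + 18)

/-- A loop multiplies the bound of its body by `N`, so the degree is governed by the nesting depth.
-/
theorem exists_polynomial_timeBound (p : Prog) :
    ∃ q : Polynomial ℕ, ∀ N, p.timeBound N = q.eval N := by
  induction p with
  | setNat a i j x => exact ⟨.C (i.steps + j.steps + x.steps + 1), fun N => by simp [timeBound]⟩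
  | setReal a i j x => exact ⟨.C (i.steps + j.steps + x.steps + 1), fun N => by simp [timeBound]⟩
  | seq p q ihp ihq =>
    obtain ⟨P, hP⟩ := ihp
    obtain ⟨Q, hQ⟩ := ihq
    exact ⟨P + Q, fun N => by simp [timeBound, hP, hQ]⟩
  | onlyIf b p ih =>
    obtain ⟨P, hP⟩ := ih
    exact ⟨.C b.steps + (P + 1) + 1, fun N => by simp [timeBound, hP]⟩
  | iter c e p ih =>
    obtain ⟨P, hP⟩ := ih
    exact ⟨.C 14 + .X * (P + .C 18), fun N => by simp [timeBound, hP]⟩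

end Prog

theorem State.writeNat_nat_of_ne (s : State) {a b : ℕ} (h : b ≠ a) (i j x : ℕ) :
    (s.writeNat a i j x).nat b = s.nat b := by
  funext i' j'
  simp [State.writeNat, h]

theorem State.writeReal_real_of_ne (s : State) {a b : ℕ} (h : b ≠ a) (i j : ℕ) (x : ℝ) :
    (s.writeReal a i j x).real b = s.real b := by
  funext i' j'
  simp [State.writeReal, h]

theorem State.writeNat_real (s : State) (a i j x : ℕ) : (s.writeNat a i j x).real = s.real := rfl

theorem State.writeReal_nat (s : State) (a i j : ℕ) (x : ℝ) :
    (s.writeReal a i j x).nat = s.nat := rfl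

theorem State.writeNat_nat_self (s : State) (a i j x i' j' : ℕ) :
    (s.writeNat a i j x).nat a i' j' = if i' = i ∧ j' = j then x else s.nat a i' j' := by
  simp [State.writeNat]

theorem State.writeReal_real_self (s : State) (a i j : ℕ) (x : ℝ) (i' j' : ℕ) :
    (s.writeReal a i j x).real a i' j' = if i' = i ∧ j' = j then x else s.real a i' j' := by
  simp [State.writeReal]

namespace Prog

/-- Invariants of loops. -/
theorem run_iter (c : ℕ) (edges : Bool) (p : Prog) (s : State) (inv : ℕ → State → Prop)
    (h0 : inv 0 (s.writeNat c 0 0 0))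
    (h1 : ∀ i s', i < s.size edges → s'.nat c 0 0 = i → inv i s' →
      inv (i + 1) ((p.run s').writeNat c 0 0 (i + 1))) :
    inv (s.size edges) ((Prog.iter c edges p).run s) := by
  have : ∀ k ≤ s.size edges, inv k (Nat.rec (s.writeNat c 0 0 0)
        (fun i s' => (p.run s').writeNat c 0 0 (i + 1)) k) ∧
      State.nat (Nat.rec (s.writeNat c 0 0 0)
        (fun i s' => (p.run s').writeNat c 0 0 (i + 1)) k) c 0 0 = k := by
    intro k
    induction k with
    | zero => intro _; exact ⟨h0, by simp [State.writeNat]⟩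
    | succ k ih =>
      intro hk
      obtain ⟨h2, h3⟩ := ih (by omega)
      exact ⟨h1 k _ (by omega) h3 h2, by simp [State.writeNat]⟩
  exact (this _ le_rfl).1

/-- Frame rule: for a concrete program the side condition is decidable, so untouched arrays are
disposed of by `decide`. -/
theorem run_nat_of_notMem {a : ℕ} {p : Prog} (h : a ∉ p.natWrites) (s : State) :
    (p.run s).nat a = s.nat a := by
  induction p generalizing s with
  | setNat b i j x => exact s.writeNat_nat_of_ne (by simpa [natWrites] using h) _ _ _
  | setReal b i j x => rfl
  | seq p q ihp ihq =>
    simp only [natWrites, List.mem_append, not_or] at h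
    rw [run, ihq h.2, ihp h.1]
  | onlyIf b p ih =>
    rw [run]
    split_ifs
    · exact ih h s
    · rfl
  | iter c e p ih =>
    simp only [natWrites, List.mem_cons, not_or] at h
    refine run_iter c e p s (fun _ s' => s'.nat a = s.nat a)
      (s.writeNat_nat_of_ne h.1 _ _ _) fun i s' _ _ hs' => ?_
    rw [State.writeNat_nat_of_ne _ h.1, ih h.2, hs']

theorem run_real_of_notMem {a : ℕ} {p : Prog} (h : a ∉ p.realWrites) (s : State) :
    (p.run s).real a = s.real a := by
  induction p generalizing s with
  | setNat b i j x => rfl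
  | setReal b i j x => exact s.writeReal_real_of_ne (by simpa [realWrites] using h) _ _ _
  | seq p q ihp ihq =>
    simp only [realWrites, List.mem_append, not_or] at h
    rw [run, ihq h.2, ihp h.1]
  | onlyIf b p ih =>
    rw [run]
    split_ifs
    · exact ih h s
    · rfl
  | iter c e p ih =>
    refine run_iter c e p s (fun _ s' => s'.real a = s.real a) rfl fun i s' _ _ hs' => ?_
    rw [State.writeNat_real, ih h, hs']

/-- Loop bounds are reread from array 0 at each test, and sizes must stay at most `N`; this is why
the program must not write to array 0. Well-formedness makes each counter agree with the index of
the recursion in `run`. -/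
theorem exec_compile {N : ℕ} {p : Prog} (hp : p.WellFormed) (h0 : 0 ∉ p.natWrites) {s : State}
    (hs : ∀ e, s.size e ≤ N) : ∃ t ≤ p.timeBound N, Exec p.compile s t (p.run s) := by
  induction p generalizing s with
  | setNat b i j x => exact ⟨_, le_rfl, .setNat _ _ _ _ _⟩
  | setReal b i j x => exact ⟨_, le_rfl, .setReal _ _ _ _ _⟩
  | seq p q ihp ihq =>
    simp only [natWrites, List.mem_append, not_or] at h0
    obtain ⟨t, ht, hp'⟩ := ihp hp.1 h0.1 hs
    have hs' : ∀ e, (p.run s).size e ≤ N := by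
      intro e; rw [State.size, run_nat_of_notMem h0.1]; exact hs e
    obtain ⟨t', ht', hq'⟩ := ihq hp.2 h0.2 hs'
    exact ⟨t + t', add_le_add ht ht', hp'.seq hq'⟩
  | onlyIf b p ih =>
    obtain ⟨t, ht, hp'⟩ := ih hp h0 hs
    rw [run]
    split_ifs with hb
    · exact ⟨b.steps + t + 1, by simp only [timeBound]; omega, .condTrue hb hp'⟩
    · exact ⟨b.steps + 1 + 1, by simp only [timeBound]; omega, .condFalse hb (.noop s)⟩
  | iter c e p ih =>
    simp only [natWrites, List.mem_cons, not_or] at h0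
    set f : ℕ → State := fun k => Nat.rec (s.writeNat c 0 0 0)
      (fun i s' => (p.run s').writeNat c 0 0 (i + 1)) k with hf
    have hf0 : ∀ k, (f k).nat 0 = s.nat 0 := by
      intro k
      induction k with
      | zero => exact s.writeNat_nat_of_ne h0.1 _ _ _
      | succ k ihk =>
        rw [← ihk]
        exact (State.writeNat_nat_of_ne _ h0.1 _ _ _).trans (run_nat_of_notMem h0.2 _)
    have hfc : ∀ k, (f k).nat c 0 0 = k := by
      intro k
      cases k <;> simp [hf, State.writeNat]
    -- Induction on the number of remaining rounds. The last failing test costs 10 steps, and each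
    -- round costs 18 besides the body; initializing the counter adds 4, whence the 14 in
    -- `timeBound`.
    have key : ∀ k ≤ s.size e, ∃ t ≤ 10 + k * (p.timeBound N + 18),
        Exec (.loop (.natLe (.add (.reg c) (.lit 1)) (.get 0 (.lit 0) (.lit (if e then 1 else 0))))
          (.seq p.compile (.setNat c (.lit 0) (.lit 0) (.add (.reg c) (.lit 1)))))
          (f (s.size e - k)) t (f (s.size e)) := by
      intro k
      induction k with
      | zero =>
        intro _
        refine ⟨_, ?_, .loopDone ?_⟩
        · simp [Test.steps, NExp.steps, NExp.reg]
        · simp only [Test.Holds, NExp.eval, NExp.reg, Nat.sub_zero, hfc, hf0, State.size]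
          omega
      | succ k ihk =>
        intro hk
        obtain ⟨t, ht, hex⟩ := ihk (by omega)
        obtain ⟨t', ht', hex'⟩ := ih (s := f (s.size e - (k + 1))) hp.2 h0.2 (by
          intro e'; rw [State.size, hf0]; exact hs e')
        have hstep : f (s.size e - k) = (p.run (f (s.size e - (k + 1)))).writeNat c
            (NExp.eval (p.run (f (s.size e - (k + 1)))) (.lit 0))
            (NExp.eval (p.run (f (s.size e - (k + 1)))) (.lit 0))
            (NExp.eval (p.run (f (s.size e - (k + 1)))) (.add (.reg c) (.lit 1))) := by
          obtain ⟨l, hl⟩ : ∃ l, s.size e - (k + 1) = l := ⟨_, rfl⟩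
          have hl' : s.size e - k = l + 1 := by omega
          simp only [NExp.eval, NExp.reg, run_nat_of_notMem hp.1, hfc, hl, hl']
          rfl
        rw [hstep] at hex
        refine ⟨_, ?_, .loopStep ?_ (hex'.seq (.setNat _ _ _ _ _)) hex⟩
        · simp only [Test.steps, NExp.steps, NExp.reg, add_mul, one_mul]
          omega
        · simp only [Test.Holds, NExp.eval, NExp.reg, hfc, hf0]
          change _ ≤ s.size e
          omega
    obtain ⟨t, ht, hex⟩ := key _ le_rfl
    rw [Nat.sub_self] at hex
    refine ⟨_, ?_, (Exec.setNat s c (.lit 0) (.lit 0) (.lit 0)).seq hex⟩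
    have := Nat.mul_le_mul_right (p.timeBound N + 18) (hs e)
    simp only [NExp.steps, timeBound]
    omega

end Prog
end Machine

/-! ### Trees of shortest paths -/

namespace SandInstance

variable {V E : Type*}

theorem Joins.eq_and_eq_or {I : SandInstance V E} {e : E} {a b c d : V} (h : I.Joins e a b)
    (h' : I.Joins e c d) : (a = c ∧ b = d) ∨ (a = d ∧ b = c) := by
  unfold Joins at h h'
  rcases h with h | h <;> rcases h' with h' | h' <;> simp_all

variable [DecidableEq E]

/-- `T v`, for `v ∈ S`, is the edge set of the path from `z` to `v` in a tree of shortest paths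
with vertex set `S`, and `d v` is the distance from `z` to `v`. -/
structure IsShortestPathTree (I : SandInstance V E) (z : V) (S : Set V) (d : V → ℝ)
    (T : V → Finset E) : Prop where
  root_mem : z ∈ S
  le_walkCost : ∀ v ∈ S, ∀ p, I.IsWalk z p v → d v ≤ I.walkCost p
  treeCost_le : ∀ v ∈ S, I.treeCost (T v) ≤ d v
  connectedIn : ∀ v ∈ S, I.ConnectedIn (T v : Set E) z v
  exists_parent : ∀ v ∈ S, ∀ e ∈ T v, ∃ a ∈ S, ∃ b ∈ S,
    I.Joins e a b ∧ T b = insert e (T a) ∧ e ∉ T a ∧ T b ⊆ T v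

namespace IsShortestPathTree

variable {I : SandInstance V E} {z : V} {S : Set V} {d : V → ℝ} {T : V → Finset E}

theorem singleton (I : SandInstance V E) (z : V) {S : Set V} {d : V → ℝ} {T : V → Finset E}
    (hS : ∀ v, v ∈ S ↔ v = z) (hd : d z = 0) (hT : T z = ∅) : I.IsShortestPathTree z S d T where
  root_mem := (hS z).2 rfl
  le_walkCost := by
    intro v hv p _
    rw [(hS v).1 hv, hd]
    exact I.walkCost_nonneg p
  treeCost_le := by
    intro v hv
    rw [(hS v).1 hv, hd, hT]
    simp [treeCost]
  connectedIn := by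
    intro v hv
    rw [(hS v).1 hv]
    exact .refl _ _ _
  exists_parent := by
    intro v hv e he
    rw [(hS v).1 hv, hT] at he
    simp at he

/-- Dijkstra's step. Any walk to the new vertex leaves `S` by some crossing edge, and already its
part up to there costs at least the minimum key `d u + I.cost e`. -/
theorem extend (h : I.IsShortestPathTree z S d T) {u v : V} {e : E} (hu : u ∈ S) (hv : v ∉ S)
    (he : I.Joins e u v)
    (hmin : ∀ e' a b, I.Joins e' a b → a ∈ S → b ∉ S → d u + I.cost e ≤ d a + I.cost e')
    {S' : Set V} {d' : V → ℝ} {T' : V → Finset E} (hS' : ∀ w, w ∈ S' ↔ w = v ∨ w ∈ S)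
    (hd' : ∀ w ∈ S, d' w = d w) (hdv : d' v = d u + I.cost e)
    (hT' : ∀ w ∈ S, T' w = T w) (hTv : T' v = insert e (T u)) :
    I.IsShortestPathTree z S' d' T' where
  root_mem := (hS' z).2 (Or.inr h.root_mem)
  le_walkCost := by
    intro w hw p hp
    rcases (hS' w).1 hw with rfl | hw
    · have key : ∀ (p : List (E × V)) (q : List (E × V)) (x : V), I.IsWalk z q x → x ∈ S →
          I.IsWalk x p w → d u + I.cost e ≤ I.walkCost q + I.walkCost p := by
        intro p
        induction p with
        | nil => rintro q x _ hx rfl; exact absurd hx hv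
        | cons s p ih =>
          intro q x hq hx hp
          have hs : I.walkCost (s :: p) = I.cost s.1 + I.walkCost p := by simp [walkCost]
          by_cases hs2 : s.2 ∈ S
          · have := ih (q ++ [s]) s.2 (hq.append ⟨hp.1, rfl⟩) hs2 hp.2
            rw [walkCost_append] at this
            have h1 : I.walkCost [s] = I.cost s.1 := by simp [walkCost]
            linarith
          · have h1 := hmin _ _ _ hp.1 hx hs2
            have h2 := h.le_walkCost x hx q hq
            have h3 := I.walkCost_nonneg p
            linarith
      have := key p [] z rfl h.root_mem hp
      rw [hdv]
      simpa [walkCost] using this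
    · rw [hd' w hw]
      exact h.le_walkCost w hw p hp
  treeCost_le := by
    intro w hw
    rcases (hS' w).1 hw with rfl | hw
    · rw [hTv, hdv]
      have h1 := h.treeCost_le u hu
      by_cases heT : e ∈ T u
      · rw [Finset.insert_eq_of_mem heT]
        linarith [I.cost_nonneg e]
      · unfold treeCost at h1 ⊢
        rw [Finset.sum_insert heT]
        linarith
    · rw [hT' w hw, hd' w hw]
      exact h.treeCost_le w hw
  connectedIn := by
    intro w hw
    rcases (hS' w).1 hw with rfl | hw
    · rw [hTv]
      exact ((h.connectedIn u hu).mono (by simp)).trans (he.connectedIn (by simp))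
    · rw [hT' w hw]
      exact h.connectedIn w hw
  exists_parent := by
    intro w hw f hf
    rcases (hS' w).1 hw with rfl | hw
    · rw [hTv] at hf ⊢
      rcases Finset.mem_insert.1 hf with rfl | hf
      · refine ⟨u, (hS' u).2 (Or.inr hu), w, hw, he, ?_, ?_, ?_⟩
        · rw [hTv, hT' u hu]
        · rw [hT' u hu]
          -- An edge of `T u` has both ends in `S`, whereas `e` has the end outside `S` that is
          -- being added.
          intro hfu
          obtain ⟨a, ha, b, hb, hab, -⟩ := h.exists_parent u hu f hfu
          rcases he.symm.eq_or_eq hab with rfl | rfl <;> contradiction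
        · rw [hTv]
      · obtain ⟨a, ha, b, hb, hab, h1, h2, h3⟩ := h.exists_parent u hu f hf
        refine ⟨a, (hS' a).2 (Or.inr ha), b, (hS' b).2 (Or.inr hb), hab, ?_, ?_, ?_⟩
        · rw [hT' a ha, hT' b hb, h1]
        · rwa [hT' a ha]
        · rw [hT' b hb]
          exact h3.trans (Finset.subset_insert _ _)
    · rw [hT' w hw] at hf ⊢
      obtain ⟨a, ha, b, hb, hab, h1, h2, h3⟩ := h.exists_parent w hw f hf
      refine ⟨a, (hS' a).2 (Or.inr ha), b, (hS' b).2 (Or.inr hb), hab, ?_, ?_, ?_⟩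
      · rw [hT' a ha, hT' b hb, h1]
      · rwa [hT' a ha]
      · rwa [hT' b hb]

theorem mem_of_reachable (h : I.IsShortestPathTree z S d T)
    (hS : ∀ e a b, I.Joins e a b → a ∈ S → b ∈ S) {v : V} (hv : I.Reachable z v) : v ∈ S := by
  refine (hv.invariant (f := fun w => w ∈ S) fun e _ a b hab => ?_).1 h.root_mem
  exact ⟨hS e a b hab, hS e b a hab.symm⟩

theorem reachable (h : I.IsShortestPathTree z S d T) {v : V} (hv : v ∈ S) : I.Reachable z v :=
  (h.connectedIn v hv).mono (Set.subset_univ _)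

/-- Every edge e of the union is the last edge of a tree path from x to y. Crossing any other edge
of the union does not change whether e lies on the path to the current vertex, but this differs at x
and y. So the ends of e are not connected by the other edges. -/
theorem isSteinerTree (h : I.IsShortestPathTree z S d T) {a b c : V} (ha : a ∈ S) (hb : b ∈ S)
    (hc : c ∈ S) : I.IsSteinerTree {a, b, c} (T a ∪ T b ∪ T c) := by
  set F := T a ∪ T b ∪ T c with hF
  have hsub : ∀ e ∈ F, ∃ v ∈ S, e ∈ T v ∧ T v ⊆ F := by
    intro e he
    rw [hF, Finset.mem_union, Finset.mem_union] at he
    rcases he with (he | he) | he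
    · exact ⟨a, ha, he, fun x hx => by simp [hF, hx]⟩
    · exact ⟨b, hb, he, fun x hx => by simp [hF, hx]⟩
    · exact ⟨c, hc, he, fun x hx => by simp [hF, hx]⟩
  have hparent : ∀ e ∈ F, ∃ x ∈ S, ∃ y ∈ S, I.Joins e x y ∧ T y = insert e (T x) ∧ e ∉ T x ∧
      T y ⊆ F := by
    intro e he
    obtain ⟨v, hv, hev, hvF⟩ := hsub e he
    obtain ⟨x, hx, y, hy, h1, h2, h3, h4⟩ := h.exists_parent v hv e hev
    exact ⟨x, hx, y, hy, h1, h2, h3, h4.trans hvF⟩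
  refine ⟨{v | I.ConnectedIn (F : Set E) z v}, ?_, ⟨z, .refl _ _ _⟩, ?_, ?_, ?_⟩
  · rintro v (rfl | rfl | rfl)
    · exact (h.connectedIn _ ha).mono fun x hx => by simpa [hF] using Or.inl hx
    · exact (h.connectedIn _ hb).mono fun x hx => by simpa [hF] using Or.inr (Or.inl hx)
    · exact (h.connectedIn _ hc).mono fun x hx => by simpa [hF] using Or.inr (Or.inr hx)
  · intro e he
    obtain ⟨x, hx, y, hy, h1, h2, -, h4⟩ := hparent e he
    have hyF : I.ConnectedIn (F : Set E) z y := (h.connectedIn y hy).mono h4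
    have hxF : I.ConnectedIn (F : Set E) z x :=
      (h.connectedIn x hx).mono fun f hf => h4 (h2 ▸ Finset.mem_insert_of_mem hf)
    rcases (I.joins_ends e).eq_and_eq_or h1 with ⟨h5, h6⟩ | ⟨h5, h6⟩ <;> rw [h5, h6]
    · exact ⟨hxF, hyF⟩
    · exact ⟨hyF, hxF⟩
  · intro u hu v hv
    exact hu.symm.trans hv
  · intro e he hcon
    obtain ⟨x, hx, y, hy, h1, h2, h3, -⟩ := hparent e he
    have hinv := hcon.invariant (f := fun w => e ∈ T w) fun e' he' u v huv => by
      obtain ⟨x', hx', y', hy', h1', h2', h3', -⟩ := hparent e' he'.1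
      have hne : e ≠ e' := fun h => he'.2 h.symm
      have hxy : e ∈ T y' ↔ e ∈ T x' := by rw [h2', Finset.mem_insert]; simp [hne]
      rcases huv.eq_and_eq_or h1' with ⟨rfl, rfl⟩ | ⟨rfl, rfl⟩
      exacts [hxy.symm, hxy]
    have hey : e ∈ T y := by rw [h2]; exact Finset.mem_insert_self _ _
    rcases (I.joins_ends e).eq_and_eq_or h1 with ⟨h5, h6⟩ | ⟨h5, h6⟩ <;> rw [h5, h6] at hinv
    · exact h3 (hinv.2 hey)
    · exact h3 (hinv.1 hey)

theorem treeCost_union_le (h : I.IsShortestPathTree z S d T) {a b c : V} (ha : a ∈ S) (hb : b ∈ S)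
    (hc : c ∈ S) : I.treeCost (T a ∪ T b ∪ T c) ≤ d a + d b + d c := by
  have hunion : ∀ A B : Finset E, I.treeCost (A ∪ B) ≤ I.treeCost A + I.treeCost B := by
    intro A B
    unfold treeCost
    rw [← Finset.sum_union_inter]
    exact le_add_of_nonneg_right (Finset.sum_nonneg fun e _ => I.cost_nonneg e)
  linarith [hunion (T a ∪ T b) (T c), hunion (T a) (T b), h.treeCost_le a ha, h.treeCost_le b hb,
    h.treeCost_le c hc]

end IsShortestPathTree

end SandInstance

/-! ### Searching for a minimum -/

namespace Machine

/-- Record the candidate `(x, y, w)` in the registers `14`, `15`, `16` and its key in the real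
register `2` if the guard holds and its key is smaller than the one recorded. Register `13`
tells whether a candidate has been recorded. -/
def consider (g : Test) (key : RExp) (x y w : NExp) : Prog :=
  .onlyIf (.conj g (.neg (.conj (.natLe (.lit 1) (.reg 13)) (.realLe (.reg 2) key))))
    (.seq (.setReal 2 (.lit 0) (.lit 0) key)
      (.seq (.setNat 13 (.lit 0) (.lit 0) (.lit 1))
        (.seq (.setNat 14 (.lit 0) (.lit 0) x)
          (.seq (.setNat 15 (.lit 0) (.lit 0) y) (.setNat 16 (.lit 0) (.lit 0) w)))))

/-- The registers hold a candidate of minimum key, if there is one. -/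
def Recorded (cand : ℕ → ℕ → ℕ → Prop) (key : ℕ → ℕ → ℕ → ℝ) (s : State) : Prop :=
  (s.nat 13 0 0 = 0 ∧ ∀ a b c, ¬ cand a b c) ∨
    (1 ≤ s.nat 13 0 0 ∧ cand (s.nat 14 0 0) (s.nat 15 0 0) (s.nat 16 0 0) ∧
      s.real 2 0 0 = key (s.nat 14 0 0) (s.nat 15 0 0) (s.nat 16 0 0) ∧
      ∀ a b c, cand a b c → s.real 2 0 0 ≤ key a b c)

theorem Recorded.congr {cand cand' : ℕ → ℕ → ℕ → Prop} {key : ℕ → ℕ → ℕ → ℝ} {s s' : State}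
    (h : Recorded cand key s) (hc : ∀ a b c, cand a b c ↔ cand' a b c)
    (h13 : s'.nat 13 = s.nat 13) (h14 : s'.nat 14 = s.nat 14) (h15 : s'.nat 15 = s.nat 15)
    (h16 : s'.nat 16 = s.nat 16) (h2 : s'.real 2 = s.real 2) : Recorded cand' key s' := by
  obtain rfl : cand = cand' := by
    funext a b c
    exact propext (hc a b c)
  unfold Recorded
  rw [h13, h14, h15, h16, h2]
  exact h

/-- The expressions for the candidate are evaluated while registers 13 to 16 are being overwritten,
so their values must not depend on those registers. -/
theorem Recorded.run_consider {cand cand' : ℕ → ℕ → ℕ → Prop} {key : ℕ → ℕ → ℕ → ℝ} {s : State}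
    (h : Recorded cand key s) {g : Test} {k : RExp} {x y w : NExp} {a b c : ℕ}
    (hk : k.eval s = key a b c)
    (hxyw : ∀ s' : State, (∀ l ∉ [13, 14, 15, 16], s'.nat l = s.nat l) →
      x.eval s' = a ∧ y.eval s' = b ∧ w.eval s' = c)
    (hc : ∀ a' b' c', cand' a' b' c' ↔
      cand a' b' c' ∨ (g.Holds s ∧ a' = a ∧ b' = b ∧ c' = c)) :
    Recorded cand' key ((consider g k x y w).run s) := by
  obtain rfl : cand' = fun a' b' c' =>
      cand a' b' c' ∨ (g.Holds s ∧ a' = a ∧ b' = b ∧ c' = c) := by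
    funext a' b' c'
    exact propext (hc a' b' c')
  rw [consider, Prog.run]
  split_ifs with ht
  · simp only [Test.Holds, NExp.eval, RExp.eval, NExp.reg, RExp.reg, hk] at ht
    obtain ⟨hg, ht⟩ := ht
    simp only [Prog.run]
    set s1 := (s.writeReal 2 (NExp.eval s (.lit 0)) (NExp.eval s (.lit 0)) (k.eval s)) with hs1
    set s2 := s1.writeNat 13 (NExp.eval s1 (.lit 0)) (NExp.eval s1 (.lit 0))
      (NExp.eval s1 (.lit 1)) with hs2
    have hx := (hxyw s2 (by
      intro l hl
      simp only [List.mem_cons, not_or] at hl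
      rw [hs2, State.writeNat_nat_of_ne _ hl.1]; rfl)).1
    rw [hx]
    set s3 := s2.writeNat 14 (NExp.eval s2 (.lit 0)) (NExp.eval s2 (.lit 0)) a with hs3
    have hy := (hxyw s3 (by
      intro l hl
      simp only [List.mem_cons, not_or] at hl
      rw [hs3, State.writeNat_nat_of_ne _ hl.2.1, hs2, State.writeNat_nat_of_ne _ hl.1]; rfl)).2.1
    rw [hy]
    set s4 := s3.writeNat 15 (NExp.eval s3 (.lit 0)) (NExp.eval s3 (.lit 0)) b with hs4
    have hw := (hxyw s4 (by
      intro l hl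
      simp only [List.mem_cons, not_or] at hl
      rw [hs4, State.writeNat_nat_of_ne _ hl.2.2.1, hs3, State.writeNat_nat_of_ne _ hl.2.1, hs2,
        State.writeNat_nat_of_ne _ hl.1]; rfl)).2.2
    rw [hw]
    refine Or.inr ?_
    simp only [State.writeNat, State.writeReal, NExp.eval, hs1, hs2, hs3, hs4, hk, true_and,
      and_self, if_true, hg]
    norm_num
    intro a' b' c' h'
    rcases h' with h' | ⟨rfl, rfl, rfl⟩
    · rcases h with h | h
      · exact absurd h' (h.2 _ _ _)
      · rw [not_and, not_le] at ht
        exact (ht h.1).le.trans (h.2.2.2 _ _ _ h')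
    · exact le_rfl
  · simp only [Test.Holds, NExp.eval, RExp.eval, NExp.reg, RExp.reg, hk, not_and] at ht
    rcases h with h | h
    · refine Or.inl ⟨h.1, fun a' b' c' h' => ?_⟩
      rcases h' with h' | ⟨hg, -⟩
      · exact h.2 _ _ _ h'
      · have ht' := ht hg
        rw [Classical.not_imp] at ht'
        omega
    · refine Or.inr ⟨h.1, Or.inl h.2.1, h.2.2.1, fun a' b' c' h' => ?_⟩
      rcases h' with h' | ⟨hg, rfl, rfl, rfl⟩
      · exact h.2.2.2 _ _ _ h'
      · have ht' := ht hg
        rw [Classical.not_imp, not_not] at ht'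
        exact ht'.2

end Machine

/-! ### Loop invariants and the shortest-path program -/

namespace Machine

namespace Prog

/-- Invariants of loops, with the parts of the memory that the body does not change. -/
theorem run_iter_of_frame {c : ℕ} {edges : Bool} {p : Prog} {s : State} (inv : ℕ → State → Prop)
    (h0 : inv 0 (s.writeNat c 0 0 0))
    (h1 : ∀ i s', i < s.size edges → s'.nat c 0 0 = i →
      (∀ b ∉ c :: p.natWrites, s'.nat b = s.nat b) →
      (∀ b ∉ p.realWrites, s'.real b = s.real b) → inv i s' →
      inv (i + 1) ((p.run s').writeNat c 0 0 (i + 1))) :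
    inv (s.size edges) ((Prog.iter c edges p).run s) := by
  refine (run_iter c edges p s (fun i s' => (∀ b ∉ c :: p.natWrites, s'.nat b = s.nat b) ∧
    (∀ b ∉ p.realWrites, s'.real b = s.real b) ∧ inv i s') ⟨?_, ?_, h0⟩ ?_).2.2
  · intro b hb
    rw [List.mem_cons, not_or] at hb
    exact State.writeNat_nat_of_ne _ hb.1 _ _ _
  · intro b _; rfl
  · rintro i s' hi hc ⟨hn, hr, hinv⟩
    refine ⟨?_, ?_, h1 i s' hi hc hn hr hinv⟩
    · intro b hb
      rw [← hn b hb]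
      rw [List.mem_cons, not_or] at hb
      rw [State.writeNat_nat_of_ne _ hb.1, run_nat_of_notMem hb.2]
    · intro b hb
      rw [← hr b hb, State.writeNat_real, run_real_of_notMem hb]

/-- Loops whose iterations write to different cells. -/
theorem run_iter_pointwise_nat {c : ℕ} {edges : Bool} {p : Prog} {s : State} {a : ℕ} (hac : a ≠ c)
    (r t F : ℕ → ℕ) (hinj : ∀ k l, l < k → ¬ (r k = r l ∧ t k = t l))
    (hp : ∀ k s', k < s.size edges → s'.nat c 0 0 = k →
      (∀ b ∉ c :: p.natWrites, s'.nat b = s.nat b) → (∀ b ∉ p.realWrites, s'.real b = s.real b) →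
      (∀ u v, (∀ l < k, ¬ (u = r l ∧ v = t l)) → s'.nat a u v = s.nat a u v) →
      ∀ u v, (p.run s').nat a u v = if u = r k ∧ v = t k then F k else s'.nat a u v) :
    (∀ l < s.size edges, ((Prog.iter c edges p).run s).nat a (r l) (t l) = F l) ∧
      ∀ u v, (∀ l < s.size edges, ¬ (u = r l ∧ v = t l)) →
        ((Prog.iter c edges p).run s).nat a u v = s.nat a u v := by
  refine run_iter_of_frame (fun k s' => (∀ l < k, s'.nat a (r l) (t l) = F l) ∧
      ∀ u v, (∀ l < k, ¬ (u = r l ∧ v = t l)) → s'.nat a u v = s.nat a u v) ⟨by simp, ?_⟩ ?_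
  · intro u v _
    rw [State.writeNat_nat_of_ne _ hac]
  · rintro k s' hk hc hn hr ⟨h1, h2⟩
    rw [State.writeNat_nat_of_ne _ hac]
    have h3 := hp k s' hk hc hn hr h2
    refine ⟨fun l hl => ?_, fun u v huv => ?_⟩
    · rw [h3]
      split_ifs with h
      · rcases Nat.lt_succ_iff_lt_or_eq.1 hl with hl | rfl
        · exact absurd ⟨h.1.symm, h.2.symm⟩ (hinj k l hl)
        · rfl
      · rcases Nat.lt_succ_iff_lt_or_eq.1 hl with hl | rfl
        · exact h1 l hl
        · exact absurd ⟨rfl, rfl⟩ h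
    · rw [h3, if_neg (huv k (Nat.lt_succ_self k))]
      exact h2 u v fun l hl => huv l (Nat.lt_succ_of_lt hl)

/-- The body may assume that rows from the current one on still hold their initial content, which
allows updates in place. -/
theorem run_iter_column {c : ℕ} {edges : Bool} {p : Prog} {s : State} {a : ℕ} (hac : a ≠ c)
    (F : ℕ → ℕ)
    (hp : ∀ k s', k < s.size edges → s'.nat c 0 0 = k →
      (∀ b ∉ c :: p.natWrites, s'.nat b = s.nat b) → (∀ b ∉ p.realWrites, s'.real b = s.real b) →
      (∀ u v, k ≤ u → s'.nat a u v = s.nat a u v) →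
      ∀ u v, (p.run s').nat a u v = if u = k ∧ v = 0 then F k else s'.nat a u v) (u v : ℕ) :
    ((Prog.iter c edges p).run s).nat a u v =
      if u < s.size edges ∧ v = 0 then F u else s.nat a u v := by
  obtain ⟨h1, h2⟩ := run_iter_pointwise_nat (c := c) (edges := edges) (p := p) (s := s) hac
    (fun l => l) (fun _ => 0) F (by omega) fun k s' hk hc hn hr hold =>
      hp k s' hk hc hn hr fun u v hu => hold u v fun l hl => by omega
  split_ifs with h
  · obtain ⟨h, rfl⟩ := h
    exact h1 u h
  · exact h2 u v fun l hl hcon => h ⟨hcon.1 ▸ hl, hcon.2⟩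

theorem run_iter_row {c : ℕ} {edges : Bool} {p : Prog} {s : State} {a : ℕ} (hac : a ≠ c)
    (r : ℕ) (F : ℕ → ℕ)
    (hp : ∀ k s', k < s.size edges → s'.nat c 0 0 = k →
      (∀ b ∉ c :: p.natWrites, s'.nat b = s.nat b) → (∀ b ∉ p.realWrites, s'.real b = s.real b) →
      (∀ u v, u ≠ r ∨ k ≤ v → s'.nat a u v = s.nat a u v) →
      ∀ u v, (p.run s').nat a u v = if u = r ∧ v = k then F k else s'.nat a u v) (u v : ℕ) :
    ((Prog.iter c edges p).run s).nat a u v =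
      if u = r ∧ v < s.size edges then F v else s.nat a u v := by
  obtain ⟨h1, h2⟩ := run_iter_pointwise_nat (c := c) (edges := edges) (p := p) (s := s) hac
    (fun _ => r) (fun l => l) F (by omega) fun k s' hk hc hn hr hold =>
      hp k s' hk hc hn hr fun u v hu => hold u v fun l hl => by omega
  split_ifs with h
  · obtain ⟨rfl, h⟩ := h
    exact h1 v h
  · exact h2 u v fun l hl hcon => h ⟨hcon.1, hcon.2 ▸ hl⟩

theorem run_iter_real_column {c : ℕ} {edges : Bool} {p : Prog} {s : State} {a : ℕ}
    (F : ℕ → ℝ)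
    (hp : ∀ k s', k < s.size edges → s'.nat c 0 0 = k →
      (∀ b ∉ c :: p.natWrites, s'.nat b = s.nat b) → (∀ b ∉ p.realWrites, s'.real b = s.real b) →
      (∀ u v, k ≤ u → s'.real a u v = s.real a u v) →
      ∀ u v, (p.run s').real a u v = if u = k ∧ v = 0 then F k else s'.real a u v) (u v : ℕ) :
    ((Prog.iter c edges p).run s).real a u v =
      if u < s.size edges ∧ v = 0 then F u else s.real a u v := by
  have key := run_iter_of_frame (c := c) (edges := edges) (p := p) (s := s)
    (fun k s' => ∀ u v, s'.real a u v = if u < k ∧ v = 0 then F u else s.real a u v)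
    (by intro u v; rw [if_neg (by omega)]; rfl) (by
      intro k s' hk hc hn hr hinv u v
      rw [State.writeNat_real, hp k s' hk hc hn hr (fun u v hu => by
        rw [hinv, if_neg (by omega)]), hinv]
      by_cases h1 : u = k
      · subst h1
        by_cases h2 : v = 0 <;> simp [h2]
      · have : u < k + 1 ↔ u < k := by omega
        simp [h1, this])
  exact key u v

end Prog

/-- The input part of the memory describes the instance `I`. -/
structure Loaded {n m : ℕ} (I : SandInstance (Fin n) (Fin m)) (s : State) : Prop where
  nat_zero : s.nat 0 = inputNat I 0
  nat_one : s.nat 1 = inputNat I 1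
  nat_two : s.nat 2 = inputNat I 2
  real_zero : s.real 0 = inputReal I 0

namespace Loaded

variable {n m : ℕ} {I : SandInstance (Fin n) (Fin m)} {s : State}

theorem size_false (h : Loaded I s) : s.size false = n := by
  rw [State.size, h.nat_zero]; rfl

theorem size_true (h : Loaded I s) : s.size true = m := by
  rw [State.size, h.nat_zero]; rfl

theorem root (h : Loaded I s) : s.nat 0 0 2 = I.root := by
  rw [h.nat_zero]; rfl

theorem fst_ends (h : Loaded I s) (e : Fin m) : s.nat 1 e 0 = (I.ends e).1 := by
  rw [h.nat_one]; simp [inputNat]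

theorem snd_ends (h : Loaded I s) (e : Fin m) : s.nat 1 e 1 = (I.ends e).2 := by
  rw [h.nat_one]; simp [inputNat]

theorem cost (h : Loaded I s) (e : Fin m) : s.real 0 e 0 = I.cost e := by
  rw [h.real_zero]; simp [inputReal]

theorem run (h : Loaded I s) {p : Prog} (hn : ∀ b < 3, b ∉ p.natWrites) (hr : 0 ∉ p.realWrites) :
    Loaded I (p.run s) where
  nat_zero := by rw [Prog.run_nat_of_notMem (hn 0 (by norm_num)), h.nat_zero]
  nat_one := by rw [Prog.run_nat_of_notMem (hn 1 (by norm_num)), h.nat_one]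
  nat_two := by rw [Prog.run_nat_of_notMem (hn 2 (by norm_num)), h.nat_two]
  real_zero := by rw [Prog.run_real_of_notMem hr, h.real_zero]

theorem of_frame (h : Loaded I s) {s' : State} {l k : List ℕ} (hn : ∀ b ∉ l, s'.nat b = s.nat b)
    (hr : ∀ b ∉ k, s'.real b = s.real b) (hl : ∀ b < 3, b ∉ l) (hk : 0 ∉ k) : Loaded I s' where
  nat_zero := by rw [hn _ (hl 0 (by norm_num)), h.nat_zero]
  nat_one := by rw [hn _ (hl 1 (by norm_num)), h.nat_one]
  nat_two := by rw [hn _ (hl 2 (by norm_num)), h.nat_two]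
  real_zero := by rw [hr _ hk, h.real_zero]

theorem joins_iff (h : Loaded I s) (e : Fin m) (u v : Fin n) :
    I.Joins e u v ↔ (s.nat 1 e 0 = u ∧ s.nat 1 e 1 = v) ∨ (s.nat 1 e 0 = v ∧ s.nat 1 e 1 = u) := by
  rw [h.fst_ends, h.snd_ends]
  simp [SandInstance.Joins, Prod.ext_iff, Fin.ext_iff]

end Loaded

/-- The vertices in the tree under construction: array `11`. -/
def treeVertices (n : ℕ) (s : State) : Set (Fin n) := {v | 1 ≤ s.nat 11 v 0}

/-- The distances in the tree under construction: real array `1`. -/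
def treeDist (n : ℕ) (s : State) : Fin n → ℝ := fun v => s.real 1 v 0

/-- The paths in the tree under construction: array `12`. -/
def treePath (n m : ℕ) (s : State) : Fin n → Finset (Fin m) :=
  fun v => Finset.univ.filter fun e => 1 ≤ s.nat 12 v e

theorem tree_congr {n m : ℕ} {s s' : State} (h11 : s'.nat 11 = s.nat 11)
    (h12 : s'.nat 12 = s.nat 12) (h1 : s'.real 1 = s.real 1) :
    treeVertices n s' = treeVertices n s ∧ treePath n m s' = treePath n m s ∧
      treeDist n s' = treeDist n s := by
  unfold treeVertices treePath treeDist
  rw [h11, h12, h1]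
  exact ⟨rfl, rfl, rfl⟩

/-- Consider extending the tree by the edge in register `22` in one of its directions. -/
def considerEdge (i j : ℕ) : Prog :=
  consider (.conj (.natLe (.lit 1) (.get 11 (.get 1 (.reg 22) (.lit i)) (.lit 0)))
      (.neg (.natLe (.lit 1) (.get 11 (.get 1 (.reg 22) (.lit j)) (.lit 0)))))
    (.add (.get 1 (.get 1 (.reg 22) (.lit i)) (.lit 0)) (.get 0 (.reg 22) (.lit 0)))
    (.reg 22) (.get 1 (.reg 22) (.lit i)) (.get 1 (.reg 22) (.lit j))

/-- Find the best edge by which the tree can be extended. -/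
def findEdge : Prog :=
  .seq (.setNat 13 (.lit 0) (.lit 0) (.lit 0))
    (.iter 22 true (.seq (considerEdge 0 1) (considerEdge 1 0)))

/-- Extend the tree by the edge that has been recorded. -/
def addEdge : Prog :=
  .seq (.iter 22 true (.setNat 12 (.reg 16) (.reg 22) (.get 12 (.reg 15) (.reg 22))))
    (.seq (.setNat 12 (.reg 16) (.reg 14) (.lit 1))
      (.seq (.setNat 11 (.reg 16) (.lit 0) (.lit 1)) (.setReal 1 (.reg 16) (.lit 0) (.reg 2))))

/-- The tree that consists of the vertex in register `10`. -/
def initTree : Prog :=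
  .seq (.iter 20 false (.setNat 11 (.reg 20) (.lit 0) (.lit 0)))
    (.seq (.iter 20 true (.setNat 12 (.reg 10) (.reg 20) (.lit 0)))
      (.seq (.setNat 11 (.reg 10) (.lit 0) (.lit 1)) (.setReal 1 (.reg 10) (.lit 0) .zero)))

/-- Compute a tree of shortest paths from the vertex in register `10`. -/
def shortestPathTree : Prog :=
  .seq initTree (.iter 21 false (.seq findEdge (.onlyIf (.natLe (.lit 1) (.reg 13)) addEdge)))

section

variable {n m : ℕ} {I : SandInstance (Fin n) (Fin m)} {s : State}

/-- An edge `e < k` by which the tree can be extended from `u` to `v`. -/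
def CrossingEdge (s : State) (k e u v : ℕ) : Prop :=
  e < k ∧ ((u = s.nat 1 e 0 ∧ v = s.nat 1 e 1) ∨ (u = s.nat 1 e 1 ∧ v = s.nat 1 e 0)) ∧
    1 ≤ s.nat 11 u 0 ∧ ¬ 1 ≤ s.nat 11 v 0

/-- The loop invariant restricts the candidates to edges below the counter; each round tries one
edge in both directions. -/
theorem recorded_findEdge :
    Recorded (CrossingEdge s (s.size true)) (fun e u _ => s.real 1 u 0 + s.real 0 e 0)
      (findEdge.run s) := by
  rw [findEdge, Prog.run]
  set s0 := (Prog.setNat 13 (.lit 0) (.lit 0) (.lit 0)).run s with hs0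
  have hfr : ∀ b ≠ 13, s0.nat b = s.nat b := fun b hb => State.writeNat_nat_of_ne _ hb _ _ _
  have hsize : s0.size true = s.size true := by rw [State.size, hfr _ (by norm_num)]; rfl
  rw [← hsize]
  refine Prog.run_iter_of_frame (c := 22) (fun k s' => Recorded (CrossingEdge s k)
    (fun e u _ => s.real 1 u 0 + s.real 0 e 0) s') ?_ ?_
  · refine Or.inl ⟨?_, fun a b c h => absurd h.1 (by omega)⟩
    simp [State.writeNat, hs0, Prog.run, NExp.eval]
  · intro k s' hk hc hn hr hinv
    have h1 : s'.nat 1 = s.nat 1 := by rw [hn 1 (by decide), hfr 1 (by decide)]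
    have h11 : s'.nat 11 = s.nat 11 := by rw [hn 11 (by decide), hfr 11 (by decide)]
    have hr0 : s'.real 0 = s.real 0 := hr 0 (by decide)
    have hr1 : s'.real 1 = s.real 1 := hr 1 (by decide)
    have step : ∀ (i j : ℕ) (s' : State) (C C' : ℕ → ℕ → ℕ → Prop),
        s'.nat 1 = s.nat 1 → s'.nat 11 = s.nat 11 → s'.real 0 = s.real 0 →
        s'.real 1 = s.real 1 → s'.nat 22 0 0 = k →
        Recorded C (fun e u _ => s.real 1 u 0 + s.real 0 e 0) s' →
        (∀ a b c, C' a b c ↔ C a b c ∨ ((1 ≤ s.nat 11 (s.nat 1 k i) 0 ∧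
          ¬ 1 ≤ s.nat 11 (s.nat 1 k j) 0) ∧ a = k ∧ b = s.nat 1 k i ∧ c = s.nat 1 k j)) →
        Recorded C' (fun e u _ => s.real 1 u 0 + s.real 0 e 0) ((considerEdge i j).run s') := by
      intro i j s' C C' h1 h11 hr0 hr1 hc hC hC'
      refine hC.run_consider (a := k) (b := s.nat 1 k i) (c := s.nat 1 k j) ?_ ?_ ?_
      · simp only [RExp.eval, NExp.eval, NExp.reg, hc, h1, hr0, hr1]
      · intro s'' hs''
        simp only [NExp.eval, NExp.reg, hs'' 22 (by decide), hs'' 1 (by decide), h1, hc, and_self]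
      · intro a b c
        rw [hC']
        simp only [Test.Holds, NExp.eval, NExp.reg, hc, h1, h11]
    have hA := step 0 1 s' _ _ h1 h11 hr0 hr1 hc hinv fun a b c => Iff.rfl
    have hB := step 1 0 ((considerEdge 0 1).run s') _ _
      (by rw [Prog.run_nat_of_notMem (by decide), h1])
      (by rw [Prog.run_nat_of_notMem (by decide), h11])
      (by rw [Prog.run_real_of_notMem (by decide), hr0])
      (by rw [Prog.run_real_of_notMem (by decide), hr1])
      (by rw [Prog.run_nat_of_notMem (by decide), hc]) hA fun a b c => Iff.rfl
    refine hB.congr ?_ (State.writeNat_nat_of_ne _ (by decide) _ _ _)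
      (State.writeNat_nat_of_ne _ (by decide) _ _ _) (State.writeNat_nat_of_ne _ (by decide) _ _ _)
      (State.writeNat_nat_of_ne _ (by decide) _ _ _) rfl
    intro e u v
    simp only [CrossingEdge]
    constructor
    · rintro ((⟨h2, h3⟩ | ⟨h2, rfl, rfl, rfl⟩) | ⟨h2, rfl, rfl, rfl⟩)
      · exact ⟨by omega, h3⟩
      · exact ⟨by omega, Or.inl ⟨rfl, rfl⟩, h2⟩
      · exact ⟨by omega, Or.inr ⟨rfl, rfl⟩, h2⟩
    · rintro ⟨h2, h3, h4⟩
      by_cases he : e = k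
      · subst he
        rcases h3 with ⟨rfl, rfl⟩ | ⟨rfl, rfl⟩
        · exact Or.inl (Or.inr ⟨h4, rfl, rfl, rfl⟩)
        · exact Or.inr ⟨h4, rfl, rfl, rfl⟩
      · exact Or.inl (Or.inl ⟨by omega, h3, h4⟩)

/-- The path to register 15 is copied into the row of register 16. Distinct rows ensure that the
source is not overwritten during the copying. -/
theorem run_addEdge (hne : s.nat 15 0 0 ≠ s.nat 16 0 0) :
    (∀ v w, (addEdge.run s).nat 11 v w =
      if v = s.nat 16 0 0 ∧ w = 0 then 1 else s.nat 11 v w) ∧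
    (∀ v e, (addEdge.run s).nat 12 v e = if v = s.nat 16 0 0 ∧ e = s.nat 14 0 0 then 1 else
      if v = s.nat 16 0 0 ∧ e < s.size true then s.nat 12 (s.nat 15 0 0) e else s.nat 12 v e) ∧
    ∀ v w, (addEdge.run s).real 1 v w =
      if v = s.nat 16 0 0 ∧ w = 0 then s.real 2 0 0 else s.real 1 v w := by
  rw [addEdge, Prog.run]
  set p := Prog.iter 22 true (.setNat 12 (.reg 16) (.reg 22) (.get 12 (.reg 15) (.reg 22))) with hp
  have h12 : ∀ v e, (p.run s).nat 12 v e =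
      if v = s.nat 16 0 0 ∧ e < s.size true then s.nat 12 (s.nat 15 0 0) e else s.nat 12 v e := by
    refine Prog.run_iter_row (by decide) _ _ fun k s' hk hc hn hr hold u v => ?_
    rw [Prog.run, State.writeNat_nat_self]
    simp only [NExp.eval, NExp.reg, hc, hn 16 (by decide), hn 15 (by decide)]
    rw [hold _ _ (Or.inl hne)]
  have hfr : ∀ b, b ≠ 22 → b ≠ 12 → (p.run s).nat b = s.nat b := fun b h1 h2 =>
    Prog.run_nat_of_notMem (by simp [hp, Prog.natWrites, h1, h2]) s
  have hfrr : ∀ b, (p.run s).real b = s.real b := fun b =>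
    Prog.run_real_of_notMem (by simp [hp, Prog.realWrites]) s
  simp only [Prog.run, NExp.eval, NExp.reg, RExp.eval, RExp.reg, State.writeNat,
    State.writeReal]
  norm_num
  simp only [hfr 11 (by norm_num) (by norm_num), hfr 14 (by norm_num) (by norm_num),
    hfr 16 (by norm_num) (by norm_num), hfrr, h12, implies_true, and_self]

/-- Only the path row of `z` is cleared. Rows and distances of other vertices may be stale, since
they are not in the tree yet. -/
theorem run_initTree (hl : Loaded I s) {z : Fin n} (hz : s.nat 10 0 0 = z) :
    I.IsShortestPathTree z (treeVertices n (initTree.run s)) (treeDist n (initTree.run s))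
      (treePath n m (initTree.run s)) := by
  set p := Prog.iter 20 false (.setNat 11 (.reg 20) (.lit 0) (.lit 0)) with hp
  set q := Prog.iter 20 true (.setNat 12 (.reg 10) (.reg 20) (.lit 0)) with hq
  have h11 : ∀ v w, (p.run s).nat 11 v w =
      if v < s.size false ∧ w = 0 then 0 else s.nat 11 v w := by
    refine Prog.run_iter_column (by decide) _ fun k s' hk hc hn hr hold u v => ?_
    rw [Prog.run, State.writeNat_nat_self]
    simp only [NExp.eval, NExp.reg, hc]
  have hsize : (p.run s).size true = s.size true := by
    rw [State.size, Prog.run_nat_of_notMem (by simp [hp, Prog.natWrites])]; rfl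
  have h10 : (p.run s).nat 10 0 0 = z := by
    rw [Prog.run_nat_of_notMem (by simp [hp, Prog.natWrites]), hz]
  have h12 : ∀ v w, (q.run (p.run s)).nat 12 v w =
      if v = (z : ℕ) ∧ w < s.size true then 0 else (p.run s).nat 12 v w := by
    rw [← hsize]
    refine Prog.run_iter_row (by decide) _ _ fun k s' hk hc hn hr hold u v => ?_
    rw [Prog.run, State.writeNat_nat_self]
    simp only [NExp.eval, NExp.reg, hc, hn 10 (by decide), h10]
  have h10' : (q.run (p.run s)).nat 10 0 0 = z := by
    rw [Prog.run_nat_of_notMem (by simp [hq, Prog.natWrites]), h10]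
  have h11' : (q.run (p.run s)).nat 11 = (p.run s).nat 11 :=
    Prog.run_nat_of_notMem (by simp [hq, Prog.natWrites]) _
  have heq : initTree.run s = (Prog.setReal 1 (.reg 10) (.lit 0) .zero).run
      ((Prog.setNat 11 (.reg 10) (.lit 0) (.lit 1)).run (q.run (p.run s))) := rfl
  rw [heq]
  clear_value p q
  refine .singleton I z (fun v => ?_) ?_ ?_
  · simp only [treeVertices, Set.mem_ofPred_eq, Prog.run, NExp.eval, NExp.reg, State.writeNat,
      State.writeReal]
    norm_num
    rw [h10', h11', h11, hl.size_false]
    simp [Fin.ext_iff, apply_ite]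
  · simp only [treeDist, Prog.run, NExp.eval, NExp.reg, State.writeNat,
      State.writeReal, RExp.eval]
    norm_num
    rw [h10']
    simp
  · ext e
    simp only [treePath, Prog.run, NExp.eval, NExp.reg, State.writeNat,
      State.writeReal]
    norm_num
    rw [h12, hl.size_true]
    simp

/-- No edge leaves the tree. -/
def TreeClosed (I : SandInstance (Fin n) (Fin m)) (s : State) : Prop :=
  ∀ e a b, I.Joins e a b → a ∈ treeVertices n s → b ∈ treeVertices n s

/-- Either no crossing edge was recorded, and the tree is closed, or the recorded edge has minimum
key and `IsShortestPathTree.extend` applies. -/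
theorem run_growTree (hl : Loaded I s) {z : Fin n}
    (h : I.IsShortestPathTree z (treeVertices n s) (treeDist n s) (treePath n m s)) {s' : State}
    (hs' : s' = (Prog.seq findEdge (.onlyIf (.natLe (.lit 1) (.reg 13)) addEdge)).run s) :
    I.IsShortestPathTree z (treeVertices n s') (treeDist n s') (treePath n m s') ∧
      (TreeClosed I s' ∨
        ∃ v ∉ treeVertices n s, treeVertices n s' = insert v (treeVertices n s)) := by
  have hrec := recorded_findEdge (s := s)
  have h11 : (findEdge.run s).nat 11 = s.nat 11 := Prog.run_nat_of_notMem (by decide) s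
  have h12 : (findEdge.run s).nat 12 = s.nat 12 := Prog.run_nat_of_notMem (by decide) s
  have hr1 : (findEdge.run s).real 1 = s.real 1 := Prog.run_real_of_notMem (by decide) s
  have hsize : (findEdge.run s).size true = s.size true := by
    rw [State.size, Prog.run_nat_of_notMem (by decide)]; rfl
  rw [Prog.run, Prog.run] at hs'
  rcases hrec with ⟨h0, hnone⟩ | ⟨h1, hc, hkey, hmin⟩
  · have : s' = findEdge.run s := by
      rw [hs', if_neg]
      simp [Test.Holds, NExp.eval, NExp.reg, h0]
    subst this
    obtain ⟨hV, hP, hD⟩ := tree_congr (n := n) (m := m) h11 h12 hr1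
    refine ⟨by rwa [hV, hD, hP], Or.inl ?_⟩
    intro e a b hab ha
    rw [hV] at ha ⊢
    by_contra hb
    refine hnone e a b ⟨by rw [hl.size_true]; exact e.2, ?_, ha, hb⟩
    rcases (hl.joins_iff e a b).1 hab with ⟨h2, h3⟩ | ⟨h2, h3⟩
    · exact Or.inl ⟨h2.symm, h3.symm⟩
    · exact Or.inr ⟨h3.symm, h2.symm⟩
  · rw [if_pos (by simpa [Test.Holds, NExp.eval, NExp.reg] using h1)] at hs'
    obtain ⟨he, hends, hu, hv⟩ := hc
    rw [hl.size_true] at he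
    obtain ⟨e, hee⟩ : ∃ e : Fin m, (e : ℕ) = (findEdge.run s).nat 14 0 0 := ⟨⟨_, he⟩, rfl⟩
    rw [← hee] at hends hkey
    obtain ⟨u, v, hJ, hue, hve⟩ : ∃ u v : Fin n, I.Joins e u v ∧
        (u : ℕ) = (findEdge.run s).nat 15 0 0 ∧ (v : ℕ) = (findEdge.run s).nat 16 0 0 := by
      rw [hl.fst_ends, hl.snd_ends] at hends
      rcases hends with ⟨h2, h3⟩ | ⟨h2, h3⟩
      · exact ⟨_, _, I.joins_ends e, h2.symm, h3.symm⟩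
      · exact ⟨_, _, (I.joins_ends e).symm, h2.symm, h3.symm⟩
    rw [← hue] at hkey hu
    rw [← hve] at hv
    have hne : u ≠ v := by rintro rfl; exact hv hu
    obtain ⟨hA, hB, hC⟩ := run_addEdge (s := findEdge.run s) (by
      rw [← hue, ← hve]; exact fun h => hne (Fin.ext h))
    rw [← hs'] at hA hB hC
    rw [← hve, h11] at hA
    rw [← hve, ← hee, ← hue, h12, hsize, hl.size_true] at hB
    rw [← hve, hr1, hkey] at hC
    simp only [hl.cost] at hC
    have hSv : ∀ w, w ∈ treeVertices n s' ↔ w = v ∨ w ∈ treeVertices n s := by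
      intro w
      simp only [treeVertices, Set.mem_ofPred_eq, hA]
      by_cases hw : w = v
      · simp [hw]
      · simp [hw, Fin.val_inj]
    refine ⟨h.extend (u := u) (v := v) (e := e) hu hv hJ ?_ hSv ?_ ?_ ?_ ?_, Or.inr ⟨v, hv, ?_⟩⟩
    · intro e' a b hab ha hb
      have := hmin e' a b ⟨by rw [hl.size_true]; exact e'.2, ?_, ha, hb⟩
      · rw [hkey] at this
        simpa only [hl.cost, treeDist] using this
      · rcases (hl.joins_iff e' a b).1 hab with ⟨h2, h3⟩ | ⟨h2, h3⟩
        · exact Or.inl ⟨h2.symm, h3.symm⟩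
        · exact Or.inr ⟨h3.symm, h2.symm⟩
    · intro w hw
      have : (w : ℕ) ≠ v := fun h => hv ((Fin.ext h : w = v) ▸ hw)
      simp [treeDist, hC, this]
    · simp [treeDist, hC]
    · intro w hw
      have : (w : ℕ) ≠ v := fun h => hv ((Fin.ext h : w = v) ▸ hw)
      simp [treePath, hB, this]
    · ext f
      simp only [treePath, hB, Finset.mem_filter, Finset.mem_univ, true_and, Finset.mem_insert,
        f.2, if_true]
      by_cases hf : f = e
      · simp [hf]
      · simp [hf, Fin.val_inj]
    · ext w
      rw [hSv]; rfl

/-- The program computes a tree of shortest paths that spans the component of its root. -/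
theorem run_shortestPathTree (hl : Loaded I s) {z : Fin n} (hz : s.nat 10 0 0 = z) {s' : State}
    (hs' : s' = shortestPathTree.run s) :
    I.IsShortestPathTree z (treeVertices n s') (treeDist n s') (treePath n m s') ∧
      TreeClosed I s' := by
  have hl0 : Loaded I (initTree.run s) := hl.run (by decide) (by decide)
  have key := Prog.run_iter_of_frame (c := 21) (edges := false) (s := initTree.run s)
    (p := .seq findEdge (.onlyIf (.natLe (.lit 1) (.reg 13)) addEdge))
    -- While the tree is not closed it gains a vertex in each round, starting with one. After `n`
    -- rounds the second alternative would require `n + 1` vertices.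
    (fun k s' => I.IsShortestPathTree z (treeVertices n s') (treeDist n s') (treePath n m s') ∧
      (TreeClosed I s' ∨ k + 1 ≤ (treeVertices n s').ncard)) ?_ ?_
  · rw [hl0.size_false] at key
    rw [hs']
    refine ⟨key.1, key.2.resolve_right fun h => ?_⟩
    have := Set.ncard_le_ncard (Set.subset_univ (treeVertices n (shortestPathTree.run s)))
    rw [Set.ncard_univ, Nat.card_fin] at this
    exact absurd (h.trans this) (by omega)
  · have := run_initTree hl hz
    have heq : ∀ s0 : State, treeVertices n (s0.writeNat 21 0 0 0) = treeVertices n s0 ∧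
        treePath n m (s0.writeNat 21 0 0 0) = treePath n m s0 ∧
        treeDist n (s0.writeNat 21 0 0 0) = treeDist n s0 := by
      intro s0
      exact tree_congr (s0.writeNat_nat_of_ne (by decide) _ _ _)
        (s0.writeNat_nat_of_ne (by decide) _ _ _) rfl
    simp only [heq]
    exact ⟨this, Or.inr ((Set.ncard_pos (Set.toFinite _)).2 ⟨z, this.root_mem⟩)⟩
  · rintro k s1 hk hc hn hr ⟨hT, hcard⟩
    have hl1 : Loaded I s1 := hl0.of_frame hn hr (by decide) (by decide)
    obtain ⟨h1, h2⟩ := run_growTree hl1 hT rfl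
    set s2 := Prog.run (.seq findEdge (.onlyIf (.natLe (.lit 1) (.reg 13)) addEdge)) s1
    have heq : treeVertices n (s2.writeNat 21 0 0 (k + 1)) = treeVertices n s2 ∧
        treePath n m (s2.writeNat 21 0 0 (k + 1)) = treePath n m s2 ∧
        treeDist n (s2.writeNat 21 0 0 (k + 1)) = treeDist n s2 :=
      tree_congr (s2.writeNat_nat_of_ne (by decide) _ _ _)
        (s2.writeNat_nat_of_ne (by decide) _ _ _) rfl
    refine ⟨by rwa [heq.1, heq.2.1, heq.2.2], ?_⟩
    simp only [TreeClosed, heq.1]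
    rcases h2 with h2 | ⟨v, hv, h2⟩
    · exact Or.inl h2
    · rcases hcard with hcard | hcard
      -- A closed tree already contains every reachable vertex, so closedness persists whatever the
      -- round does.
      · refine Or.inl fun e a b hab ha => ?_
        rw [h2] at ha ⊢
        rcases ha with rfl | ha
        · have : ∀ w, I.Reachable z w → w ∈ treeVertices n s1 := fun w hw =>
            hT.mem_of_reachable hcard hw
          refine Or.inr (this b ((h1.reachable (v := a) ?_).trans (hab.connectedIn trivial)))
          rw [h2]; exact Set.mem_insert _ _
        · exact Or.inr (hcard e a b hab ha)
      · refine Or.inr ?_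
        rw [h2, Set.ncard_insert_of_notMem hv]
        omega

end

end Machine

/-! ### Tight matchings and alternating trees -/

/-- The rows below `p` are matched to columns below `k`, and the prices `u` and `v` are dual
feasible for the costs `c` and tight on the matching. -/
structure TightMatching (k p : ℕ) (c : ℕ → ℕ → ℝ) (mu : ℕ → ℕ) (u v : ℕ → ℝ) : Prop where
  lt : ∀ i < p, mu i < k
  inj : ∀ i < p, ∀ i' < p, mu i = mu i' → i = i'
  tight : ∀ i < p, u i + v (mu i) = c i (mu i)
  dual : ∀ i < k, ∀ j < k, u i + v j ≤ c i j

/-- An alternating tree of tight edges with rows `R` and columns `C` that grows from row `p`. For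
`i ∈ R`, the function `mm i` is the tight matching of the rows up to `p` that leaves out `i`. -/
structure AlternatingTree (k p : ℕ) (c : ℕ → ℕ → ℝ) (mu : ℕ → ℕ) (u v : ℕ → ℝ) (R C : ℕ → Prop)
    (mm : ℕ → ℕ → ℕ) : Prop extends TightMatching k p c mu u v where
  root_mem : R p
  le_of_mem : ∀ i, R i → i ≤ p
  exists_of_mem : ∀ j, C j → ∃ i < p, mu i = j ∧ R i
  mem_of_lt : ∀ i < p, R i → C (mu i)
  variant_lt : ∀ i, R i → ∀ r ≤ p, r ≠ i → mm i r < k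
  variant_inj : ∀ i, R i → ∀ r ≤ p, r ≠ i → ∀ r' ≤ p, r' ≠ i → mm i r = mm i r' → r = r'
  variant_tight : ∀ i, R i → ∀ r ≤ p, r ≠ i → u r + v (mm i r) = c r (mm i r)
  variant_mem : ∀ i, R i → ∀ r ≤ p, r ≠ i → C (mm i r) ∨ (r < p ∧ mm i r = mu r)
  variant_eq : ∀ i, R i → ∀ r ≤ p, ¬ R r → mm i r = mu r

namespace AlternatingTree

variable {k p : ℕ} {c : ℕ → ℕ → ℝ} {mu : ℕ → ℕ} {u v : ℕ → ℝ} {R C : ℕ → Prop}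
  {mm : ℕ → ℕ → ℕ}

theorem mem_column_iff (h : AlternatingTree k p c mu u v R C mm) {i : ℕ} (hi : i < p) :
    C (mu i) ↔ R i := by
  refine ⟨fun hC => ?_, h.mem_of_lt i hi⟩
  obtain ⟨i', hi', he, hR⟩ := h.exists_of_mem _ hC
  rwa [h.inj i hi i' hi' he.symm]

/-- Tree rows use exactly tree columns in each stored matching. Hence a price change cancels on all
pairs of these matchings. -/
theorem variant_mem_iff (h : AlternatingTree k p c mu u v R C mm) {i : ℕ} (hi : R i) {r : ℕ}
    (hr : r ≤ p) (hri : r ≠ i) : C (mm i r) ↔ R r := by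
  constructor
  · intro hC
    by_contra hR
    have hrp : r ≠ p := by rintro rfl; exact hR h.root_mem
    rw [h.variant_eq i hi r hr hR, h.mem_column_iff (by omega)] at hC
    exact hR hC
  · intro hR
    rcases h.variant_mem i hi r hr hri with hC | ⟨hrp, he⟩
    · exact hC
    · rw [he]; exact h.mem_of_lt r hrp hR

open Classical in
-- Raising tree rows and lowering tree columns by `δ` keeps tight pairs tight. The only constraints
-- that become tighter are those between a tree row and a column outside, where the slack is at
-- least `δ`.
theorem dualStep (h : AlternatingTree k p c mu u v R C mm) {δ : ℝ} (h0 : 0 ≤ δ)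
    (hδ : ∀ i < k, ∀ j < k, R i → ¬ C j → δ ≤ c i j - u i - v j) {u' v' : ℕ → ℝ}
    (hpk : p < k) (hu : ∀ i < k, u' i = if R i then u i + δ else u i)
    (hv : ∀ j < k, v' j = if C j then v j - δ else v j) :
    AlternatingTree k p c mu u' v' R C mm where
  lt := h.lt
  inj := h.inj
  tight i hi := by
    rw [hu i (by omega), hv _ (h.lt i hi)]
    have := h.tight i hi
    simp only [h.mem_column_iff hi]
    split_ifs <;> linarith
  dual i hi j hj := by
    rw [hu i hi, hv j hj]
    have h1 := h.dual i hi j hj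
    have h2 := hδ i hi j hj
    split_ifs with h3 h4 h4
    · linarith
    · linarith [h2 h3 h4]
    · linarith
    · linarith
  root_mem := h.root_mem
  le_of_mem := h.le_of_mem
  exists_of_mem := h.exists_of_mem
  mem_of_lt := h.mem_of_lt
  variant_lt := h.variant_lt
  variant_inj := h.variant_inj
  variant_tight i hi r hr hri := by
    rw [hu r (by omega), hv _ (h.variant_lt i hi r hr hri)]
    have := h.variant_tight i hi r hr hri
    simp only [h.variant_mem_iff hi hr hri]
    split_ifs <;> linarith
  variant_mem := h.variant_mem
  variant_eq := h.variant_eq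

/-- To leave out the new row `i'`, take the matching that leaves out `i` and give `i` the column
`j`. That column was used by `i'` alone, because rows outside the tree keep their original partners.
-/
theorem grow (h : AlternatingTree k p c mu u v R C mm) {i j i' : ℕ} (hi : R i) (hj : j < k)
    (hCj : ¬ C j) (ht : u i + v j = c i j) (hi' : i' < p) (hmu : mu i' = j)
    {R' C' : ℕ → Prop} {mm' : ℕ → ℕ → ℕ} (hR' : ∀ r, R' r ↔ r = i' ∨ R r)
    (hC' : ∀ l, C' l ↔ l = j ∨ C l) (hmm : ∀ r ≠ i', ∀ l ≤ p, mm' r l = mm r l)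
    (hmm' : ∀ r ≤ p, mm' i' r = if r = i then j else mm i r) :
    AlternatingTree k p c mu u v R' C' mm' := by
  have hRi' : ¬ R i' := by
    rw [← h.mem_column_iff hi', hmu]; exact hCj
  have hii' : i ≠ i' := by rintro rfl; exact hRi' hi
  have hold : ∀ r, R' r → r ≠ i' → R r := fun r hr hne => ((hR' r).1 hr).resolve_left hne
  have hne : ∀ r ≤ p, r ≠ i → r ≠ i' → mm i r ≠ j := by
    intro r hr hri hri' he
    rcases h.variant_mem i hi r hr hri with h1 | ⟨h1, h2⟩
    · exact hCj (he ▸ h1)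
    · exact hri' (h.inj r h1 i' hi' (by rw [← h2, he, hmu]))
  refine ⟨h.toTightMatching, (hR' p).2 (Or.inr h.root_mem), ?_, ?_, ?_, ?_, ?_, ?_, ?_, ?_⟩
  · intro r hr
    rcases (hR' r).1 hr with rfl | hr
    · omega
    · exact h.le_of_mem r hr
  · intro l hl
    rcases (hC' l).1 hl with rfl | hl
    · exact ⟨i', hi', hmu, (hR' i').2 (Or.inl rfl)⟩
    · obtain ⟨r, hr, he, hRr⟩ := h.exists_of_mem l hl
      exact ⟨r, hr, he, (hR' r).2 (Or.inr hRr)⟩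
  · intro r hr hRr
    rcases (hR' r).1 hRr with rfl | hRr
    · exact (hC' _).2 (Or.inl hmu)
    · exact (hC' _).2 (Or.inr (h.mem_of_lt r hr hRr))
  · intro q hq r hr hrq
    by_cases hqi : q = i'
    · subst hqi
      rw [hmm' r hr]
      split_ifs with hri
      · exact hj
      · exact h.variant_lt i hi r hr hri
    · rw [hmm q hqi r hr]
      exact h.variant_lt q (hold q hq hqi) r hr hrq
  · intro q hq r hr hrq r' hr' hrq'
    by_cases hqi : q = i'
    · subst hqi
      rw [hmm' r hr, hmm' r' hr']
      split_ifs with h1 h2 h2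
      · intro _; omega
      · intro he; exact absurd he.symm (hne r' hr' h2 hrq')
      · intro he; exact absurd he (hne r hr h1 hrq)
      · exact h.variant_inj i hi r hr h1 r' hr' h2
    · rw [hmm q hqi r hr, hmm q hqi r' hr']
      exact h.variant_inj q (hold q hq hqi) r hr hrq r' hr' hrq'
  · intro q hq r hr hrq
    by_cases hqi : q = i'
    · subst hqi
      rw [hmm' r hr]
      split_ifs with hri
      · rw [hri]; exact ht
      · exact h.variant_tight i hi r hr hri
    · rw [hmm q hqi r hr]
      exact h.variant_tight q (hold q hq hqi) r hr hrq
  · intro q hq r hr hrq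
    by_cases hqi : q = i'
    · subst hqi
      rw [hmm' r hr]
      split_ifs with hri
      · exact Or.inl ((hC' j).2 (Or.inl rfl))
      · exact (h.variant_mem i hi r hr hri).imp_left fun h => (hC' _).2 (Or.inr h)
    · rw [hmm q hqi r hr]
      exact (h.variant_mem q (hold q hq hqi) r hr hrq).imp_left fun h => (hC' _).2 (Or.inr h)
  · intro q hq r hr hRr
    rw [hR', not_or] at hRr
    by_cases hqi : q = i'
    · subst hqi
      have hri : r ≠ i := by rintro rfl; exact hRr.2 hi
      rw [hmm' r hr, if_neg hri]
      exact h.variant_eq i hi r hr hRr.2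
    · rw [hmm q hqi r hr]
      exact h.variant_eq q (hold q hq hqi) r hr hRr.2

/-- The stored matching that leaves out `i` covers all other rows up to `p`; as `j` is free, adding
the pair (i, j) completes it. No alternating path needs to be traced back. -/
theorem augment (h : AlternatingTree k p c mu u v R C mm) {i j : ℕ} (hi : R i) (hj : j < k)
    (hCj : ¬ C j) (ht : u i + v j = c i j) (hfree : ∀ r < p, mu r ≠ j) {mu' : ℕ → ℕ}
    (hmu : ∀ r ≤ p, mu' r = if r = i then j else mm i r) :
    TightMatching k (p + 1) c mu' u v := by
  have hne : ∀ r ≤ p, r ≠ i → mm i r ≠ j := by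
    intro r hr hri he
    rcases h.variant_mem i hi r hr hri with h1 | ⟨h1, h2⟩
    · exact hCj (he ▸ h1)
    · exact hfree r h1 (by rw [← h2, he])
  refine ⟨?_, ?_, ?_, h.dual⟩
  · intro r hr
    rw [hmu r (by omega)]
    split_ifs with hri
    · exact hj
    · exact h.variant_lt i hi r (by omega) hri
  · intro r hr r' hr'
    rw [hmu r (by omega), hmu r' (by omega)]
    split_ifs with h1 h2 h2
    · intro _; omega
    · intro he; exact absurd he.symm (hne r' (by omega) h2)
    · intro he; exact absurd he (hne r (by omega) h1)
    · exact h.variant_inj i hi r (by omega) h1 r' (by omega) h2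
  · intro r hr
    rw [hmu r (by omega)]
    split_ifs with hri
    · rw [hri]; exact ht
    · exact h.variant_tight i hi r (by omega) hri

/-- Each tree column is the partner of a row below `p`. This bounds the number of growth steps in a
phase. -/
theorem ncard_le (h : AlternatingTree k p c mu u v R C mm) : {j | C j}.ncard ≤ p := by
  have h1 : {j | C j} ⊆ ((Finset.range p).image mu : Finset ℕ) := by
    intro j hj
    obtain ⟨i, hi, he, -⟩ := h.exists_of_mem j hj
    simp only [Finset.coe_image, Finset.coe_range, Set.mem_image, Set.mem_Iio]
    exact ⟨i, hi, he⟩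
  refine (Set.ncard_le_ncard h1 (Finset.finite_toSet _)).trans ?_
  rw [Set.ncard_coe_finset]
  exact Finset.card_image_le.trans (Finset.card_range p).le

theorem finite_columns (h : AlternatingTree k p c mu u v R C mm) : {j | C j}.Finite := by
  refine (Set.finite_Iio k).subset fun j hj => ?_
  obtain ⟨i, hi, rfl, -⟩ := h.exists_of_mem j hj
  exact h.lt i hi

theorem exists_notMem (h : AlternatingTree k p c mu u v R C mm) (hpk : p < k) :
    ∃ j < k, ¬ C j := by
  by_contra! hcon
  have h1 : (Finset.range k : Set ℕ) ⊆ {j | C j} := fun j hj => hcon j (by simpa using hj)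
  have h2 := Set.ncard_le_ncard h1 h.finite_columns
  rw [Set.ncard_coe_finset, Finset.card_range] at h2
  exact absurd (h2.trans h.ncard_le) (by omega)

end AlternatingTree

theorem TightMatching.alternatingTree {k p : ℕ} {c : ℕ → ℕ → ℝ} {mu : ℕ → ℕ} {u v : ℕ → ℝ}
    (h : TightMatching k p c mu u v) {R C : ℕ → Prop} {mm : ℕ → ℕ → ℕ} (hR : ∀ i, R i ↔ i = p)
    (hC : ∀ j, ¬ C j) (hmm : ∀ r ≤ p, mm p r = mu r) : AlternatingTree k p c mu u v R C mm := by
  refine ⟨h, (hR p).2 rfl, ?_, ?_, ?_, ?_, ?_, ?_, ?_, ?_⟩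
  · intro i hi; exact ((hR i).1 hi).le
  · intro j hj; exact absurd hj (hC j)
  · intro i hi hRi; exact absurd ((hR i).1 hRi) (by omega)
  · intro i hi r hr hri
    obtain rfl := (hR i).1 hi
    rw [hmm r hr]; exact h.lt r (by omega)
  · intro i hi r hr hri r' hr' hri'
    obtain rfl := (hR i).1 hi
    rw [hmm r hr, hmm r' hr']; exact h.inj r (by omega) r' (by omega)
  · intro i hi r hr hri
    obtain rfl := (hR i).1 hi
    rw [hmm r hr]; exact h.tight r (by omega)
  · intro i hi r hr hri
    obtain rfl := (hR i).1 hi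
    exact Or.inr ⟨by omega, hmm r hr⟩
  · intro i hi r hr _
    obtain rfl := (hR i).1 hi
    exact hmm r hr

/-! ### The Hungarian algorithm as a program -/

namespace Machine

/-- Start a tree at the row in register `50`. -/
def initPhase : Prog :=
  .seq (.iter 51 false (.setNat 42 (.reg 51) (.lit 0) (.lit 0)))
    (.seq (.iter 51 false (.setNat 43 (.reg 51) (.lit 0) (.lit 0)))
      (.seq (.setNat 42 (.reg 50) (.lit 0) (.lit 1))
        (.seq (.iter 51 false (.setNat 44 (.reg 50) (.reg 51) (.get 40 (.reg 51) (.lit 0))))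
          (.setNat 45 (.lit 0) (.lit 0) (.lit 0)))))

/-- Find a row of the tree and a column outside the tree of minimum slack. -/
def findTight : Prog :=
  .seq (.setNat 13 (.lit 0) (.lit 0) (.lit 0))
    (.iter 53 false (.iter 54 false
      (consider (.conj (.natLe (.lit 1) (.get 42 (.reg 53) (.lit 0)))
          (.conj (.natLe (.add (.reg 54) (.lit 1)) (.reg 8))
            (.neg (.natLe (.lit 1) (.get 43 (.reg 54) (.lit 0))))))
        (.sub (.sub (.get 3 (.reg 53) (.reg 54)) (.get 4 (.reg 53) (.lit 0)))
          (.get 5 (.reg 54) (.lit 0)))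
        (.reg 53) (.reg 54) (.lit 0))))

/-- Change the prices by the slack in the real register `2`. -/
def changePrices : Prog :=
  .seq (.iter 51 false (.onlyIf (.natLe (.lit 1) (.get 42 (.reg 51) (.lit 0)))
      (.setReal 4 (.reg 51) (.lit 0) (.add (.get 4 (.reg 51) (.lit 0)) (.reg 2)))))
    (.iter 51 false (.onlyIf (.natLe (.lit 1) (.get 43 (.reg 51) (.lit 0)))
      (.setReal 5 (.reg 51) (.lit 0) (.sub (.get 5 (.reg 51) (.lit 0)) (.reg 2)))))

/-- Find out which row is matched to the column in register `15`. -/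
def findPartner : Prog :=
  .seq (.setNat 41 (.lit 0) (.lit 0) (.lit 0))
    (.iter 51 false (.onlyIf (.conj (.natLe (.add (.reg 51) (.lit 1)) (.reg 50))
        (.conj (.natLe (.get 40 (.reg 51) (.lit 0)) (.reg 15))
          (.natLe (.reg 15) (.get 40 (.reg 51) (.lit 0)))))
      (.setNat 41 (.lit 0) (.lit 0) (.add (.reg 51) (.lit 1)))))

/-- Enlarge the matching. -/
def augment : Prog :=
  .seq (.setNat 45 (.lit 0) (.lit 0) (.lit 1))
    (.seq (.iter 51 false (.setNat 40 (.reg 51) (.lit 0) (.get 44 (.reg 14) (.reg 51))))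
      (.setNat 40 (.reg 14) (.lit 0) (.reg 15)))

/-- Enlarge the tree. -/
def growAlternating : Prog :=
  .seq (.iter 51 false
      (.setNat 44 (.sub (.reg 41) (.lit 1)) (.reg 51) (.get 44 (.reg 14) (.reg 51))))
    (.seq (.setNat 44 (.sub (.reg 41) (.lit 1)) (.reg 14) (.reg 15))
      (.seq (.setNat 43 (.reg 15) (.lit 0) (.lit 1))
        (.setNat 42 (.sub (.reg 41) (.lit 1)) (.lit 0) (.lit 1))))

/-- Enlarge the tree or, if possible, the matching. -/
def alternatingStep : Prog :=
  .seq findTight (.seq changePrices (.seq findPartner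
    (.seq (.onlyIf (.natLe (.lit 1) (.reg 41)) growAlternating)
      (.onlyIf (.neg (.natLe (.lit 1) (.reg 41))) augment))))

/-- Match one more row. -/
def matchingPhase : Prog :=
  .seq initPhase (.iter 52 false (.onlyIf (.neg (.natLe (.lit 1) (.reg 45))) alternatingStep))

/-- The Hungarian algorithm for the costs in real array `3`, with the number of rows and columns
in register `8`. -/
def hungarian : Prog :=
  .iter 50 false (.onlyIf (.natLe (.add (.reg 50) (.lit 1)) (.reg 8)) matchingPhase)

/-- The state holds a tight matching of `p` rows. -/
def HoldsMatching (k p : ℕ) (c : ℕ → ℕ → ℝ) (s : State) : Prop :=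
  TightMatching k p c (fun i => s.nat 40 i 0) (fun i => s.real 4 i 0) fun j => s.real 5 j 0

/-- The columns of the tree. -/
def treeColumns (n : ℕ) (s : State) (j : ℕ) : Prop := j < n ∧ 1 ≤ s.nat 43 j 0

/-- The rows of the tree. -/
def treeRows (n : ℕ) (s : State) (i : ℕ) : Prop := i < n ∧ 1 ≤ s.nat 42 i 0

/-- The state holds an alternating tree. -/
def HoldsTree (n k p : ℕ) (c : ℕ → ℕ → ℝ) (s : State) : Prop :=
  AlternatingTree k p c (fun i => s.nat 40 i 0) (fun i => s.real 4 i 0) (fun j => s.real 5 j 0)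
    (treeRows n s) (treeColumns n s) (s.nat 44)

theorem HoldsMatching.congr {k p : ℕ} {c : ℕ → ℕ → ℝ} {s s' : State} (h : HoldsMatching k p c s)
    (h40 : s'.nat 40 = s.nat 40) (h4 : s'.real 4 = s.real 4) (h5 : s'.real 5 = s.real 5) :
    HoldsMatching k p c s' := by
  unfold HoldsMatching
  rw [h40, h4, h5]
  exact h

theorem HoldsTree.congr {n k p : ℕ} {c : ℕ → ℕ → ℝ} {s s' : State} (h : HoldsTree n k p c s)
    (h40 : s'.nat 40 = s.nat 40) (h42 : s'.nat 42 = s.nat 42) (h43 : s'.nat 43 = s.nat 43)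
    (h44 : s'.nat 44 = s.nat 44) (h4 : s'.real 4 = s.real 4) (h5 : s'.real 5 = s.real 5) :
    HoldsTree n k p c s' := by
  unfold HoldsTree treeRows treeColumns
  rw [h40, h42, h43, h44, h4, h5]
  exact h

section

variable {n k p : ℕ} {c : ℕ → ℕ → ℝ} {s : State}

/-- The initial tree is the single row `p`, and the matching that leaves it out is the current one.
The entry copied for row `p` itself may be stale, as nothing depends on it. -/
theorem run_initPhase (hn : s.size false = n) (hkn : k ≤ n) (hp : s.nat 50 0 0 = p) (hpk : p < k)
    (h : HoldsMatching k p c s) :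
    HoldsTree n k p c (initPhase.run s) ∧ (initPhase.run s).nat 45 0 0 = 0 := by
  have h40 : (initPhase.run s).nat 40 = s.nat 40 := Prog.run_nat_of_notMem (by decide) s
  have h4 : (initPhase.run s).real 4 = s.real 4 := Prog.run_real_of_notMem (by decide) s
  have h5 : (initPhase.run s).real 5 = s.real 5 := Prog.run_real_of_notMem (by decide) s
  set p1 : Prog := .iter 51 false (.setNat 42 (.reg 51) (.lit 0) (.lit 0)) with hp1
  set p2 : Prog := .iter 51 false (.setNat 43 (.reg 51) (.lit 0) (.lit 0)) with hp2
  set p3 : Prog := .setNat 42 (.reg 50) (.lit 0) (.lit 1) with hp3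
  set p4 : Prog := .iter 51 false (.setNat 44 (.reg 50) (.reg 51) (.get 40 (.reg 51) (.lit 0)))
    with hp4
  have h42 : ∀ i, i < n → (p1.run s).nat 42 i 0 = 0 := by
    intro i hi
    rw [hp1, Prog.run_iter_column (by decide) (fun _ => 0) fun k s' hk hc hn hr hold u v => ?_,
      if_pos ⟨hn ▸ hi, rfl⟩]
    rw [Prog.run, State.writeNat_nat_self]
    simp only [NExp.eval, NExp.reg, hc]
  have h43 : ∀ i, i < n → (p2.run (p1.run s)).nat 43 i 0 = 0 := by
    intro i hi
    have hsz : (p1.run s).size false = n := by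
      rw [State.size, Prog.run_nat_of_notMem (by decide)]; exact hn
    rw [hp2, Prog.run_iter_column (by decide) (fun _ => 0) fun k s' hk hc hn hr hold u v => ?_,
      if_pos ⟨hsz ▸ hi, rfl⟩]
    rw [Prog.run, State.writeNat_nat_self]
    simp only [NExp.eval, NExp.reg, hc]
  have h50 : ∀ q : Prog, 50 ∉ q.natWrites → (q.run s).nat 50 0 0 = p := fun q hq => by
    rw [Prog.run_nat_of_notMem hq, hp]
  have h50' : (p2.run (p1.run s)).nat 50 0 0 = p := h50 (p1.seq p2) (by decide)
  have h44 : ∀ r, r < n → (p4.run (p3.run (p2.run (p1.run s)))).nat 44 p r = s.nat 40 r 0 := by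
    intro r hr
    have h0 : ((p1.seq (p2.seq p3)).run s).nat 0 = s.nat 0 :=
      Prog.run_nat_of_notMem (by decide) s
    have hsz : (p3.run (p2.run (p1.run s))).size false = n :=
      (congrFun (congrFun h0 0) 0).trans hn
    rw [hp4, Prog.run_iter_row (by decide) p (fun t => s.nat 40 t 0)
      fun k s' hk hc hn hr' hold u v => ?_, if_pos ⟨rfl, hsz ▸ hr⟩]
    rw [Prog.run, State.writeNat_nat_self]
    have h1 : (p3.run (p2.run (p1.run s))).nat 50 0 0 = p := h50 (p1.seq (p2.seq p3)) (by decide)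
    have h2 : (p3.run (p2.run (p1.run s))).nat 40 = s.nat 40 :=
      Prog.run_nat_of_notMem (p := p1.seq (p2.seq p3)) (by decide) s
    simp only [NExp.eval, NExp.reg, hc, hn 50 (by decide), hn 40 (by decide), h1, h2]
  have heq : initPhase.run s = (Prog.setNat 45 (.lit 0) (.lit 0) (.lit 0)).run
      (p4.run (p3.run (p2.run (p1.run s)))) := rfl
  have hfin42 : ∀ i, (initPhase.run s).nat 42 i 0 = if i = p then 1 else (p1.run s).nat 42 i 0 := by
    intro i
    have e1 : (initPhase.run s).nat 42 = (p3.run (p2.run (p1.run s))).nat 42 := by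
      rw [heq]
      exact Prog.run_nat_of_notMem (p := p4.seq (.setNat 45 (.lit 0) (.lit 0) (.lit 0)))
        (by decide) _
    have e2 : (p2.run (p1.run s)).nat 42 = (p1.run s).nat 42 := Prog.run_nat_of_notMem (by decide) _
    rw [e1, hp3, Prog.run, State.writeNat_nat_self]
    simp only [NExp.eval, NExp.reg, h50', e2, and_true]
  have hfin43 : (initPhase.run s).nat 43 = (p2.run (p1.run s)).nat 43 := by
    rw [heq]
    exact Prog.run_nat_of_notMem (p := p3.seq (p4.seq (.setNat 45 (.lit 0) (.lit 0) (.lit 0))))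
      (by decide) _
  have hfin44 : (initPhase.run s).nat 44 = (p4.run (p3.run (p2.run (p1.run s)))).nat 44 := by
    rw [heq]
    exact Prog.run_nat_of_notMem (by decide) _
  refine ⟨?_, by rw [heq]; simp [Prog.run, State.writeNat, NExp.eval]⟩
  unfold HoldsTree
  rw [h40, h4, h5]
  refine TightMatching.alternatingTree h ?_ ?_ ?_
  · intro i
    simp only [treeRows, hfin42]
    constructor
    · rintro ⟨hi, h1⟩
      by_contra hip
      rw [if_neg hip, h42 i hi] at h1
      omega
    · rintro rfl
      exact ⟨by omega, by simp⟩
  · rintro j ⟨hj, h1⟩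
    rw [hfin43, h43 j hj] at h1
    omega
  · intro r hr
    rw [hfin44, h44 r (by omega)]

/-- The inner invariant covers complete rows below `l` together with the part of row `l` to the left
of the inner counter. The third component of a candidate is a dummy, fixed to 0. -/
theorem recorded_findTight (hn : s.size false = n) (hk : s.nat 8 0 0 = k) :
    Recorded (fun i j w => w = 0 ∧ i < n ∧ j < n ∧ 1 ≤ s.nat 42 i 0 ∧ j < k ∧ ¬ 1 ≤ s.nat 43 j 0)
      (fun i j _ => s.real 3 i j - s.real 4 i 0 - s.real 5 j 0) (findTight.run s) := by
  set key : ℕ → ℕ → ℕ → ℝ := fun i j _ => s.real 3 i j - s.real 4 i 0 - s.real 5 j 0 with hkey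
  set good : ℕ → ℕ → ℕ → Prop := fun i j w =>
    w = 0 ∧ 1 ≤ s.nat 42 i 0 ∧ j < k ∧ ¬ 1 ≤ s.nat 43 j 0 with hgood
  rw [findTight, Prog.run]
  set s0 := (Prog.setNat 13 (.lit 0) (.lit 0) (.lit 0)).run s with hs0
  have hfr : ∀ b ≠ 13, s0.nat b = s.nat b := fun b hb => State.writeNat_nat_of_ne _ hb _ _ _
  have hsize : s0.size false = n := by rw [State.size, hfr _ (by norm_num)]; exact hn
  have houter := Prog.run_iter_of_frame (c := 53) (edges := false) (s := s0)
    (p := .iter 54 false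
      (consider (.conj (.natLe (.lit 1) (.get 42 (.reg 53) (.lit 0)))
          (.conj (.natLe (.add (.reg 54) (.lit 1)) (.reg 8))
            (.neg (.natLe (.lit 1) (.get 43 (.reg 54) (.lit 0))))))
        (.sub (.sub (.get 3 (.reg 53) (.reg 54)) (.get 4 (.reg 53) (.lit 0)))
          (.get 5 (.reg 54) (.lit 0)))
        (.reg 53) (.reg 54) (.lit 0)))
    (fun l s' => Recorded (fun i j w => good i j w ∧ i < l ∧ j < n) key s')
    (Or.inl ⟨by simp [State.writeNat, hs0, Prog.run, NExp.eval], fun a b c h => by omega⟩)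
    ?_
  · rw [hsize] at houter
    refine houter.congr (fun a b c => ?_) rfl rfl rfl rfl rfl
    simp only [hgood]
    tauto
  intro l s1 hl hc1 hn1 hr1 hinv1
  have hsize1 : s1.size false = n := by rw [State.size, hn1 0 (by decide)]; exact hsize
  have hinner := Prog.run_iter_of_frame (c := 54) (edges := false) (s := s1)
    (p := 
      (consider (.conj (.natLe (.lit 1) (.get 42 (.reg 53) (.lit 0)))
          (.conj (.natLe (.add (.reg 54) (.lit 1)) (.reg 8))
            (.neg (.natLe (.lit 1) (.get 43 (.reg 54) (.lit 0))))))
        (.sub (.sub (.get 3 (.reg 53) (.reg 54)) (.get 4 (.reg 53) (.lit 0)))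
          (.get 5 (.reg 54) (.lit 0)))
        (.reg 53) (.reg 54) (.lit 0)))
    (fun t s' => Recorded (fun i j w => good i j w ∧ ((i < l ∧ j < n) ∨ (i = l ∧ j < t))) key s')
    (hinv1.congr (fun a b c => by
        simp only [Nat.not_lt_zero, and_false, or_false])
        (State.writeNat_nat_of_ne _ (by decide) _ _ _)
      (State.writeNat_nat_of_ne _ (by decide) _ _ _) (State.writeNat_nat_of_ne _ (by decide) _ _ _)
      (State.writeNat_nat_of_ne _ (by decide) _ _ _) rfl)
    ?_
  · rw [hsize1] at hinner
    refine hinner.congr (fun a b c => ?_) (State.writeNat_nat_of_ne _ (by decide) _ _ _)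
      (State.writeNat_nat_of_ne _ (by decide) _ _ _) (State.writeNat_nat_of_ne _ (by decide) _ _ _)
      (State.writeNat_nat_of_ne _ (by decide) _ _ _) rfl
    have : a < l + 1 ↔ a < l ∨ a = l := by omega
    rw [this]; tauto
  intro t s2 ht hc2 hn2 hr2 hinv2
  have hfr2 : ∀ b, b ∉ [13, 14, 15, 16, 53, 54] → s2.nat b = s.nat b := by
    intro b hb
    simp only [List.mem_cons, not_or] at hb
    rw [hn2 b (by simp [consider, Prog.natWrites, hb]),
      hn1 b (by simp [consider, Prog.natWrites, hb]), hfr b hb.1]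
  have hfrr2 : ∀ b ≠ 2, s2.real b = s.real b := by
    intro b hb
    rw [hr2 b (by simp [consider, Prog.realWrites, hb]),
      hr1 b (by simp [consider, Prog.realWrites, hb])]; rfl
  have h53 : s2.nat 53 0 0 = l := by rw [hn2 53 (by decide), hc1]
  refine (hinv2.run_consider (cand' := fun i j w =>
    good i j w ∧ ((i < l ∧ j < n) ∨ (i = l ∧ j < t + 1))) (a := l) (b := t) (c := 0) ?_ ?_ ?_).congr
    (fun a b c => Iff.rfl) (State.writeNat_nat_of_ne _ (by decide) _ _ _)
    (State.writeNat_nat_of_ne _ (by decide) _ _ _) (State.writeNat_nat_of_ne _ (by decide) _ _ _)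
    (State.writeNat_nat_of_ne _ (by decide) _ _ _) rfl
  · simp only [hkey, RExp.eval, NExp.eval, NExp.reg, h53, hc2, hfrr2 3 (by decide),
      hfrr2 4 (by decide), hfrr2 5 (by decide)]
  · intro s3 hs3
    simp only [NExp.eval, NExp.reg, hs3 53 (by decide), hs3 54 (by decide), h53, hc2, and_self]
  · intro a b w
    simp only [Test.Holds, NExp.eval, NExp.reg, h53, hc2, hfr2 42 (by decide),
      hfr2 43 (by decide), hfr2 8 (by decide), hk, hgood]
    constructor
    · rintro ⟨⟨rfl, h2, h3, h4⟩, h5⟩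
      by_cases hab : a = l ∧ b = t
      · obtain ⟨rfl, rfl⟩ := hab
        exact Or.inr ⟨⟨h2, by omega, h4⟩, rfl, rfl, rfl⟩
      · exact Or.inl ⟨⟨rfl, h2, h3, h4⟩, by omega⟩
    · rintro (⟨h1, h2⟩ | ⟨⟨h1, h2, h3⟩, rfl, rfl, rfl⟩)
      · exact ⟨h1, by omega⟩
      · exact ⟨⟨rfl, h1, by omega, h3⟩, by omega⟩

theorem run_changePrices (hn : s.size false = n) :
    (∀ i < n, (changePrices.run s).real 4 i 0 =
      if 1 ≤ s.nat 42 i 0 then s.real 4 i 0 + s.real 2 0 0 else s.real 4 i 0) ∧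
    ∀ j < n, (changePrices.run s).real 5 j 0 =
      if 1 ≤ s.nat 43 j 0 then s.real 5 j 0 - s.real 2 0 0 else s.real 5 j 0 := by
  rw [changePrices, Prog.run]
  set p1 : Prog := .iter 51 false (.onlyIf (.natLe (.lit 1) (.get 42 (.reg 51) (.lit 0)))
      (.setReal 4 (.reg 51) (.lit 0) (.add (.get 4 (.reg 51) (.lit 0)) (.reg 2)))) with hp1
  have h1n : ∀ b ≠ 51, (p1.run s).nat b = s.nat b := fun b hb =>
    Prog.run_nat_of_notMem (by simp [hp1, Prog.natWrites, hb]) s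
  have h1r : ∀ b ≠ 4, (p1.run s).real b = s.real b := fun b hb =>
    Prog.run_real_of_notMem (by simp [hp1, Prog.realWrites, hb]) s
  constructor
  · intro i hi
    rw [Prog.run_real_of_notMem (by decide)]
    rw [hp1, Prog.run_iter_real_column (fun i => if 1 ≤ s.nat 42 i 0 then
      s.real 4 i 0 + s.real 2 0 0 else s.real 4 i 0) ?_, if_pos ⟨hn ▸ hi, rfl⟩]
    intro k s' hk hc hn' hr hold u v
    rw [Prog.run]
    simp only [Test.Holds, NExp.eval, NExp.reg, hc, hn' 42 (by decide)]
    split_ifs with h1 h2 h2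
    · rw [Prog.run, State.writeReal_real_self]
      simp only [NExp.eval, RExp.eval, RExp.reg, hc, hr 2 (by decide), h2, and_self, if_true]
      rw [hold k 0 le_rfl]
    · rw [Prog.run, State.writeReal_real_self]
      simp only [NExp.eval, hc, if_neg h2]
    · rw [h2.1, h2.2, hold k 0 le_rfl]
    · rfl
  · intro j hj
    have hsize : (p1.run s).size false = n := by rw [State.size, h1n 0 (by decide)]; exact hn
    rw [Prog.run_iter_real_column (fun j => if 1 ≤ s.nat 43 j 0 then
      s.real 5 j 0 - s.real 2 0 0 else s.real 5 j 0) ?_, if_pos ⟨hsize ▸ hj, rfl⟩]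
    intro k s' hk hc hn' hr hold u v
    rw [Prog.run]
    simp only [Test.Holds, NExp.eval, NExp.reg, hc, hn' 43 (by decide), h1n 43 (by decide)]
    split_ifs with h1 h2 h2
    · rw [Prog.run, State.writeReal_real_self]
      simp only [NExp.eval, RExp.eval, RExp.reg, hc, hr 2 (by decide), h2, and_self, if_true]
      rw [hold k 0 le_rfl, h1r 5 (by decide), h1r 2 (by decide)]
    · rw [Prog.run, State.writeReal_real_self]
      simp only [NExp.eval, hc, if_neg h2]
    · rw [h2.1, h2.2, hold k 0 le_rfl, h1r 5 (by decide)]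
    · rfl

/-- Register 41 holds the row plus one, so that 0 can stand for a free column. -/
theorem run_findPartner (hn : s.size false = n) (hp : s.nat 50 0 0 = p) (hpn : p ≤ n) :
    ((findPartner.run s).nat 41 0 0 = 0 ∧ ∀ r < p, s.nat 40 r 0 ≠ s.nat 15 0 0) ∨
      ∃ r < p, (findPartner.run s).nat 41 0 0 = r + 1 ∧ s.nat 40 r 0 = s.nat 15 0 0 := by
  rw [findPartner, Prog.run]
  set s0 := (Prog.setNat 41 (.lit 0) (.lit 0) (.lit 0)).run s with hs0
  have hfr : ∀ b ≠ 41, s0.nat b = s.nat b := fun b hb => State.writeNat_nat_of_ne _ hb _ _ _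
  have hsize : s0.size false = n := by rw [State.size, hfr _ (by norm_num)]; exact hn
  have key := Prog.run_iter_of_frame (c := 51) (edges := false) (s := s0)
    (p := .onlyIf (.conj (.natLe (.add (.reg 51) (.lit 1)) (.reg 50))
        (.conj (.natLe (.get 40 (.reg 51) (.lit 0)) (.reg 15))
          (.natLe (.reg 15) (.get 40 (.reg 51) (.lit 0)))))
      (.setNat 41 (.lit 0) (.lit 0) (.add (.reg 51) (.lit 1))))
    (fun t s' => (s'.nat 41 0 0 = 0 ∧ ∀ r < p, r < t → s.nat 40 r 0 ≠ s.nat 15 0 0) ∨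
      ∃ r < p, s'.nat 41 0 0 = r + 1 ∧ s.nat 40 r 0 = s.nat 15 0 0)
    (Or.inl ⟨by simp [State.writeNat, hs0, Prog.run, NExp.eval], by omega⟩) ?_
  · rw [hsize] at key
    rcases key with ⟨h1, h2⟩ | h
    · exact Or.inl ⟨h1, fun r hr => h2 r hr (by omega)⟩
    · exact Or.inr h
  · intro t s' ht hc hn' hr hinv
    rw [State.writeNat_nat_of_ne _ (by decide), Prog.run]
    have h50 : s'.nat 50 0 0 = p := by rw [hn' 50 (by decide), hfr 50 (by decide), hp]
    have h40 : s'.nat 40 = s.nat 40 := by rw [hn' 40 (by decide), hfr 40 (by decide)]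
    have h15 : s'.nat 15 = s.nat 15 := by rw [hn' 15 (by decide), hfr 15 (by decide)]
    simp only [Test.Holds, NExp.eval, NExp.reg, hc, h50, h40, h15]
    split_ifs with h1
    · refine Or.inr ⟨t, by omega, ?_, by omega⟩
      simp [Prog.run, State.writeNat, NExp.eval, hc]
    · rcases hinv with ⟨h2, h3⟩ | h
      · refine Or.inl ⟨h2, fun r hr hrt => ?_⟩
        rcases Nat.lt_succ_iff_lt_or_eq.1 hrt with hrt | rfl
        · exact h3 r hr hrt
        · intro he; exact h1 ⟨by omega, by omega, by omega⟩
      · exact Or.inr h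

theorem run_augment (hn : s.size false = n) (r : ℕ) (hr : r < n) :
    (augment.run s).nat 40 r 0 =
      if r = s.nat 14 0 0 then s.nat 15 0 0 else s.nat 44 (s.nat 14 0 0) r := by
  rw [augment, Prog.run, Prog.run]
  set s0 := (Prog.setNat 45 (.lit 0) (.lit 0) (.lit 1)).run s with hs0
  have hfr : ∀ b ≠ 45, s0.nat b = s.nat b := fun b hb => State.writeNat_nat_of_ne _ hb _ _ _
  have hsize : s0.size false = n := by rw [State.size, hfr _ (by norm_num)]; exact hn
  set p1 : Prog := .iter 51 false (.setNat 40 (.reg 51) (.lit 0) (.get 44 (.reg 14) (.reg 51)))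
    with hp1
  have h1 : (p1.run s0).nat 40 r 0 = s.nat 44 (s.nat 14 0 0) r := by
    rw [hp1, Prog.run_iter_column (by decide) (fun r => s.nat 44 (s.nat 14 0 0) r) ?_,
      if_pos ⟨hsize ▸ hr, rfl⟩]
    intro k s' hk hc hn' hr hold u v
    rw [Prog.run, State.writeNat_nat_self]
    simp only [NExp.eval, NExp.reg, hc, hn' 44 (by decide), hn' 14 (by decide), hfr 44 (by decide),
      hfr 14 (by decide)]
  have h2 : ∀ b, b ∉ [40, 45, 51] → (p1.run s0).nat b = s.nat b := fun b hb => by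
    simp only [List.mem_cons, not_or] at hb
    rw [Prog.run_nat_of_notMem (by simp [hp1, Prog.natWrites, hb]), hfr b hb.2.1]
  change State.nat (Prog.run (.setNat 40 (.reg 14) (.lit 0) (.reg 15)) (p1.run s0)) 40 r 0 = _
  clear_value s0 p1
  rw [Prog.run, State.writeNat_nat_self]
  simp only [NExp.eval, NExp.reg, h1, h2 14 (by decide), h2 15 (by decide), and_true]

/-- The row of array 44 for the left-out row in register 14 is copied to row `q`; `hne` keeps the
source intact during the copying. -/
theorem run_growAlternating (hn : s.size false = n) {q : ℕ} (hq : s.nat 41 0 0 = q + 1)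
    (hne : s.nat 14 0 0 ≠ q) :
    (∀ r t, (growAlternating.run s).nat 44 r t = if r = q ∧ t = s.nat 14 0 0 then s.nat 15 0 0
      else if r = q ∧ t < n then s.nat 44 (s.nat 14 0 0) t else s.nat 44 r t) ∧
    (∀ j, (growAlternating.run s).nat 43 j 0 = if j = s.nat 15 0 0 then 1 else s.nat 43 j 0) ∧
    ∀ i, (growAlternating.run s).nat 42 i 0 = if i = q then 1 else s.nat 42 i 0 := by
  rw [growAlternating, Prog.run]
  set p1 : Prog := .iter 51 false
    (.setNat 44 (.sub (.reg 41) (.lit 1)) (.reg 51) (.get 44 (.reg 14) (.reg 51))) with hp1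
  have h1 : ∀ r t, (p1.run s).nat 44 r t =
      if r = q ∧ t < n then s.nat 44 (s.nat 14 0 0) t else s.nat 44 r t := by
    rw [← hn]
    refine Prog.run_iter_row (by decide) _ _ fun k s' hk hc hn' hr hold u v => ?_
    rw [Prog.run, State.writeNat_nat_self]
    simp only [NExp.eval, NExp.reg, hc, hn' 41 (by decide), hn' 14 (by decide), hq,
      Nat.add_sub_cancel]
    rw [hold _ _ (Or.inl hne)]
  have h2 : ∀ b, b ≠ 44 → b ≠ 51 → (p1.run s).nat b = s.nat b := fun b hb hb' =>
    Prog.run_nat_of_notMem (by simp [hp1, Prog.natWrites, hb, hb']) _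
  clear_value p1
  simp only [Prog.run, NExp.eval, NExp.reg, State.writeNat]
  norm_num
  simp only [h1, h2 14 (by norm_num) (by norm_num), h2 15 (by norm_num) (by norm_num),
    h2 41 (by norm_num) (by norm_num), h2 42 (by norm_num) (by norm_num),
    h2 43 (by norm_num) (by norm_num), hq, Nat.add_sub_cancel, implies_true, and_self]

/-- One price change by the minimum slack makes a pair (tree row, outside column) tight. If the
column is free the matching is enlarged; otherwise its partner joins the tree, with one more column.
-/
theorem run_alternatingStep (hn : s.size false = n) (hkn : k ≤ n) (hk : s.nat 8 0 0 = k)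
    (hp : s.nat 50 0 0 = p) (hpk : p < k) (h45 : s.nat 45 0 0 = 0)
    (h : HoldsTree n k p (s.real 3) s) {s' : State} (hs' : s' = alternatingStep.run s) :
    (1 ≤ s'.nat 45 0 0 ∧ HoldsMatching k (p + 1) (s.real 3) s') ∨
      (s'.nat 45 0 0 = 0 ∧ HoldsTree n k p (s.real 3) s' ∧
        {j | treeColumns n s' j}.ncard = {j | treeColumns n s j}.ncard + 1) := by
  have hrec := recorded_findTight hn hk
  rw [alternatingStep, Prog.run, Prog.run, Prog.run, Prog.run] at hs'
  set s1 := findTight.run s with hs1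
  have hn1 : ∀ b, b ∉ findTight.natWrites → s1.nat b = s.nat b := fun b hb =>
    Prog.run_nat_of_notMem hb s
  have hr1 : ∀ b, b ∉ findTight.realWrites → s1.real b = s.real b := fun b hb =>
    Prog.run_real_of_notMem hb s
  rcases hrec with ⟨-, hnone⟩ | ⟨-, ⟨-, hi, hjn, hRi, hjk, hCj⟩, hkey, hmin⟩
  · obtain ⟨j, hj, hCj⟩ := AlternatingTree.exists_notMem h hpk
    -- A candidate always exists: row `p` is in the tree, and at most `p < k` columns are.
    refine absurd ⟨rfl, h.root_mem.1, ?_, h.root_mem.2, hj, ?_⟩ (hnone p j 0)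
    · omega
    · exact fun hcon => hCj ⟨by omega, hcon⟩
  obtain ⟨i, hie⟩ : ∃ i, s1.nat 14 0 0 = i := ⟨_, rfl⟩
  obtain ⟨j, hje⟩ : ∃ j, s1.nat 15 0 0 = j := ⟨_, rfl⟩
  rw [hie] at hi hRi hkey
  rw [hje] at hjn hjk hCj hkey
  have hp1 := run_changePrices (s := s1) (n := n) (by
    rw [State.size, hn1 0 (by decide)]; exact hn)
  set s2 := changePrices.run s1 with hs2
  have hn2 : ∀ b, b ∉ changePrices.natWrites → s2.nat b = s1.nat b := fun b hb =>
    Prog.run_nat_of_notMem hb s1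
  simp only [hn1 42 (by decide), hn1 43 (by decide), hr1 4 (by decide), hr1 5 (by decide)] at hp1
  obtain ⟨hu, hv⟩ := hp1
  have hδ : 0 ≤ s1.real 2 0 0 := by
    rw [hkey]
    have := h.dual i (by have := h.le_of_mem i ⟨hi, hRi⟩; omega) j hjk
    simp only at this ⊢
    linarith
  have hT2 : AlternatingTree k p (s.real 3) (fun i => s.nat 40 i 0) (fun i => s2.real 4 i 0)
      (fun j => s2.real 5 j 0) (treeRows n s) (treeColumns n s) (s.nat 44) := by
    refine AlternatingTree.dualStep h hδ ?_ hpk ?_ ?_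
    · intro a ha b hb hRa hCb
      exact hmin a b 0 ⟨rfl, hRa.1, by omega, hRa.2, hb, fun hcon => hCb ⟨by omega, hcon⟩⟩
    · intro a ha
      rw [hu a (by omega)]
      have : treeRows n s a ↔ 1 ≤ s.nat 42 a 0 := ⟨fun h => h.2, fun h => ⟨by omega, h⟩⟩
      simp only [this]
    · intro b hb
      rw [hv b (by omega)]
      have : treeColumns n s b ↔ 1 ≤ s.nat 43 b 0 := ⟨fun h => h.2, fun h => ⟨by omega, h⟩⟩
      simp only [this]
  have htight : s2.real 4 i 0 + s2.real 5 j 0 = s.real 3 i j := by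
    rw [hu i hi, hv j hjn, if_pos hRi, if_neg hCj, hkey]
    ring
  have hRi' : treeRows n s i := ⟨hi, hRi⟩
  have hCj' : ¬ treeColumns n s j := fun h => hCj h.2
  have hpart := run_findPartner (s := s2) (n := n) (p := p)
    (by rw [State.size, hn2 0 (by decide), hn1 0 (by decide)]; exact hn)
    (by rw [hn2 50 (by decide), hn1 50 (by decide), hp]) (by omega)
  set s3 := findPartner.run s2 with hs3
  have hn3 : ∀ b, b ∉ findTight.natWrites → b ∉ changePrices.natWrites →
      b ∉ findPartner.natWrites → s3.nat b = s.nat b := fun b hb hb' hb'' => by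
    rw [← hn1 b hb, ← hn2 b hb', hs3, Prog.run_nat_of_notMem hb'']
  have hr3 : s3.real = s2.real := by
    funext b
    exact Prog.run_real_of_notMem (by
      have : findPartner.realWrites = [] := rfl
      simp [this]) s2
  have h14 : s3.nat 14 0 0 = i := by
    rw [hs3, Prog.run_nat_of_notMem (by decide), hn2 14 (by decide), hie]
  have h15 : s3.nat 15 0 0 = j := by
    rw [hs3, Prog.run_nat_of_notMem (by decide), hn2 15 (by decide), hje]
  have hsize3 : s3.size false = n := by
    rw [State.size, hn3 0 (by decide) (by decide) (by decide)]; exact hn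
  rw [hn2 40 (by decide), hn1 40 (by decide), hn2 15 (by decide), hje] at hpart
  rcases hpart with ⟨h41, hfree⟩ | ⟨q, hqp, h41, hq⟩
  · have h1 : ¬ Test.Holds s3 (.natLe (.lit 1) (.reg 41)) := by
      simp [Test.Holds, NExp.eval, NExp.reg, h41]
    rw [show Prog.run (.onlyIf _ growAlternating) s3 = s3 from if_neg h1, Prog.run,
      if_pos (show Test.Holds s3 (.neg _) from h1)] at hs'
    refine Or.inl ⟨?_, ?_⟩
    · rw [hs', augment, Prog.run, Prog.run_nat_of_notMem (by decide)]
      simp [Prog.run, State.writeNat, NExp.eval]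
    · have hr' : s'.real = s2.real := by
        rw [← hr3, hs']
        funext b
        exact Prog.run_real_of_notMem (by
          have : augment.realWrites = [] := rfl
          simp [this]) s3
      unfold HoldsMatching
      rw [hr']
      refine hT2.augment hRi' hjk hCj' htight hfree fun r hr => ?_
      rw [hs', run_augment hsize3 r (by omega), h14, h15,
        hn3 44 (by decide) (by decide) (by decide)]
  · have h1 : Test.Holds s3 (.natLe (.lit 1) (.reg 41)) := by
      simp [Test.Holds, NExp.eval, NExp.reg, h41]
    -- The second conditional tests register 41 again; growing leaves it unchanged, so the
    -- augmenting branch is skipped.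
    have h2 : Test.Holds (growAlternating.run s3) (.natLe (.lit 1) (.reg 41)) := by
      simp only [Test.Holds, NExp.eval, NExp.reg,
        Prog.run_nat_of_notMem (p := growAlternating) (a := 41) (by decide), h41]
      omega
    rw [show Prog.run (.onlyIf _ growAlternating) s3 = growAlternating.run s3 from if_pos h1,
      Prog.run, if_neg (by simpa [Test.Holds] using h2)] at hs'
    have hiq : i ≠ q := by
      rintro rfl
      exact hCj' (hq ▸ hT2.mem_of_lt i hqp hRi')
    obtain ⟨h44', h43', h42'⟩ := run_growAlternating hsize3 h41 (by rwa [h14])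
    rw [← hs', h14, h15] at h44'
    rw [← hs', h15] at h43'
    rw [← hs'] at h42'
    simp only [hn3 44 (by decide) (by decide) (by decide)] at h44'
    simp only [hn3 43 (by decide) (by decide) (by decide)] at h43'
    simp only [hn3 42 (by decide) (by decide) (by decide)] at h42'
    have hr' : s'.real = s2.real := by
      rw [← hr3, hs']
      funext b
      exact Prog.run_real_of_notMem (by
        have : growAlternating.realWrites = [] := rfl
        simp [this]) s3
    have h40' : s'.nat 40 = s.nat 40 := by
      rw [hs', Prog.run_nat_of_notMem (by decide), hn3 40 (by decide) (by decide) (by decide)]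
    have hC' : ∀ l, treeColumns n s' l ↔ l = j ∨ treeColumns n s l := by
      intro l
      simp only [treeColumns, h43']
      by_cases hl : l = j
      · simp [hl, hjn]
      · simp [hl]
    refine Or.inr ⟨?_, ?_, ?_⟩
    · rw [hs', Prog.run_nat_of_notMem (by decide), hn3 45 (by decide) (by decide) (by decide), h45]
    · unfold HoldsTree
      rw [hr', h40']
      refine hT2.grow hRi' hjk hCj' htight hqp hq ?_ hC' ?_ ?_
      · intro r
        simp only [treeRows, h42']
        by_cases hr : r = q
        · simp [hr, show q < n by omega]
        · simp [hr]
      · intro r hr l hl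
        simp [h44', hr]
      · intro r hr
        simp [h44', show r < n by omega]
    · have : {l | treeColumns n s' l} = insert j {l | treeColumns n s l} := by
        ext l
        simp only [Set.mem_ofPred_eq, Set.mem_insert_iff, hC']
      rw [this]
      exact Set.ncard_insert_of_notMem (s := {l | treeColumns n s l}) hCj' hT2.finite_columns

theorem run_matchingPhase (hn : s.size false = n) (hkn : k ≤ n) (hk : s.nat 8 0 0 = k)
    (hp : s.nat 50 0 0 = p) (hpk : p < k) (h : HoldsMatching k p (s.real 3) s) :
    HoldsMatching k (p + 1) (s.real 3) (matchingPhase.run s) := by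
  obtain ⟨hT, h45⟩ := run_initPhase hn hkn hp hpk h
  rw [matchingPhase, Prog.run]
  have hfr : ∀ b, b ∉ initPhase.natWrites → (initPhase.run s).nat b = s.nat b := fun b hb =>
    Prog.run_nat_of_notMem hb s
  have hr3 : (initPhase.run s).real 3 = s.real 3 := Prog.run_real_of_notMem (by decide) s
  set s0 := initPhase.run s with hs0
  have hsize : s0.size false = n := by rw [State.size, hfr 0 (by decide)]; exact hn
  have key := Prog.run_iter_of_frame (c := 52) (edges := false) (s := s0)
    (p := .onlyIf (.neg (.natLe (.lit 1) (.reg 45))) alternatingStep)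
    (fun t s' => (1 ≤ s'.nat 45 0 0 ∧ HoldsMatching k (p + 1) (s.real 3) s') ∨
      (s'.nat 45 0 0 = 0 ∧ HoldsTree n k p (s.real 3) s' ∧ t ≤ {j | treeColumns n s' j}.ncard))
    (Or.inr ⟨by rw [State.writeNat_nat_of_ne _ (by decide), h45],
      hT.congr (State.writeNat_nat_of_ne _ (by decide) _ _ _)
        (State.writeNat_nat_of_ne _ (by decide) _ _ _)
        (State.writeNat_nat_of_ne _ (by decide) _ _ _)
        (State.writeNat_nat_of_ne _ (by decide) _ _ _) rfl rfl, Nat.zero_le _⟩) ?_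
  · rw [hsize] at key
    rcases key with ⟨-, h1⟩ | ⟨-, h1, h2⟩
    · exact h1
    -- Without an augmentation there would be at least `n` tree columns after `n` rounds, but there
    -- are at most `p < k ≤ n`.
    · exact absurd (h2.trans (AlternatingTree.ncard_le h1)) (by omega)
  · intro t s1 ht hc hn1 hr1 hinv
    have hM : ∀ {s2 : State} {q : ℕ}, HoldsMatching k q (s.real 3) s2 →
        HoldsMatching k q (s.real 3) (s2.writeNat 52 0 0 (t + 1)) := fun h =>
      h.congr (State.writeNat_nat_of_ne _ (by decide) _ _ _) rfl rfl
    have hT : ∀ {s2 : State}, HoldsTree n k p (s.real 3) s2 →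
        HoldsTree n k p (s.real 3) (s2.writeNat 52 0 0 (t + 1)) := fun h =>
      h.congr (State.writeNat_nat_of_ne _ (by decide) _ _ _)
        (State.writeNat_nat_of_ne _ (by decide) _ _ _)
        (State.writeNat_nat_of_ne _ (by decide) _ _ _)
        (State.writeNat_nat_of_ne _ (by decide) _ _ _) rfl rfl
    have hC : ∀ {s2 : State}, {j | treeColumns n (s2.writeNat 52 0 0 (t + 1)) j} =
        {j | treeColumns n s2 j} := by
      intro s2
      unfold treeColumns
      rw [State.writeNat_nat_of_ne _ (by decide)]
    rw [Prog.run]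
    rcases hinv with ⟨h1, h2⟩ | ⟨h1, h2, h3⟩
    · have h0 : ¬ Test.Holds s1 (.neg (.natLe (.lit 1) (.reg 45))) := not_not.2 h1
      rw [if_neg h0]
      refine Or.inl ⟨?_, hM h2⟩
      rwa [State.writeNat_nat_of_ne _ (by decide)]
    · rw [if_pos (by simp [Test.Holds, NExp.eval, NExp.reg, h1])]
      have h3r : s1.real 3 = s.real 3 := by rw [hr1 3 (by decide), hr3]
      have hstep := run_alternatingStep (s := s1) (n := n) (k := k) (p := p)
        (by rw [State.size, hn1 0 (by decide)]; exact hsize) hkn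
        (by rw [hn1 8 (by decide), hfr 8 (by decide), hk])
        (by rw [hn1 50 (by decide), hfr 50 (by decide), hp]) hpk h1 (h3r ▸ h2) rfl
      rw [h3r] at hstep
      rw [State.writeNat_nat_of_ne _ (by decide), hC]
      rcases hstep with ⟨h4, h5⟩ | ⟨h4, h5, h6⟩
      · exact Or.inl ⟨h4, hM h5⟩
      · exact Or.inr ⟨h4, hT h5, by omega⟩

/-- The Hungarian algorithm finds a perfect matching and prices that prove its optimality. -/
theorem run_hungarian (hn : s.size false = n) (hkn : k ≤ n) (hk : s.nat 8 0 0 = k)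
    (hc : ∀ i < k, ∀ j < k, 0 ≤ s.real 3 i j) (h4 : ∀ i, s.real 4 i 0 = 0)
    (h5 : ∀ i, s.real 5 i 0 = 0) : HoldsMatching k k (s.real 3) (hungarian.run s) := by
  have key := Prog.run_iter_of_frame (c := 50) (edges := false) (s := s)
    (p := .onlyIf (.natLe (.add (.reg 50) (.lit 1)) (.reg 8)) matchingPhase)
    (fun t s' => HoldsMatching k (min t k) (s.real 3) s') ?_ ?_
  · rw [hn, min_eq_right hkn] at key
    exact key
  -- The empty matching with zero prices is dual feasible because the costs are nonnegative.
  · refine ⟨by simp, by simp, by simp, fun i hi j hj => ?_⟩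
    simp only [State.writeNat_real, h4, h5, add_zero]
    exact hc i hi j hj
  · intro t s1 ht hct hn1 hr1 hinv
    refine HoldsMatching.congr ?_ (State.writeNat_nat_of_ne _ (by decide) _ _ _) rfl rfl
    have h8 : s1.nat 8 0 0 = k := by rw [hn1 8 (by decide), hk]
    have h3 : s1.real 3 = s.real 3 := hr1 3 (by decide)
    rw [Prog.run]
    simp only [Test.Holds, NExp.eval, NExp.reg, hct, h8]
    split_ifs with htk
    · rw [min_eq_left (by omega)] at hinv
      rw [min_eq_left htk, ← h3]
      exact run_matchingPhase (by rw [State.size, hn1 0 (by decide)]; exact hn) hkn h8 hct htk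
        (h3 ▸ hinv)
    · rw [min_eq_right (by omega)] at hinv
      rwa [min_eq_right (by omega)]

end

end Machine

/-! ### Assignment duality, the cost bound, and stars of shortest paths -/

theorem TightMatching.exists_perm {k : ℕ} {c : ℕ → ℕ → ℝ} {mu : ℕ → ℕ} {u v : ℕ → ℝ}
    (h : TightMatching k k c mu u v) : ∃ σ : Equiv.Perm (Fin k), ∀ i, (σ i : ℕ) = mu i := by
  let f : Fin k → Fin k := fun i => ⟨mu i, h.lt i i.2⟩
  have hf : Function.Injective f := fun i j hij =>
    Fin.ext (h.inj i i.2 j j.2 (congrArg Fin.val hij))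
  exact ⟨Equiv.ofBijective f (Finite.injective_iff_bijective.1 hf), fun i => rfl⟩

/-- Correctness of the Hungarian program gives existence for any nonnegative cost matrix: run it on
a suitable memory. -/
theorem exists_tightMatching (k : ℕ) (c : ℕ → ℕ → ℝ) (hc : ∀ i < k, ∀ j < k, 0 ≤ c i j) :
    ∃ mu u v, TightMatching k k c mu u v := by
  -- All natural-number cells equal `k`, so both the loop bound and register 8 read `k`; the prices
  -- start at 0.
  let s : Machine.State := ⟨fun _ _ _ => k, fun a i j => if a = 3 then c i j else 0⟩
  have h3 : s.real 3 = c := by funext i j; simp [s]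
  have := Machine.run_hungarian (s := s) (n := k) rfl le_rfl rfl (by rwa [h3])
    (fun i => by simp [s]) (fun i => by simp [s])
  rw [h3] at this
  exact ⟨_, _, _, this⟩

/-- Duality for the assignment problem with nonnegative costs. -/
theorem exists_optimal_prices {α β : Type*} [Fintype α] [Fintype β]
    (hcard : Fintype.card α = Fintype.card β) (w : α → β → ℝ) (hw : ∀ a b, 0 ≤ w a b) :
    ∃ (M : α ≃ β) (p : α → ℝ) (q : β → ℝ), (∀ a b, p a + q b ≤ w a b) ∧
      ∑ a, w a (M a) = ∑ a, p a + ∑ b, q b := by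
  obtain ⟨k, hk⟩ : ∃ k, Fintype.card α = k := ⟨_, rfl⟩
  let φ : α ≃ Fin k := Fintype.equivFinOfCardEq hk
  let ψ : β ≃ Fin k := Fintype.equivFinOfCardEq (hcard ▸ hk)
  obtain ⟨mu, u, v, h⟩ := exists_tightMatching k
    (fun i j => if h : i < k ∧ j < k then w (φ.symm ⟨i, h.1⟩) (ψ.symm ⟨j, h.2⟩) else 0) (by
      intro i hi j hj
      rw [dif_pos ⟨hi, hj⟩]
      exact hw _ _)
  obtain ⟨σ, hσ⟩ := h.exists_perm
  refine ⟨(φ.trans σ).trans ψ.symm, fun a => u (φ a), fun b => v (ψ b), fun a b => ?_, ?_⟩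
  · have := h.dual (φ a) (φ a).2 (ψ b) (ψ b).2
    rw [dif_pos ⟨(φ a).2, (ψ b).2⟩] at this
    simpa using this
  · have h1 : ∑ b, v (ψ b) = ∑ a, v (σ (φ a)) := by
      rw [← Equiv.sum_comp ((φ.trans σ).trans ψ.symm)]
      simp
    rw [h1, ← Finset.sum_add_distrib]
    refine Finset.sum_congr rfl fun a _ => ?_
    have := h.tight (φ a) (φ a).2
    rw [← hσ, dif_pos ⟨(φ a).2, (σ (φ a)).2⟩] at this
    rw [this]
    simp

namespace SandInstance

variable {V E : Type*}

/-- The chosen matching weighs no more than the one certified by the prices, whose weight equals the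
price total. -/
theorem IsMatchingOutput.totalCost_le [Fintype E] {I : SandInstance V E} {x y : E → ℕ}
    (hx : I.IsMatchingOutput x) (hy : I.Feasible y) :
    I.totalCost x ≤ 4 / 3 * I.totalCost y := by
  obtain ⟨T, M, hT, hM, hx⟩ := hx
  obtain rfl : x = fun e => {g | e ∈ T g (M g)}.ncard := funext hx
  obtain ⟨M', p, q, hpq, hsum⟩ := exists_optimal_prices
    ((card_greenSide I).trans (card_blueSide I).symm) (fun g b => I.treeCost (T g b))
    fun g b => I.treeCost_nonneg _
  rw [I.totalCost_ncard fun g => T g (M g)]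
  exact (hM M').trans (hsum.trans_le (hy.sum_prices_le T hT p q hpq))

theorem dist_comm (I : SandInstance V E) (u v : V) : I.dist u v = I.dist v u := by
  unfold dist
  congr 1
  ext c
  constructor <;> rintro ⟨p, hp, rfl⟩ <;> exact hp.exists_reverse_cost

theorem ConnectedIn.dist_le_treeCost [DecidableEq E] {I : SandInstance V E} {T : Finset E}
    {u v : V} (h : I.ConnectedIn (T : Set E) u v) : I.dist u v ≤ I.treeCost T := by
  obtain ⟨p, hp, hpT⟩ := h.exists_isPath
  refine (dist_le hp.1).trans ?_
  rw [walkCost_eq_of_edges, ← List.sum_toFinset I.cost hp.nodup_edges]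
  exact I.treeCost_mono fun e he => hpT e (List.mem_toFinset.1 he)

/-- The label is at most the cost of any walk, while the stored path connects the ends at no more
than the label. -/
theorem IsShortestPathTree.eq_dist [DecidableEq E] {I : SandInstance V E} {z : V} {S : Set V}
    {d : V → ℝ} {T : V → Finset E} (h : I.IsShortestPathTree z S d T) {v : V} (hv : v ∈ S) :
    d v = I.dist z v :=
  le_antisymm (le_dist (h.reachable hv) (h.le_walkCost v hv))
    ((h.connectedIn v hv).dist_le_treeCost.trans (h.treeCost_le v hv))

/-- The cost of three shortest walks from `z` to `a`, `b` and the root. -/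
noncomputable def starCost (I : SandInstance V E) (a b z : V) : ℝ :=
  I.dist z a + I.dist z b + I.dist z I.root

/-- A tree on three vertices branches at one vertex `z`. Together with
`IsMinSteinerTree.le_starCost`, this makes the minimum tree cost the minimum star cost over
reachable centers. -/
theorem IsSteinerTree.exists_starCost_le {I : SandInstance V E} {a b : V} {T : Finset E}
    (hT : I.IsSteinerTree {a, b, I.root} T) :
    ∃ z, I.Reachable z I.root ∧ I.starCost a b z ≤ I.treeCost T := by
  obtain ⟨z, p, q, r, hp, hq, hr, hle⟩ := I.exists_star_le (a := a) (b := b) (c := I.root)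
    (hT.connectedIn (by simp) (by simp)) (hT.connectedIn (by simp) (by simp))
  exact ⟨z, hr.reachable, le_trans (add_le_add (add_le_add (dist_le hp) (dist_le hq)) (dist_le hr))
    hle⟩

theorem IsMinSteinerTree.le_starCost {I : SandInstance V E} {a b z : V} {T : Finset E}
    (hT : I.IsMinSteinerTree {a, b, I.root} T) (ha : I.Reachable a I.root)
    (hb : I.Reachable b I.root) (hz : I.Reachable z I.root) :
    I.treeCost T ≤ I.starCost a b z := by
  rw [starCost, I.dist_comm z a, I.dist_comm z b, I.dist_comm z]
  exact hT.le_dist (ha.trans hz.symm) (hb.trans hz.symm) hz.symm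

theorem exists_isMinSteinerTree [Fintype E] {I : SandInstance V E} {a b : V}
    (ha : I.Reachable a I.root) (hb : I.Reachable b I.root) :
    ∃ T, I.IsMinSteinerTree {a, b, I.root} T := by
  obtain ⟨T, -, hT⟩ := I.exists_isSteinerTree_subset {a, b, I.root} I.root Finset.univ (by
    rw [Finset.coe_univ]
    rintro v (rfl | rfl | rfl)
    exacts [ha.symm, hb.symm, .refl _ _ _])
  obtain ⟨T', hT', hmin⟩ := (Set.toFinite {T | I.IsSteinerTree {a, b, I.root} T}).exists_minimalFor
    I.treeCost _ ⟨T, hT⟩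
  refine ⟨T', hT', fun T'' hT'' => ?_⟩
  rcases le_total (I.treeCost T') (I.treeCost T'') with h | h
  · exact h
  · exact hmin hT'' h

end SandInstance

/-! ### Listing the terminals and computing the Steiner costs -/

namespace Machine

/-- List the members of a terminal set in array `a`, followed by copies of the root, with
their number in register `l`. The set is given by column `f` of array `2`. -/
def listSide (a l f : ℕ) : Prog :=
  .seq (.iter 60 false (.setNat a (.reg 60) (.lit 0) (.get 0 (.lit 0) (.lit 2))))
    (.seq (.setNat l (.lit 0) (.lit 0) (.lit 0))
      (.iter 60 false (.onlyIf (.natLe (.lit 1) (.get 2 (.reg 60) (.lit f)))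
        (.seq (.setNat a (.reg l) (.lit 0) (.reg 60))
          (.setNat l (.lit 0) (.lit 0) (.add (.reg l) (.lit 1)))))))

/-- The first column of array `a` lists the members of `C`, followed by copies of `r`. -/
structure Lists {n : ℕ} (C : Finset (Fin n)) (r : Fin n) (a : ℕ → ℕ) : Prop where
  exists_mem : ∀ i < C.card, ∃ v ∈ C, a i = (v : ℕ)
  inj : ∀ i < C.card, ∀ j < C.card, a i = a j → i = j
  eq_root : ∀ i < n, C.card ≤ i → a i = r

theorem run_listSide {n m : ℕ} {I : SandInstance (Fin n) (Fin m)} {s : State} (hl : Loaded I s)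
    (C : Finset (Fin n)) {a l f : ℕ} (ha : 3 ≤ a) (hla : 3 ≤ l) (hal : a ≠ l) (ha60 : a ≠ 60)
    (hl60 : l ≠ 60) (hf : ∀ v : Fin n, 1 ≤ s.nat 2 v f ↔ v ∈ C) :
    Lists C I.root (fun i => ((listSide a l f).run s).nat a i 0) ∧
      ((listSide a l f).run s).nat l 0 0 = C.card := by
  classical
  rw [listSide, Prog.run, Prog.run]
  set p1 : Prog := .iter 60 false (.setNat a (.reg 60) (.lit 0) (.get 0 (.lit 0) (.lit 2))) with hp1
  have h1 : ∀ i < n, (p1.run s).nat a i 0 = I.root := by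
    intro i hi
    rw [hp1, Prog.run_iter_column ha60 (fun _ => I.root) fun k s' hk hc hn hr hold u v => ?_,
      if_pos ⟨hl.size_false ▸ hi, rfl⟩]
    rw [Prog.run, State.writeNat_nat_self]
    simp only [NExp.eval, NExp.reg, hc, hn 0 (by simp [Prog.natWrites]; omega), hl.root]
  have h1' : ∀ b, b ≠ a → b ≠ 60 → (p1.run s).nat b = s.nat b := fun b hb hb' =>
    Prog.run_nat_of_notMem (by simp [hp1, Prog.natWrites, hb, hb']) s
  set s1 := (Prog.setNat l (.lit 0) (.lit 0) (.lit 0)).run (p1.run s) with hs1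
  have h2 : ∀ b, b ≠ l → s1.nat b = (p1.run s).nat b := fun b hb =>
    State.writeNat_nat_of_ne _ hb _ _ _
  have hsize : s1.size false = n := by
    rw [State.size, h2 0 (by omega), h1' 0 (by omega) (by omega)]; exact hl.size_false
  -- `N t` is the number of members below `t`, which is also the next free position. All listed
  -- members are below `t`, so the next one is new.
  set N : ℕ → ℕ := fun t => (C.filter fun v : Fin n => (v : ℕ) < t).card with hN
  have key := Prog.run_iter_of_frame (c := 60) (edges := false) (s := s1)
    (p := .onlyIf (.natLe (.lit 1) (.get 2 (.reg 60) (.lit f)))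
        (.seq (.setNat a (.reg l) (.lit 0) (.reg 60))
          (.setNat l (.lit 0) (.lit 0) (.add (.reg l) (.lit 1)))))
    (fun t s' => s'.nat l 0 0 = N t ∧ (∀ i < N t, ∃ v ∈ C, (v : ℕ) < t ∧ s'.nat a i 0 = v) ∧
      (∀ i < N t, ∀ j < N t, s'.nat a i 0 = s'.nat a j 0 → i = j) ∧
      ∀ i < n, N t ≤ i → s'.nat a i 0 = I.root) ?_ ?_
  · rw [hsize] at key
    have hNn : N n = C.card := by
      simp only [hN, Fin.is_lt, Finset.filter_true]
    rw [hNn] at key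
    obtain ⟨k1, k2, k3, k4⟩ := key
    refine ⟨⟨fun i hi => ?_, k3, k4⟩, k1⟩
    obtain ⟨v, hv, -, h⟩ := k2 i hi
    exact ⟨v, hv, h⟩
  · have hN0 : N 0 = 0 := by simp [hN]
    rw [hN0]
    refine ⟨?_, by simp, by simp, fun i hi _ => ?_⟩
    · rw [State.writeNat_nat_of_ne _ hl60]
      simp [hs1, Prog.run, State.writeNat, NExp.eval]
    · rw [State.writeNat_nat_of_ne _ ha60, h2 a hal, h1 i hi]
  · rintro t s' ht hc hn hr ⟨k1, k2, k3, k4⟩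
    rw [hsize] at ht
    have hN1 : N (t + 1) = N t + if (⟨t, ht⟩ : Fin n) ∈ C then 1 else 0 := by
      simp only [hN]
      split_ifs with htC
      · have : (C.filter fun v : Fin n => (v : ℕ) < t + 1) =
            insert ⟨t, ht⟩ (C.filter fun v : Fin n => (v : ℕ) < t) := by
          ext v
          simp only [Finset.mem_filter, Finset.mem_insert, Fin.ext_iff]
          constructor
          · rintro ⟨hv, hvt⟩
            by_cases h : (v : ℕ) = t
            · exact Or.inl h
            · exact Or.inr ⟨hv, by omega⟩
          · rintro (h | ⟨hv, hvt⟩)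
            · exact ⟨(Fin.ext h : v = ⟨t, ht⟩) ▸ htC, by omega⟩
            · exact ⟨hv, by omega⟩
        rw [this, Finset.card_insert_of_notMem (by simp)]
      · congr 1
        ext v
        simp only [Finset.mem_filter]
        constructor
        · rintro ⟨hv, hvt⟩
          refine ⟨hv, lt_of_le_of_ne (by omega) ?_⟩
          intro h
          exact htC ((Fin.ext h : v = ⟨t, ht⟩) ▸ hv)
        · rintro ⟨hv, hvt⟩
          exact ⟨hv, by omega⟩
    have hNt : N t ≤ t := by
      have : (C.filter fun v : Fin n => (v : ℕ) < t).map Fin.valEmbedding ⊆ Finset.range t := by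
        intro x hx
        simp only [Finset.mem_map, Finset.mem_filter] at hx
        obtain ⟨v, ⟨-, hv⟩, rfl⟩ := hx
        simpa using hv
      have := Finset.card_le_card this
      rwa [Finset.card_map, Finset.card_range] at this
    have htest : Test.Holds s' (.natLe (.lit 1) (.get 2 (.reg 60) (.lit f))) ↔
        (⟨t, ht⟩ : Fin n) ∈ C := by
      rw [← hf]
      simp only [Test.Holds, NExp.eval, NExp.reg, hc]
      rw [hn 2 (by simp [Prog.natWrites]; omega), h2 2 (by omega), h1' 2 (by omega) (by omega)]
    simp only [State.writeNat_nat_of_ne _ hl60, State.writeNat_nat_of_ne _ ha60]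
    rw [Prog.run]
    simp only [htest]
    rw [hN1]
    split_ifs with htC
    · have hsa : ∀ i, (Prog.run (.seq (.setNat a (.reg l) (.lit 0) (.reg 60))
          (.setNat l (.lit 0) (.lit 0) (.add (.reg l) (.lit 1)))) s').nat a i 0 =
          if i = N t then t else s'.nat a i 0 := by
        intro i
        rw [Prog.run, Prog.run, State.writeNat_nat_of_ne _ hal, Prog.run, State.writeNat_nat_self]
        simp only [NExp.eval, NExp.reg, k1, hc, and_true]
      have hsl : (Prog.run (.seq (.setNat a (.reg l) (.lit 0) (.reg 60))
          (.setNat l (.lit 0) (.lit 0) (.add (.reg l) (.lit 1)))) s').nat l 0 0 = N t + 1 := by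
        rw [Prog.run, Prog.run, State.writeNat_nat_self]
        simp only [NExp.eval, NExp.reg, and_self, if_true, Prog.run,
          State.writeNat_nat_of_ne _ hal.symm, k1]
      simp only [hsa, hsl]
      refine ⟨trivial, fun i hi => ?_, fun i hi j hj => ?_, fun i hi hNi => ?_⟩
      · split_ifs with h
        · exact ⟨⟨t, ht⟩, htC, by simp, rfl⟩
        · obtain ⟨v, hv, hvt, he⟩ := k2 i (by omega)
          exact ⟨v, hv, by omega, he⟩
      · split_ifs with h h' h'
        · intro _; omega
        · intro he
          obtain ⟨v, hv, hvt, he'⟩ := k2 j (by omega)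
          omega
        · intro he
          obtain ⟨v, hv, hvt, he'⟩ := k2 i (by omega)
          omega
        · exact k3 i (by omega) j (by omega)
      · rw [if_neg (by omega)]
        exact k4 i hi (by omega)
    · refine ⟨k1, fun i hi => ?_, k3, k4⟩
      obtain ⟨v, hv, hvt, he⟩ := k2 i hi
      exact ⟨v, hv, by omega, he⟩

theorem Lists.exists_vertex {n : ℕ} {C : Finset (Fin n)} {r : Fin n} {a : ℕ → ℕ}
    (h : Lists C r a) {i : ℕ} (hi : i < n) : ∃ v : Fin n, a i = v ∧ (v ∈ C ∨ v = r) := by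
  by_cases hC : i < C.card
  · obtain ⟨v, hv, he⟩ := h.exists_mem i hC
    exact ⟨v, he, Or.inl hv⟩
  · exact ⟨r, h.eq_root i hi (by omega), Or.inr rfl⟩

/-- The first positions of the list enumerate the terminals, and the following copies of the root
play the dummies. -/
theorem Lists.exists_equiv {n : ℕ} {C : Finset (Fin n)} {r : Fin n} {a : ℕ → ℕ}
    (h : Lists C r a) {k d : ℕ} (hk : k = C.card + d) (hkn : k ≤ n) :
    ∃ φ : Fin k ≃ {v // v ∈ C} ⊕ Fin d,
      ∀ i, ((Sum.elim (fun v => v.1) (fun _ => r) (φ i) : Fin n) : ℕ) = a i := by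
  choose v hv hva using h.exists_mem
  let f : Fin k → {v // v ∈ C} ⊕ Fin d := fun i =>
    if hi : (i : ℕ) < C.card then .inl ⟨v i hi, hv i hi⟩ else .inr ⟨i - C.card, by omega⟩
  have hf : Function.Injective f := by
    intro i j hij
    simp only [f] at hij
    split_ifs at hij with h1 h2 h2
    · refine Fin.ext (h.inj i h1 j h2 ?_)
      rw [hva i h1, hva j h2]
      simpa [Fin.ext_iff] using hij
    · rw [Sum.inr.injEq, Fin.mk.injEq] at hij
      exact Fin.ext (by omega)
  have hb : Function.Bijective f := (Fintype.bijective_iff_injective_and_card f).2 ⟨hf, by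
    simp [hk]⟩
  refine ⟨Equiv.ofBijective f hb, fun i => ?_⟩
  rw [Equiv.ofBijective_apply]
  simp only [f]
  split_ifs with h1
  · exact (hva i h1).symm
  · exact (h.eq_root i (by omega) (by omega)).symm

/-- The length of the three paths from the root of the tree to the row in register `62`, the
column in register `63` and the root of the instance. -/
def starLength : RExp :=
  .add (.add (.get 1 (.get 4 (.reg 62) (.lit 0)) (.lit 0))
    (.get 1 (.get 5 (.reg 63) (.lit 0)) (.lit 0))) (.get 1 (.get 0 (.lit 0) (.lit 2)) (.lit 0))

/-- Use the root of the tree, in register `61`, as a center if this is better. -/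
def improveCenter : Prog :=
  .onlyIf (.neg (.conj (.natLe (.lit 1) (.get 30 (.reg 62) (.reg 63)))
      (.realLe (.get 3 (.reg 62) (.reg 63)) starLength)))
    (.seq (.setReal 3 (.reg 62) (.reg 63) starLength)
      (.setNat 30 (.reg 62) (.reg 63) (.add (.reg 61) (.lit 1))))

/-- Compute the costs of minimum Steiner trees in real array `3`, and the centers of such trees
in array `30`. -/
def steinerCosts : Prog :=
  .iter 61 false (.seq (.setNat 10 (.lit 0) (.lit 0) (.reg 61)) (.seq shortestPathTree
    (.onlyIf (.natLe (.lit 1) (.get 11 (.get 0 (.lit 0) (.lit 2)) (.lit 0)))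
      (.iter 62 false (.iter 63 false improveCenter)))))

/-- The best center among the vertices below `t` that are connected to the root. -/
def BestCenter {n m : ℕ} (I : SandInstance (Fin n) (Fin m)) (a b : Fin n) (t q : ℕ) (c : ℝ) :
    Prop :=
  (q = 0 ∧ ∀ z : Fin n, (z : ℕ) < t → ¬ I.Reachable z I.root) ∨
    ∃ z : Fin n, q = z + 1 ∧ I.Reachable z I.root ∧ c = I.starCost a b z ∧
      ∀ z' : Fin n, (z' : ℕ) < t → I.Reachable z' I.root → c ≤ I.starCost a b z'

section

variable {n m : ℕ} {I : SandInstance (Fin n) (Fin m)} {s : State}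

theorem val_lt_succ_iff {n : ℕ} (z z' : Fin n) : (z' : ℕ) < z + 1 ↔ (z' : ℕ) < z ∨ z' = z := by
  rw [Fin.ext_iff]; omega

theorem BestCenter.skip {a b z : Fin n} {q : ℕ} {c : ℝ} (h : BestCenter I a b z q c)
    (hz : ¬ I.Reachable z I.root) : BestCenter I a b (z + 1) q c := by
  rcases h with ⟨h1, h2⟩ | ⟨w, h1, h2, h3, h4⟩
  · refine Or.inl ⟨h1, fun z' hz' => ?_⟩
    rcases (val_lt_succ_iff z z').1 hz' with hz' | rfl
    exacts [h2 z' hz', hz]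
  · refine Or.inr ⟨w, h1, h2, h3, fun z' hz' hr => ?_⟩
    rcases (val_lt_succ_iff z z').1 hz' with hz' | rfl
    exacts [h4 z' hz' hr, absurd hr hz]

theorem BestCenter.keep {a b z : Fin n} {q : ℕ} {c : ℝ} (h : BestCenter I a b z q c)
    (hq : 1 ≤ q) (hc : c ≤ I.starCost a b z) : BestCenter I a b (z + 1) q c := by
  rcases h with ⟨h1, h2⟩ | ⟨w, h1, h2, h3, h4⟩
  · omega
  · refine Or.inr ⟨w, h1, h2, h3, fun z' hz' hr => ?_⟩
    rcases (val_lt_succ_iff z z').1 hz' with hz' | rfl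
    exacts [h4 z' hz' hr, hc]

theorem BestCenter.replace {a b z : Fin n} {q : ℕ} {c : ℝ} (h : BestCenter I a b z q c)
    (hz : I.Reachable z I.root) (hc : ¬ (1 ≤ q ∧ c ≤ I.starCost a b z)) :
    BestCenter I a b (z + 1) (z + 1) (I.starCost a b z) := by
  refine Or.inr ⟨z, rfl, hz, rfl, fun z' hz' hr => ?_⟩
  rcases (val_lt_succ_iff z z').1 hz' with hz' | rfl
  · rcases h with ⟨h1, h2⟩ | ⟨w, h1, h2, h3, h4⟩
    · exact absurd hr (h2 z' hz')
    · have := h4 z' hz' hr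
      rw [not_and, not_le] at hc
      exact (hc (by omega)).le.trans this
  · exact le_rfl

theorem treeDist_of_reachable {z : Fin n}
    (h : I.IsShortestPathTree z (treeVertices n s) (treeDist n s) (treePath n m s))
    (hc : TreeClosed I s) {v : Fin n} (hv : I.Reachable z v) : s.real 1 v 0 = I.dist z v :=
  h.eq_dist (h.mem_of_reachable hc hv)

/-- All vertices are tried as centers. Entry 0 of array 30 means that no center has been found yet,
so the array has to start empty; a center is stored plus one. -/
theorem run_steinerCosts (hl : Loaded I s) {x y : Fin n → Fin n}
    (hx : ∀ i : Fin n, s.nat 4 i 0 = x i) (hy : ∀ i : Fin n, s.nat 5 i 0 = y i)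
    (hxr : ∀ i, I.Reachable (x i) I.root) (hyr : ∀ i, I.Reachable (y i) I.root)
    (h30 : ∀ i j, s.nat 30 i j = 0) (i j : Fin n) :
    BestCenter I (x i) (y j) n ((steinerCosts.run s).nat 30 i j)
      ((steinerCosts.run s).real 3 i j) := by
  have key := Prog.run_iter_of_frame (c := 61) (edges := false) (s := s)
    (p := .seq (.setNat 10 (.lit 0) (.lit 0) (.reg 61)) (.seq shortestPathTree
    (.onlyIf (.natLe (.lit 1) (.get 11 (.get 0 (.lit 0) (.lit 2)) (.lit 0)))
      (.iter 62 false (.iter 63 false improveCenter)))))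
    (fun t s' => ∀ i j : Fin n, BestCenter I (x i) (y j) t (s'.nat 30 i j) (s'.real 3 i j)) ?_ ?_
  · rw [hl.size_false] at key
    exact key i j
  · intro i j
    refine Or.inl ⟨?_, by simp⟩
    rw [State.writeNat_nat_of_ne _ (by decide), h30]
  intro t s1 ht hc hn hr hinv i j
  rw [hl.size_false] at ht
  obtain ⟨z, rfl⟩ : ∃ z : Fin n, (z : ℕ) = t := ⟨⟨t, ht⟩, rfl⟩
  rw [State.writeNat_nat_of_ne _ (by decide), State.writeNat_real, Prog.run]
  have hl1 : Loaded I s1 := hl.of_frame hn hr (by decide) (by decide)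
  set s2 := (Prog.setNat 10 (.lit 0) (.lit 0) (.reg 61)).run s1 with hs2
  have hn2 : ∀ b ≠ 10, s2.nat b = s1.nat b := fun b hb => State.writeNat_nat_of_ne _ hb _ _ _
  have hr2 : s2.real = s1.real := rfl
  have hl2 : Loaded I s2 := hl1.run (by decide) (by decide)
  have h10 : s2.nat 10 0 0 = z := by
    simp [hs2, Prog.run, State.writeNat, NExp.eval, NExp.reg, hc]
  clear_value s2
  rw [Prog.run]
  obtain ⟨hT, hcl⟩ := run_shortestPathTree hl2 h10 rfl
  have hl3 : Loaded I (shortestPathTree.run s2) := hl2.run (by decide) (by decide)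
  have hn3 : ∀ b, b ∉ shortestPathTree.natWrites → b ≠ 10 →
      (shortestPathTree.run s2).nat b = s1.nat b := fun b hb hb' => by
    rw [Prog.run_nat_of_notMem hb, hn2 b hb']
  have hr3 : (shortestPathTree.run s2).real 3 = s1.real 3 := by
    rw [Prog.run_real_of_notMem (by decide), hr2]
  set s3 := shortestPathTree.run s2 with hs3
  have hinv3 : ∀ i j : Fin n, BestCenter I (x i) (y j) z (s3.nat 30 i j) (s3.real 3 i j) := by
    intro i j
    rw [hn3 30 (by decide) (by decide), hr3]
    exact hinv i j
  have hroot : Test.Holds s3 (.natLe (.lit 1) (.get 11 (.get 0 (.lit 0) (.lit 2)) (.lit 0))) ↔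
      I.Reachable z I.root := by
    simp only [Test.Holds, NExp.eval, hl3.root]
    exact ⟨fun h => hT.reachable h, fun h => hT.mem_of_reachable hcl h⟩
  clear_value s3
  rw [Prog.run]
  by_cases hzr : I.Reachable z I.root
  swap
  · rw [if_neg (mt hroot.1 hzr)]
    exact (hinv3 i j).skip hzr
  rw [if_pos (hroot.2 hzr)]
  have hx3 : ∀ i : Fin n, s3.nat 4 i 0 = x i := fun i => by
    rw [hn3 4 (by decide) (by decide), hn 4 (by decide), hx]
  have hy3 : ∀ i : Fin n, s3.nat 5 i 0 = y i := fun i => by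
    rw [hn3 5 (by decide) (by decide), hn 5 (by decide), hy]
  have h61 : s3.nat 61 0 0 = z := by rw [hn3 61 (by decide) (by decide), hc]
  have hstar : ∀ i j : Fin n,
      s3.real 1 (x i) 0 + s3.real 1 (y j) 0 + s3.real 1 I.root 0 = I.starCost (x i) (y j) z := by
    intro i j
    rw [treeDist_of_reachable hT hcl (hzr.trans (hxr i).symm),
      treeDist_of_reachable hT hcl (hzr.trans (hyr j).symm), treeDist_of_reachable hT hcl hzr]
    rfl
  have houter := Prog.run_iter_of_frame (c := 62) (edges := false) (s := s3)
    (p := .iter 63 false improveCenter)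
    -- Cells already visited in this round account for the center `z`, the remaining ones only for
    -- the centers below it.
    (fun l s' => ∀ i j : Fin n, BestCenter I (x i) (y j) (if (i : ℕ) < l then z + 1 else z)
      (s'.nat 30 i j) (s'.real 3 i j)) ?_ ?_
  · rw [hl3.size_false] at houter
    simpa using houter i j
  · intro i j
    rw [State.writeNat_nat_of_ne _ (by decide), State.writeNat_real]
    simpa using hinv3 i j
  intro l s4 hl4 hc4 hn4 hr4 hinv4
  rw [hl3.size_false] at hl4
  have hsize4 : s4.size false = n := by
    rw [State.size, hn4 0 (by decide)]; exact hl3.size_false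
  have hinner := Prog.run_iter_of_frame (c := 63) (edges := false) (s := s4)
    (p := improveCenter)
    (fun t s' => ∀ i j : Fin n, BestCenter I (x i) (y j)
      (if (i : ℕ) < l ∨ ((i : ℕ) = l ∧ (j : ℕ) < t) then z + 1 else z)
      (s'.nat 30 i j) (s'.real 3 i j)) ?_ ?_
  · rw [hsize4] at hinner
    intro i j
    rw [State.writeNat_nat_of_ne _ (by decide), State.writeNat_real]
    have h1 := hinner i j
    have h2 : ((i : ℕ) < l ∨ ((i : ℕ) = l ∧ (j : ℕ) < n)) ↔ (i : ℕ) < l + 1 := by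
      have := j.2; omega
    simpa only [h2] using h1
  · intro i j
    rw [State.writeNat_nat_of_ne _ (by decide), State.writeNat_real]
    simpa using hinv4 i j
  intro t s5 ht5 hc5 hn5 hr5 hinv5 i j
  rw [hsize4] at ht5
  rw [State.writeNat_nat_of_ne _ (by decide), State.writeNat_real]
  have hfr5 : ∀ b, b ∉ [30, 62, 63] → s5.nat b = s3.nat b := by
    intro b hb
    simp only [List.mem_cons, not_or] at hb
    rw [hn5 b (by simp [improveCenter, Prog.natWrites, hb]),
      hn4 b (by simp [improveCenter, Prog.natWrites, hb])]
  have hfrr5 : ∀ b ≠ 3, s5.real b = s3.real b := by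
    intro b hb
    rw [hr5 b (by simp [improveCenter, Prog.realWrites, hb]),
      hr4 b (by simp [improveCenter, Prog.realWrites, hb])]
  have h62 : s5.nat 62 0 0 = l := by rw [hn5 62 (by decide), hc4]
  have hval : ∀ s' : State, (∀ b ≠ 30, s'.nat b = s5.nat b) → s'.real 1 = s5.real 1 →
      starLength.eval s' = I.starCost (x ⟨l, hl4⟩) (y ⟨t, ht5⟩) z := by
    intro s' hn' hr'
    have e1 := hx3 ⟨l, hl4⟩
    have e2 := hy3 ⟨t, ht5⟩
    simp only at e1 e2
    simp only [starLength, RExp.eval, NExp.eval, NExp.reg, hn' 62 (by decide), hn' 63 (by decide),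
      hn' 4 (by decide), hn' 5 (by decide), hn' 0 (by decide), hr', h62, hc5, hfr5 4 (by decide),
      hfr5 5 (by decide), hfr5 0 (by decide), hfrr5 1 (by decide), e1, e2, hl3.root, hstar]
  have hcell := hinv5 i j
  have hupd : (improveCenter.run s5).nat 30 i j = s5.nat 30 i j ∧
        (improveCenter.run s5).real 3 i j = s5.real 3 i j ∧
        (i = ⟨l, hl4⟩ ∧ j = ⟨t, ht5⟩ → 1 ≤ s5.nat 30 i j ∧
          s5.real 3 i j ≤ I.starCost (x i) (y j) z) ∨
      (improveCenter.run s5).nat 30 i j = z + 1 ∧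
        (improveCenter.run s5).real 3 i j = I.starCost (x i) (y j) z ∧
        i = ⟨l, hl4⟩ ∧ j = ⟨t, ht5⟩ ∧ ¬ (1 ≤ s5.nat 30 i j ∧
          s5.real 3 i j ≤ I.starCost (x i) (y j) z) := by
    have htest : Test.Holds s5 (.neg (.conj (.natLe (.lit 1) (.get 30 (.reg 62) (.reg 63)))
        (.realLe (.get 3 (.reg 62) (.reg 63)) starLength))) ↔
        ¬ (1 ≤ s5.nat 30 l t ∧ s5.real 3 l t ≤ I.starCost (x ⟨l, hl4⟩) (y ⟨t, ht5⟩) z) := by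
      simp only [Test.Holds, RExp.eval, NExp.eval, NExp.reg, h62, hc5,
        hval s5 (fun _ _ => rfl) rfl]
    rw [improveCenter, Prog.run]
    by_cases h1 : ¬ (1 ≤ s5.nat 30 l t ∧ s5.real 3 l t ≤ I.starCost (x ⟨l, hl4⟩) (y ⟨t, ht5⟩) z)
    · rw [if_pos (htest.2 h1)]
      simp only [Prog.run]
      rw [State.writeNat_nat_self, State.writeNat_real, State.writeReal_real_self,
        hval s5 (fun _ _ => rfl) rfl]
      simp only [NExp.eval, NExp.reg, State.writeReal_nat, h62, hc5]
      rw [hfr5 61 (by decide), h61]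
      by_cases hij : (i : ℕ) = l ∧ (j : ℕ) = t
      · obtain ⟨rfl, rfl⟩ := hij
        refine Or.inr ⟨by simp, by simp, rfl, rfl, h1⟩
      · refine Or.inl ⟨by rw [if_neg hij], by rw [if_neg hij], ?_⟩
        rintro ⟨rfl, rfl⟩
        exact absurd ⟨rfl, rfl⟩ hij
    · rw [if_neg (mt htest.1 h1)]
      refine Or.inl ⟨rfl, rfl, ?_⟩
      rintro ⟨rfl, rfl⟩
      exact not_not.1 h1
  by_cases hij : i = ⟨l, hl4⟩ ∧ j = ⟨t, ht5⟩
  · have h1 : ¬ ((i : ℕ) < l ∨ ((i : ℕ) = l ∧ (j : ℕ) < t)) := by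
      rw [hij.1, hij.2]; simp
    have h2 : (i : ℕ) < l ∨ ((i : ℕ) = l ∧ (j : ℕ) < t + 1) := by
      rw [hij.1, hij.2]; simp
    rw [if_neg h1] at hcell
    rw [if_pos h2]
    rcases hupd with ⟨e1, e2, e3⟩ | ⟨e1, e2, -, -, e3⟩
    · rw [e1, e2]
      exact hcell.keep (e3 hij).1 (e3 hij).2
    · rw [e1, e2]
      exact hcell.replace hzr e3
  · have h1 : ((i : ℕ) < l ∨ ((i : ℕ) = l ∧ (j : ℕ) < t + 1)) ↔
        ((i : ℕ) < l ∨ ((i : ℕ) = l ∧ (j : ℕ) < t)) := by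
      rw [Fin.ext_iff, Fin.ext_iff] at hij
      simp only at hij
      omega
    simp only [h1]
    rcases hupd with ⟨e1, e2, -⟩ | ⟨-, -, e3, e4, -⟩
    · rw [e1, e2]
      exact hcell
    · exact absurd ⟨e3, e4⟩ hij

end

end Machine

/-! ### Installing the trees -/

namespace Machine

/-- Install one unit of capacity on the three tree paths from the root of the tree to the row in
register `64`, the column matched to it and the root of the instance. -/
def installTree : Prog :=
  .iter 65 true (.onlyIf (.natLe (.lit 1)
      (.add (.add (.get 12 (.get 4 (.reg 64) (.lit 0)) (.reg 65))
        (.get 12 (.get 5 (.get 40 (.reg 64) (.lit 0)) (.lit 0)) (.reg 65)))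
        (.get 12 (.get 0 (.lit 0) (.lit 2)) (.reg 65))))
    (.setNat 3 (.reg 65) (.lit 0) (.add (.get 3 (.reg 65) (.lit 0)) (.lit 1))))

/-- Install the capacities of Steiner trees for the pairs of the matching in array `40`, with the
number of pairs in register `8` and the centers of the trees in array `30`. -/
def installTrees : Prog :=
  .iter 64 false (.onlyIf (.natLe (.add (.reg 64) (.lit 1)) (.reg 8))
    (.seq (.setNat 10 (.lit 0) (.lit 0)
        (.sub (.get 30 (.reg 64) (.get 40 (.reg 64) (.lit 0))) (.lit 1)))
      (.seq shortestPathTree installTree)))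

section

variable {n m : ℕ} {I : SandInstance (Fin n) (Fin m)} {s : State}

theorem run_installTree (hl : Loaded I s) {a b : Fin n} (ha : s.nat 4 (s.nat 64 0 0) 0 = a)
    (hb : s.nat 5 (s.nat 40 (s.nat 64 0 0) 0) 0 = b) (e : Fin m) :
    (installTree.run s).nat 3 e 0 = s.nat 3 e 0 +
      if e ∈ treePath n m s a ∪ treePath n m s b ∪ treePath n m s I.root then 1 else 0 := by
  rw [installTree, Prog.run_iter_column (by decide) (fun u => s.nat 3 u 0 +
    if 1 ≤ s.nat 12 a u + s.nat 12 b u + s.nat 12 I.root u then 1 else 0)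
    fun k s' hk hc hn hr hold u v => ?_, if_pos ⟨hl.size_true ▸ e.2, rfl⟩]
  · congr 2
    simp only [treePath, Finset.mem_union, Finset.mem_filter, Finset.mem_univ, true_and, eq_iff_iff]
    omega
  · have htest : Test.Holds s' (.natLe (.lit 1)
        (.add (.add (.get 12 (.get 4 (.reg 64) (.lit 0)) (.reg 65))
          (.get 12 (.get 5 (.get 40 (.reg 64) (.lit 0)) (.lit 0)) (.reg 65)))
          (.get 12 (.get 0 (.lit 0) (.lit 2)) (.reg 65)))) ↔
        1 ≤ s.nat 12 a k + s.nat 12 b k + s.nat 12 I.root k := by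
      simp only [Test.Holds, NExp.eval, NExp.reg, hc, hn 12 (by decide), hn 4 (by decide),
        hn 64 (by decide), hn 5 (by decide), hn 40 (by decide), hn 0 (by decide), ha, hb, hl.root]
    rw [Prog.run]
    by_cases h : 1 ≤ s.nat 12 a k + s.nat 12 b k + s.nat 12 I.root k
    · rw [if_pos (htest.2 h), Prog.run, State.writeNat_nat_self, if_pos h]
      simp only [NExp.eval, NExp.reg, hc, hold k 0 le_rfl]
    · rw [if_neg (mt htest.1 h), if_neg h]
      split_ifs with huv
      · rw [huv.1, huv.2, hold k 0 le_rfl, add_zero]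
      · rfl

/-- The shortest-path tree of the stored center is recomputed for each pair. The union of its three
paths is a tree costing at most the star, and the union is counted once even on edges shared by the
paths. -/
theorem run_installTrees (hl : Loaded I s) {k : ℕ} (hkn : k ≤ n) (hk : s.nat 8 0 0 = k)
    {x y : Fin n → Fin n} (hx : ∀ i : Fin n, s.nat 4 i 0 = x i)
    (hy : ∀ i : Fin n, s.nat 5 i 0 = y i)
    (hxr : ∀ i, I.Reachable (x i) I.root) (hyr : ∀ i, I.Reachable (y i) I.root)
    (h3 : ∀ e : Fin m, s.nat 3 e 0 = 0) (hmu : ∀ i < k, s.nat 40 i 0 < k) {c : ℕ → ℕ → ℝ}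
    (hbest : ∀ i j : Fin n, BestCenter I (x i) (y j) n (s.nat 30 i j) (c i j)) :
    ∃ F : ℕ → Finset (Fin m), (∀ i j : Fin n, (i : ℕ) < k → s.nat 40 i 0 = j →
        I.IsSteinerTree {x i, y j, I.root} (F i) ∧ I.treeCost (F i) ≤ c i j) ∧
      ∀ e : Fin m, (installTrees.run s).nat 3 e 0 =
        ((Finset.range k).filter fun i => e ∈ F i).card := by
  have key := Prog.run_iter_of_frame (c := 64) (edges := false) (s := s)
    (p := .onlyIf (.natLe (.add (.reg 64) (.lit 1)) (.reg 8))
      (.seq (.setNat 10 (.lit 0) (.lit 0)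
          (.sub (.get 30 (.reg 64) (.get 40 (.reg 64) (.lit 0))) (.lit 1)))
        (.seq shortestPathTree installTree)))
    (fun t s' => ∃ F : ℕ → Finset (Fin m), (∀ i j : Fin n, (i : ℕ) < t → (i : ℕ) < k →
        s.nat 40 i 0 = j → I.IsSteinerTree {x i, y j, I.root} (F i) ∧ I.treeCost (F i) ≤ c i j) ∧
      ∀ e : Fin m, s'.nat 3 e 0 = ((Finset.range (min t k)).filter fun i => e ∈ F i).card) ?_ ?_
  · rw [hl.size_false, min_eq_right hkn] at key
    obtain ⟨F, hF, he⟩ := key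
    exact ⟨F, fun i j hi hij => hF i j i.2 hi hij, he⟩
  · refine ⟨fun _ => ∅, by simp, fun e => ?_⟩
    rw [State.writeNat_nat_of_ne _ (by decide), h3]
    simp
  rintro t s1 ht hc hn hr ⟨F, hF, hFe⟩
  rw [hl.size_false] at ht
  rw [State.writeNat_nat_of_ne _ (by decide), Prog.run]
  have htest : Test.Holds s1 (.natLe (.add (.reg 64) (.lit 1)) (.reg 8)) ↔ t < k := by
    simp only [Test.Holds, NExp.eval, NExp.reg, hc, hn 8 (by decide), hk]
    exact Nat.succ_le_iff
  by_cases htk : t < k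
  swap
  · rw [if_neg (mt htest.1 htk)]
    refine ⟨F, fun i j hi hik hij => hF i j (by omega) hik hij, ?_⟩
    rw [min_eq_right (by omega)]
    rwa [min_eq_right (by omega)] at hFe
  rw [if_pos (htest.2 htk), Prog.run]
  rw [min_eq_left htk.le] at hFe
  have hl1 : Loaded I s1 := hl.of_frame hn hr (by decide) (by decide)
  obtain ⟨i, rfl⟩ : ∃ i : Fin n, (i : ℕ) = t := ⟨⟨t, ht⟩, rfl⟩
  obtain ⟨j, hj⟩ : ∃ j : Fin n, s.nat 40 i 0 = j :=
    ⟨⟨s.nat 40 i 0, (hmu i htk).trans_le hkn⟩, rfl⟩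
  -- A center has been recorded because the root itself qualifies; subtracting one from the entry
  -- recovers it.
  obtain ⟨z, hz, hzr, hcz, -⟩ := (hbest i j).resolve_left fun h =>
    h.2 I.root I.root.2 (.refl _ _ _)
  set s2 := (Prog.setNat 10 (.lit 0) (.lit 0)
    (.sub (.get 30 (.reg 64) (.get 40 (.reg 64) (.lit 0))) (.lit 1))).run s1 with hs2
  have hn2 : ∀ b ≠ 10, s2.nat b = s1.nat b := fun b hb => State.writeNat_nat_of_ne _ hb _ _ _
  have hl2 : Loaded I s2 := hl1.run (by decide) (by decide)
  have h10 : s2.nat 10 0 0 = z := by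
    simp only [hs2, Prog.run, State.writeNat_nat_self, NExp.eval, NExp.reg, hc,
      hn 40 (by decide), hn 30 (by decide), hj, hz]
    simp
  clear_value s2
  rw [Prog.run]
  obtain ⟨hT, hcl⟩ := run_shortestPathTree hl2 h10 rfl
  have hl3 : Loaded I (shortestPathTree.run s2) := hl2.run (by decide) (by decide)
  have hn3 : ∀ b, b ∉ shortestPathTree.natWrites → b ≠ 10 →
      (shortestPathTree.run s2).nat b = s1.nat b := fun b hb hb' => by
    rw [Prog.run_nat_of_notMem hb, hn2 b hb']
  set s3 := shortestPathTree.run s2 with hs3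
  clear_value s3
  have h64 : s3.nat 64 0 0 = i := by rw [hn3 64 (by decide) (by decide), hc]
  have hinst := run_installTree hl3 (a := x i) (b := y j)
    (by rw [h64, hn3 4 (by decide) (by decide), hn 4 (by decide), hx])
    (by rw [h64, hn3 40 (by decide) (by decide), hn 40 (by decide), hj,
      hn3 5 (by decide) (by decide), hn 5 (by decide), hy])
  set A := treePath n m s3 (x i) ∪ treePath n m s3 (y j) ∪ treePath n m s3 I.root with hA
  have hxz := hT.mem_of_reachable hcl (hzr.trans (hxr i).symm)
  have hyz := hT.mem_of_reachable hcl (hzr.trans (hyr j).symm)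
  have hrz := hT.mem_of_reachable hcl hzr
  refine ⟨Function.update F i A, fun i' j' hi' hik hij => ?_, fun e => ?_⟩
  · by_cases hii : i' = i
    · subst hii
      obtain rfl : j = j' := Fin.ext (hj.symm.trans hij)
      rw [Function.update_self]
      refine ⟨hT.isSteinerTree hxz hyz hrz, (hT.treeCost_union_le hxz hyz hrz).trans_eq ?_⟩
      rw [hcz, hT.eq_dist hxz, hT.eq_dist hyz, hT.eq_dist hrz]
      rfl
    · have : (i' : ℕ) ≠ i := fun h => hii (Fin.ext h)
      rw [Function.update_of_ne this]
      exact hF i' j' (by omega) hik hij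
  · rw [hinst, hn3 3 (by decide) (by decide), hFe, min_eq_left (by omega), Finset.range_add_one,
      Finset.filter_insert, Function.update_self]
    have hcongr : (Finset.range i).filter (fun l => e ∈ Function.update F i A l) =
        (Finset.range i).filter fun l => e ∈ F l :=
      Finset.filter_congr fun l hl => by
        rw [Function.update_of_ne (Finset.mem_range.1 hl).ne]
    rw [hcongr]
    split_ifs with h
    · rw [Finset.card_insert_of_notMem (by simp)]
    · rfl

end

end Machine

/-! ### From the computed data to an output of the algorithm -/

namespace SandInstance

variable {V E : Type*}

/-- Minimum Steiner trees for the pairs of a matching that is optimal by duality form an output of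
the matching algorithm. -/
theorem isMatchingOutput_of_prices {I : SandInstance V E} {k : ℕ} (φ : Fin k ≃ I.GreenSide)
    (ψ : Fin k ≃ I.BlueSide) (σ : Equiv.Perm (Fin k)) {w : Fin k → Fin k → ℝ} {u v : Fin k → ℝ}
    (hw : ∀ i j T, I.IsMinSteinerTree {I.greenVertex (φ i), I.blueVertex (ψ j), I.root} T →
      I.treeCost T = w i j)
    (hex : ∀ i j, ∃ T, I.IsMinSteinerTree {I.greenVertex (φ i), I.blueVertex (ψ j), I.root} T)
    (dual : ∀ i j, u i + v j ≤ w i j) (tight : ∀ i, u i + v (σ i) = w i (σ i))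
    {F : ℕ → Finset E}
    (hF : ∀ i : Fin k,
      I.IsMinSteinerTree {I.greenVertex (φ i), I.blueVertex (ψ (σ i)), I.root} (F i))
    {x : E → ℕ} (hx : ∀ e, x e = {i | i < k ∧ e ∈ F i}.ncard) : I.IsMatchingOutput x := by
  classical
  choose T hT using hex
  -- The family of trees uses the installed ones on matched pairs and arbitrary minimum trees
  -- elsewhere. All choices have the same costs, so the prices still certify the matching.
  have hT' : ∀ g b, I.IsMinSteinerTree {I.greenVertex g, I.blueVertex b, I.root}
      (if b = ψ (σ (φ.symm g)) then F (φ.symm g) else T (φ.symm g) (ψ.symm b)) := by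
    intro g b
    split_ifs with h
    · simpa [h] using hF (φ.symm g)
    · simpa using hT (φ.symm g) (ψ.symm b)
  refine ⟨_, (φ.symm.trans σ).trans ψ, hT', fun M => ?_, fun e => ?_⟩
  · have hcost : ∀ g b, I.treeCost
        (if b = ψ (σ (φ.symm g)) then F (φ.symm g) else T (φ.symm g) (ψ.symm b)) =
        w (φ.symm g) (ψ.symm b) := fun g b => hw _ _ _ (by simpa using hT' g b)
    simp only [hcost]
    rw [← Equiv.sum_comp φ, ← Equiv.sum_comp φ]
    simp only [Equiv.trans_apply, Equiv.symm_apply_apply, ← tight]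
    refine le_trans (le_of_eq ?_) (Finset.sum_le_sum fun i _ => dual i (ψ.symm (M (φ i))))
    rw [Finset.sum_add_distrib, Finset.sum_add_distrib, Equiv.sum_comp σ v]
    congr 1
    exact (Equiv.sum_comp ((φ.trans M).trans ψ.symm) v).symm
  · have hinj : Function.Injective fun g : I.GreenSide => (φ.symm g : ℕ) :=
      Fin.val_injective.comp φ.symm.injective
    rw [hx, ← Set.ncard_image_of_injective _ hinj]
    congr 1
    ext i
    simp only [Equiv.trans_apply, if_true, Set.mem_ofPred_eq, Set.mem_image]
    constructor
    · rintro ⟨hi, he⟩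
      exact ⟨φ ⟨i, hi⟩, by simpa using he, by simp⟩
    · rintro ⟨g, hg, rfl⟩
      exact ⟨(φ.symm g).2, hg⟩

end SandInstance

namespace Machine

section

variable {n m : ℕ} {I : SandInstance (Fin n) (Fin m)}

theorem BestCenter.exists_center {a b : Fin n} {q : ℕ} {c : ℝ} (h : BestCenter I a b n q c) :
    ∃ z : Fin n, I.Reachable z I.root ∧ c = I.starCost a b z ∧
      ∀ z' : Fin n, I.Reachable z' I.root → c ≤ I.starCost a b z' := by
  rcases h with ⟨-, h⟩ | ⟨z, -, hz, hc, h⟩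
  · exact absurd (.refl _ _ _) (h I.root I.root.2)
  · exact ⟨z, hz, hc, fun z' hz' => h z' z'.2 hz'⟩

theorem BestCenter.nonneg {a b : Fin n} {q : ℕ} {c : ℝ} (h : BestCenter I a b n q c) : 0 ≤ c := by
  obtain ⟨z, -, rfl, -⟩ := h.exists_center
  exact add_nonneg (add_nonneg (I.dist_nonneg _ _) (I.dist_nonneg _ _)) (I.dist_nonneg _ _)

theorem BestCenter.le_treeCost {a b : Fin n} {q : ℕ} {c : ℝ} (h : BestCenter I a b n q c)
    {T : Finset (Fin m)} (hT : I.IsSteinerTree {a, b, I.root} T) : c ≤ I.treeCost T := by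
  obtain ⟨-, -, -, hmin⟩ := h.exists_center
  obtain ⟨z, hz, hle⟩ := hT.exists_starCost_le
  exact (hmin z hz).trans hle

/-- Every Steiner tree costs at least some star, and a minimum one costs at most each star, in
particular the best. -/
theorem BestCenter.treeCost_eq {a b : Fin n} {q : ℕ} {c : ℝ} (h : BestCenter I a b n q c)
    (ha : I.Reachable a I.root) (hb : I.Reachable b I.root) {T : Finset (Fin m)}
    (hT : I.IsMinSteinerTree {a, b, I.root} T) : I.treeCost T = c := by
  refine le_antisymm ?_ (h.le_treeCost hT.1)
  obtain ⟨z, hz, rfl, -⟩ := h.exists_center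
  exact hT.le_starCost ha hb hz

end

/-- The matching algorithm. -/
def matchingAlgorithm : Prog :=
  .seq (listSide 4 6 0) (.seq (listSide 5 7 1)
    (.seq (.setNat 8 (.lit 0) (.lit 0) (.add (.reg 7) (.sub (.reg 6) (.reg 7))))
      (.seq steinerCosts (.seq hungarian installTrees))))

theorem wellFormed_matchingAlgorithm : matchingAlgorithm.WellFormed := by
  repeat' first | exact trivial | apply And.intro | decide

theorem notMem_natWrites_matchingAlgorithm : 0 ∉ matchingAlgorithm.natWrites := by decide

theorem loaded_input {n m : ℕ} (I : SandInstance (Fin n) (Fin m)) : Loaded I (input I) :=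
  ⟨rfl, rfl, rfl, rfl⟩

theorem inputNat_of_le {n m a : ℕ} (I : SandInstance (Fin n) (Fin m)) (ha : 3 ≤ a) (i j : ℕ) :
    inputNat I a i j = 0 := by
  obtain ⟨a, rfl⟩ := Nat.exists_eq_add_of_le' ha
  rfl

theorem inputReal_of_le {n m a : ℕ} (I : SandInstance (Fin n) (Fin m)) (ha : 1 ≤ a) (i j : ℕ) :
    inputReal I a i j = 0 := by
  obtain ⟨a, rfl⟩ := Nat.exists_eq_add_of_le' ha
  rfl

/-- Feasibility of the instance is used only for reachability: every listed vertex is a terminal or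
the root, so it is connected to the root. The computed star costs are then exactly the minimum tree
costs. -/
theorem isMatchingOutput_run {n m : ℕ} {I : SandInstance (Fin n) (Fin m)}
    {y : Fin m → ℕ} (hy : I.Feasible y) :
    I.IsMatchingOutput (output m (matchingAlgorithm.run (input I))) := by
  have hl := loaded_input I
  change I.IsMatchingOutput (output m (installTrees.run (hungarian.run (steinerCosts.run
    ((Prog.setNat 8 (.lit 0) (.lit 0) (.add (.reg 7) (.sub (.reg 6) (.reg 7)))).run
      ((listSide 5 7 1).run ((listSide 4 6 0).run (input I))))))))
  obtain ⟨hA, hA6⟩ := run_listSide (a := 4) (l := 6) (f := 0) hl I.green (by decide) (by decide)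
    (by decide) (by decide) (by decide) fun v => by
      by_cases h : v ∈ I.green <;> simp [input, inputNat, h]
  have hl1 : Loaded I ((listSide 4 6 0).run (input I)) := hl.run (by decide) (by decide)
  have hn1 : ∀ b ∉ (listSide 4 6 0).natWrites,
      ((listSide 4 6 0).run (input I)).nat b = inputNat I b :=
    fun b hb => Prog.run_nat_of_notMem hb _
  have hr1 : ∀ b, ((listSide 4 6 0).run (input I)).real b = inputReal I b :=
    fun b => Prog.run_real_of_notMem (by simp [listSide, Prog.realWrites]) _
  set s1 := (listSide 4 6 0).run (input I) with hs1
  clear_value s1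
  obtain ⟨hB, hB7⟩ := run_listSide (a := 5) (l := 7) (f := 1) hl1 I.blue (by decide) (by decide)
    (by decide) (by decide) (by decide) fun v => by
      rw [hn1 2 (by decide)]
      by_cases h : v ∈ I.blue <;> simp [inputNat, h]
  have hl2 : Loaded I ((listSide 5 7 1).run s1) := hl1.run (by decide) (by decide)
  have hn2 : ∀ b ∉ (listSide 5 7 1).natWrites, ((listSide 5 7 1).run s1).nat b = s1.nat b :=
    fun b hb => Prog.run_nat_of_notMem hb _
  have hr2 : ∀ b, ((listSide 5 7 1).run s1).real b = inputReal I b :=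
    fun b => (Prog.run_real_of_notMem (by simp [listSide, Prog.realWrites]) _).trans (hr1 b)
  set s2 := (listSide 5 7 1).run s1 with hs2
  clear_value s2
  set s3 := (Prog.setNat 8 (.lit 0) (.lit 0) (.add (.reg 7) (.sub (.reg 6) (.reg 7)))).run s2
    with hs3
  obtain ⟨k, hk⟩ : ∃ k, k = I.blue.card + (I.green.card - I.blue.card) := ⟨_, rfl⟩
  have hkn : k ≤ n := by
    have h1 := I.blue.card_le_univ
    have h2 := I.green.card_le_univ
    rw [Fintype.card_fin] at h1 h2
    omega
  have h8 : s3.nat 8 0 0 = k := by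
    rw [hk, ← hA6, ← hB7, ← hn2 6 (by decide)]
    simp [hs3, Prog.run, State.writeNat, NExp.eval, NExp.reg]
  have hn3 : ∀ b ≠ 8, s3.nat b = s2.nat b := fun b hb => State.writeNat_nat_of_ne _ hb _ _ _
  have hr3 : ∀ b, s3.real b = inputReal I b := hr2
  have hl3 : Loaded I s3 := hl2.run (by decide) (by decide)
  clear_value s3
  choose a ha har using fun i : Fin n => hA.exists_vertex i.2
  choose b hb hbr using fun i : Fin n => hB.exists_vertex i.2
  have har' : ∀ i, I.Reachable (a i) I.root := fun i => (har i).elim hy.1.reachable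
    fun h => h ▸ .refl _ _ _
  have hbr' : ∀ i, I.Reachable (b i) I.root := fun i => (hbr i).elim hy.2.reachable
    fun h => h ▸ .refl _ _ _
  have ha3 : ∀ i : Fin n, s3.nat 4 i 0 = a i := fun i => by
    rw [hn3 4 (by decide), hn2 4 (by decide), ha]
  have hb3 : ∀ i : Fin n, s3.nat 5 i 0 = b i := fun i => by rw [hn3 5 (by decide), hb]
  have hz3 : ∀ c ∈ [3, 30], ∀ i j, s3.nat c i j = 0 := by
    intro c hc i j
    fin_cases hc <;>
    rw [hn3 _ (by decide), hn2 _ (by decide), hn1 _ (by decide), inputNat_of_le I (by decide)]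
  have hbest := run_steinerCosts hl3 ha3 hb3 har' hbr' (hz3 30 (by simp))
  have hl4 : Loaded I (steinerCosts.run s3) := hl3.run (by decide) (by decide)
  have hn4 : ∀ b ∉ steinerCosts.natWrites, (steinerCosts.run s3).nat b = s3.nat b :=
    fun b hb => Prog.run_nat_of_notMem hb _
  have hr4 : ∀ b ∉ steinerCosts.realWrites, (steinerCosts.run s3).real b = inputReal I b :=
    fun b hb => (Prog.run_real_of_notMem hb _).trans (hr3 b)
  set s4 := steinerCosts.run s3 with hs4
  clear_value s4
  have hmatch : TightMatching k k (s4.real 3) (fun i => (hungarian.run s4).nat 40 i 0)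
      (fun i => (hungarian.run s4).real 4 i 0) fun j => (hungarian.run s4).real 5 j 0 :=
    run_hungarian hl4.size_false hkn (by rw [hn4 8 (by decide), h8])
    (fun i hi j hj => (hbest ⟨i, hi.trans_le hkn⟩ ⟨j, hj.trans_le hkn⟩).nonneg)
    -- The prices live in the real arrays 4 and 5, which are still zero; the natural-number arrays
    -- with these numbers hold the lists of terminals.
    (fun i => by rw [hr4 4 (by decide), inputReal_of_le I (by decide)])
    fun i => by rw [hr4 5 (by decide), inputReal_of_le I (by decide)]
  have hl5 : Loaded I (hungarian.run s4) := hl4.run (by decide) (by decide)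
  have hn5 : ∀ b ∉ hungarian.natWrites, (hungarian.run s4).nat b = s4.nat b :=
    fun b hb => Prog.run_nat_of_notMem hb _
  set s5 := hungarian.run s4 with hs5
  clear_value s5
  obtain ⟨F, hF, hout⟩ := run_installTrees hl5 hkn
    (by rw [hn5 8 (by decide), hn4 8 (by decide), h8])
    (fun i => by rw [hn5 4 (by decide), hn4 4 (by decide), ha3])
    (fun i => by rw [hn5 5 (by decide), hn4 5 (by decide), hb3]) har' hbr'
    (fun e => by rw [hn5 3 (by decide), hn4 3 (by decide), hz3 3 (by simp)]) hmatch.lt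
    fun i j => by rw [hn5 30 (by decide)]; exact hbest i j
  obtain ⟨σ, hσ⟩ := hmatch.exists_perm
  obtain ⟨φ, hφ⟩ := hA.exists_equiv (d := I.blue.card - I.green.card) (by omega) hkn
  obtain ⟨ψ, hψ⟩ := hB.exists_equiv (d := I.green.card - I.blue.card) hk hkn
  have hφ' : ∀ i, I.greenVertex (φ i) = a (i.castLE hkn) := by
    intro i
    refine Fin.ext (Eq.trans ?_ ((hφ i).trans (ha (i.castLE hkn))))
    rcases φ i with v | v <;> rfl
  have hψ' : ∀ i, I.blueVertex (ψ i) = b (i.castLE hkn) := by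
    intro i
    refine Fin.ext (Eq.trans ?_ ((hψ i).trans (hb (i.castLE hkn))))
    rcases ψ i with v | v <;> rfl
  refine SandInstance.isMatchingOutput_of_prices φ ψ σ (w := fun i j => s4.real 3 i j)
    (u := fun i => s5.real 4 i 0) (v := fun j => s5.real 5 j 0) (F := F)
    (fun i j T hT => ?_) (fun i j => ?_) (fun i j => hmatch.dual i i.2 j j.2) (fun i => ?_)
    (fun i => ?_) fun e => ?_
  · rw [hφ', hψ'] at hT
    exact (hbest (i.castLE hkn) (j.castLE hkn)).treeCost_eq (har' _) (hbr' _) hT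
  · rw [hφ', hψ']
    exact SandInstance.exists_isMinSteinerTree (har' _) (hbr' _)
  · have := hmatch.tight i i.2
    simp only [← hσ] at this
    exact this
  · rw [hφ', hψ']
    obtain ⟨h1, h2⟩ := hF (i.castLE hkn) ((σ i).castLE hkn) i.2 (hσ i).symm
    -- The installed tree costs at most the best star, and no Steiner tree is cheaper than that.
    exact ⟨h1, fun T hT => h2.trans ((hbest _ _).le_treeCost hT)⟩
  · rw [output, hout, ← Set.ncard_coe_finset]
    congr 1
    ext i
    simp

end Machine

theorem mainTheorem2 :
    (∀ {V E : Type*} [Finite V] [Fintype E] (I : SandInstance V E),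
      (∃ y, I.Feasible y) →
      ∃ opt : ℝ, IsLeast {c | ∃ y, I.Feasible y ∧ I.totalCost y = c} opt ∧
        ∀ x, I.IsMatchingOutput x → I.Feasible x ∧ I.totalCost x ≤ 3 / 2 * opt) ∧
    (∃ (prog : Machine.Cmd) (q : Polynomial ℕ),
      ∀ (n m : ℕ) (I : SandInstance (Fin n) (Fin m)),
        (∃ y, I.Feasible y) →
        ∃ (t : ℕ) (s : Machine.State),
          Machine.Exec prog (Machine.input I) t s ∧ t ≤ q.eval (n + m) ∧
            I.IsMatchingOutput (Machine.output m s)) := by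
  constructor
  · rintro V E _ _ I hI
    obtain ⟨opt, hopt⟩ := I.exists_isLeast_totalCost hI
    refine ⟨opt, hopt, fun x hx => ?_⟩
    obtain ⟨⟨y, hy, rfl⟩, -⟩ := hopt
    refine ⟨hx.feasible, (hx.totalCost_le hy).trans ?_⟩
    have : 0 ≤ I.totalCost y := Finset.sum_nonneg fun e _ =>
      mul_nonneg (I.cost_nonneg e) (Nat.cast_nonneg _)
    -- The proved factor 4/3 is weakened to 3/2, using that the optimum is nonnegative.
    linarith
  · obtain ⟨q, hq⟩ := Machine.matchingAlgorithm.exists_polynomial_timeBound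
    refine ⟨Machine.matchingAlgorithm.compile, q, fun n m I ⟨y, hy⟩ => ?_⟩
    obtain ⟨t, ht, hexec⟩ := Machine.Prog.exec_compile (N := n + m)
      Machine.wellFormed_matchingAlgorithm Machine.notMem_natWrites_matchingAlgorithm
      (s := Machine.input I) (by
        rintro (_ | _)
        · exact (Machine.loaded_input I).size_false.trans_le (Nat.le_add_right _ _)
        · exact (Machine.loaded_input I).size_true.trans_le (Nat.le_add_left _ _))
    exact ⟨t, _, hexec, ht.trans_eq (hq _), Machine.isMatchingOutput_run hy⟩
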